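/- Let $\mathcal C\subset\mathbb P^n\times\mathbb P^1$ be an irreducible complex projective curve whose projection $\pi:\mathcal C\to\mathbb P^1$ is dominant. Let $\mathcal B\subset\mathbb P^1$ be the branch locus of $\pi$, that is, the set of points whose fiber does not have $\deg\pi$ points, where the degree of a map is the number of points in its general fiber. A witness set $W_\pi$ consists of bihomogeneous polynomials $f_1,\dots,f_k$ having $\mathcal C$ as an irreducible component of their common zero set, a point $q\in\mathbb P^1\setminus\mathcal B$, and the set $\pi^{-1}(q)$ of witness points. The Galois (monodromy) group $\mathcal G_\pi$ is the group of permutations of $\pi^{-1}(q)$ obtained by lifting to $\mathcal C$ the loops in $\mathbb P^1\setminus\mathcal B$ based at $q$. A block is a subset $S$ of $\pi^{-1}(q)$ such that, for every $\gamma\in\mathcal G_\pi$, $\gamma S\cap S$ is empty or $\gamma S=S$; $\mathcal G_\pi$ is imprimitive if it has a block other than $\emptyset$, the singletons and $\pi^{-1}(q)$. A decomposition $\pi=\alpha\circ\beta$ (first $\alpha$, then $\beta$) consists of a nonempty Zariski-open set $U\subseteq\mathbb P^1$, a variety $V$ and dominant finite morphisms $\pi^{-1}(U)\xrightarrow{\alpha}V\xrightarrow{\beta}U$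 whose composite is $\pi$. The point $q$ is general for the decomposition if $q\in U$ and $\beta^{-1}(q)$ has exactly $\deg\beta$ points. For a decomposition for which $q$ is general, an $\alpha$-factor of $W_\pi$ is a set of $\deg\alpha$ distinct witness points that map to the same point under $\alpha$, and a $\beta$-factor is a set of $\deg\beta$ distinct witness points that map to pairwise distinct points under $\alpha$. Suppose that $W_\pi$ has $ab$ witness points, where $a,b>1$, and that $\mathcal G_\pi$ is imprimitive. Let $A$ and $B$ be sets of $a$ and $b$ distinct witness points, respectively. Then: 1. There is a decomposition $\pi=\alpha\circ\beta$, with $q$ general for it, such that $A$ is an $\alpha$-factor and $B$ is a $\beta$-factor if and only if $A$ is a block of $\mathcal G_\pi$ and $B$ is a set of representatives for $\{\gamma A\}_{\gamma\in\mathcal G_\pi}$, i.e. $\gamma A\cap B$ is exactly one point for each $\gamma\in\mathcal G_\pi$. 2. There is a decomposition $\pi=\alpha\circ\beta$, with $q$ general for it, such that $A$ is an $\alpha$-factor if and only if $A$ is a block of $\mathcal G_\pi$. 3. For every decomposition $\pi=\alpha\circ\beta$, with $q$ general for it, such that $A$ is an $\alpha$-factor: $B$ is a $\beta$-factor if and only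 if $B$ is a set of representatives for $\{\gamma A\}_{\gamma\in\mathcal G_\pi}$. -/

import Mathlib

open scoped LinearAlgebra.Projectivization Topology Pointwise

noncomputable section

namespace Decomposable

/-! ### Spaces with homogeneous coordinates

The ambient spaces are `ℂ^N`, `ℙⁿ` and `ℙⁿ × ℙᵐ`.  For each of them `form d` is the set of
functions `x ↦ F(coordinates of x)` where `F` runs over the (bi)homogeneous polynomials of degree
`d`.  For a projective space the coordinates are those of the chosen representative; the zero locus
of a form, and the quotient of two forms of equal degree, do not depend on that choice. -/

/-- Complex projective space `ℙⁿ`. -/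
abbrev PSpace (n : ℕ) : Type := ℙ ℂ (Fin (n + 1) → ℂ)

/-- The functions on an ambient space that are given by forms of a given degree. -/
class HasForms (M : Type) where
  /-- the degrees of forms -/
  Deg : Type
  /-- the forms of degree `d`, evaluated at the coordinates of the points -/
  form : Deg → Set (M → ℂ)

/-- A polynomial in `x₀, …, xₙ` and `t₀, …, tₘ` that is homogeneous of degree `d.1` in `x`
and homogeneous of degree `d.2` in `t`. -/
def IsBihomogeneous {n m : ℕ} (F : MvPolynomial (Fin (n + 1) ⊕ Fin (m + 1)) ℂ) (d : ℕ × ℕ) :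
    Prop :=
  F.IsWeightedHomogeneous
    (Sum.elim (fun _ => ((1, 0) : ℕ × ℕ)) (fun _ => ((0, 1) : ℕ × ℕ))) d

/-- The value of a bihomogeneous polynomial at the coordinates of a point of `ℙⁿ × ℙᵐ`. -/
def evalAt {n m : ℕ} (F : MvPolynomial (Fin (n + 1) ⊕ Fin (m + 1)) ℂ)
    (p : PSpace n × PSpace m) : ℂ :=
  MvPolynomial.eval (Sum.elim p.1.rep p.2.rep) F

instance affineForms (N : ℕ) : HasForms (Fin N → ℂ) where
  Deg := Unit
  form _ := {φ | ∃ F : MvPolynomial (Fin N) ℂ, φ = fun x => MvPolynomial.eval x F}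

instance projectiveForms (n : ℕ) : HasForms (PSpace n) where
  Deg := ℕ
  form d := {φ | ∃ F : MvPolynomial (Fin (n + 1)) ℂ,
    F.IsHomogeneous d ∧ φ = fun x => MvPolynomial.eval x.rep F}

instance biprojectiveForms (n m : ℕ) : HasForms (PSpace n × PSpace m) where
  Deg := ℕ × ℕ
  form d := {φ | ∃ F : MvPolynomial (Fin (n + 1) ⊕ Fin (m + 1)) ℂ,
    IsBihomogeneous F d ∧ φ = evalAt F}

/-- The Zariski topology: the sets where a form does not vanish are a basis of open sets. -/
abbrev zariski (M : Type) [HasForms M] : TopologicalSpace M :=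
  TopologicalSpace.generateFrom {W | ∃ d, ∃ φ ∈ HasForms.form (M := M) d, W = {x | φ x ≠ 0}}

/-- The classical (complex) topology of `ℙⁿ`, as a quotient of `ℂⁿ⁺¹ ∖ {0}`. It is the instance on
`ℙⁿ`, and `ℙⁿ × ℙᵐ` carries the product topology; the Zariski topology is always named. -/
instance classicalTopology (n : ℕ) : TopologicalSpace (PSpace n) :=
  TopologicalSpace.coinduced (Projectivization.mk' ℂ) inferInstance

/-! ### Regular functions and morphisms of quasi-projective varieties -/

section Morphisms

variable {M M' : Type} [HasForms M] [HasForms M']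

/-- `h` is a regular function on the locally closed set `X`: near each point of `X` it is a
quotient of two forms of the same degree.  (The neighbourhood can be taken to be the set where the
denominator does not vanish: multiply both forms by a third one.) -/
def IsRegularFun (X : Set M) (h : M → ℂ) : Prop :=
  ∀ p ∈ X, ∃ d, ∃ φ ∈ HasForms.form (M := M) d, ∃ ψ ∈ HasForms.form (M := M) d,
    ψ p ≠ 0 ∧ ∀ x ∈ X, ψ x ≠ 0 → h x = φ x / ψ x

/-- `f` restricts to a morphism `X → Y` of locally closed sets: it is Zariski-continuous and pulls
back regular functions on open subsets of `Y` to regular functions.  The values of `f` outside `X`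
are irrelevant. -/
structure IsRegularMap (f : M → M') (X : Set M) (Y : Set M') : Prop where
  mapsTo : Set.MapsTo f X Y
  continuousOn : @ContinuousOn M M' (zariski M) (zariski M') f X
  pullback : ∀ W : Set M', IsOpen[zariski M'] W → ∀ h : M' → ℂ,
    IsRegularFun (Y ∩ W) h → IsRegularFun (X ∩ f ⁻¹' W) (h ∘ f)

/-- `X` is an affine variety: it is isomorphic to a Zariski-closed subset of some `ℂ^N`. -/
def IsAffineVariety (X : Set M) : Prop :=
  ∃ (N : ℕ) (Z : Set (Fin N → ℂ)), IsClosed[zariski (Fin N → ℂ)] Z ∧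
    ∃ (f : M → (Fin N → ℂ)) (g : (Fin N → ℂ) → M),
      IsRegularMap f X Z ∧ IsRegularMap g Z X ∧ Set.InvOn g f X Z

/-- `f : X → Y` is a finite morphism: `Y` is covered by affine open sets `Y ∩ W` whose preimages
are affine, with every regular function on the preimage integral over the regular functions on
`Y ∩ W`. -/
structure IsFiniteMorphism (f : M → M') (X : Set M) (Y : Set M') : Prop where
  regular : IsRegularMap f X Y
  finite : ∀ y ∈ Y, ∃ W : Set M', IsOpen[zariski M'] W ∧ y ∈ W ∧
    IsAffineVariety (Y ∩ W) ∧ IsAffineVariety (X ∩ f ⁻¹' W) ∧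
    ∀ h : M → ℂ, IsRegularFun (X ∩ f ⁻¹' W) h →
      ∃ (k : ℕ) (c : Fin k → M' → ℂ), (∀ i, IsRegularFun (Y ∩ W) (c i)) ∧
        ∀ x ∈ X ∩ f ⁻¹' W, h x ^ k + ∑ i : Fin k, c i (f x) * h x ^ (i : ℕ) = 0

/-- `f : X → Y`, with `Y` irreducible, has degree `d`: the fiber over a general point of `Y`
consists of exactly `d` points. -/
def HasDegree (f : M → M') (X : Set M) (Y : Set M') (d : ℕ) : Prop :=
  ∃ W : Set M', IsOpen[zariski M'] W ∧ (Y ∩ W).Nonempty ∧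
    ∀ y ∈ Y ∩ W, (X ∩ f ⁻¹' {y}).encard = d

end Morphisms

/-! ### The curve, its projection, and the monodromy group -/

section Curve

variable {n : ℕ}

/-- `C` is an irreducible (projective) curve in `ℙⁿ × ℙ¹`. -/
structure IsIrreducibleCurve (C : Set (PSpace n × PSpace 1)) : Prop where
  closed : IsClosed[zariski (PSpace n × PSpace 1)] C
  irreducible : @IsIrreducible _ (zariski (PSpace n × PSpace 1)) C
  dim_one : @topologicalKrullDim C
    (TopologicalSpace.induced Subtype.val (zariski (PSpace n × PSpace 1))) = 1

/-- The projection `π : C → ℙ¹` is dominant. -/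
def IsDominantProjection (C : Set (PSpace n × PSpace 1)) : Prop :=
  @Dense _ (zariski (PSpace 1)) (Prod.snd '' C)

/-- The fiber `π⁻¹(q)` of the projection `π : C → ℙ¹`. -/
def fiber (C : Set (PSpace n × PSpace 1)) (q : PSpace 1) : Set (PSpace n × PSpace 1) :=
  C ∩ Prod.snd ⁻¹' {q}

/-- The branch locus of `π : C → ℙ¹`: the points whose fiber does not have `deg π` points. -/
def branchLocus (C : Set (PSpace n × PSpace 1)) : Set (PSpace 1) :=
  {q | ¬ ∃ d : ℕ, HasDegree Prod.snd C (Set.univ : Set (PSpace 1)) d ∧ (fiber C q).encard = d}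

/-- `σ` is the permutation of `π⁻¹(q)` induced by the loop `γ`: the lift of `γ` to `C` that
starts at `p` ends at `σ p`, for every point `p` of the fiber. -/
def IsInducedBy (C : Set (PSpace n × PSpace 1)) {q : PSpace 1} (γ : Path q q)
    (σ : Equiv.Perm (fiber C q)) : Prop :=
  ∀ p : fiber C q, ∃ Γ : Path (p : PSpace n × PSpace 1) (σ p : PSpace n × PSpace 1),
    ∀ s : unitInterval, Γ s ∈ C ∧ (Γ s).2 = γ s

/-- The Galois/monodromy group `G_π` based at a point `q` outside the branch locus: the
permutations of the fiber `π⁻¹(q)` induced by the loops in `ℙ¹ ∖ branchLocus` based at `q`. -/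
def monodromyGroup (C : Set (PSpace n × PSpace 1)) (q : PSpace 1) (hq : q ∉ branchLocus C) :
    Subgroup (Equiv.Perm (fiber C q)) where
  carrier := {σ | ∃ γ : Path q q, (∀ s, γ s ∉ branchLocus C) ∧ IsInducedBy C γ σ}
  one_mem' := by
    refine ⟨Path.refl q, fun s => by simpa using hq, fun p => ⟨Path.refl _, fun s => ?_⟩⟩
    exact ⟨p.2.1, p.2.2⟩
  mul_mem' := by
    rintro σ τ ⟨γ, hγ, hσ⟩ ⟨δ, hδ, hτ⟩
    refine ⟨δ.trans γ, fun s => ?_, fun p => ?_⟩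
    · rw [Path.trans_apply]
      split_ifs
      · exact hδ _
      · exact hγ _
    · obtain ⟨Γ, hΓ⟩ := hτ p
      obtain ⟨Δ, hΔ⟩ := hσ (τ p)
      have h : (σ (τ p) : PSpace n × PSpace 1) = ((σ * τ) p : fiber C q) := rfl
      refine ⟨(Γ.trans Δ).cast rfl h.symm, fun s => ?_⟩
      rw [Path.cast_coe, Path.trans_apply, Path.trans_apply]
      split_ifs
      · exact hΓ _
      · exact hΔ _
  inv_mem' := by
    rintro σ ⟨γ, hγ, hσ⟩
    refine ⟨γ.symm, fun s => hγ _, fun p => ?_⟩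
    obtain ⟨Γ, hΓ⟩ := hσ (σ⁻¹ p)
    have h : (p : PSpace n × PSpace 1) = (σ (σ⁻¹ p) : fiber C q) := by simp
    exact ⟨(Γ.cast rfl h).symm, fun s => hΓ _⟩

/-- A permutation group is imprimitive if it has a block other than the empty set, the
singletons and the whole set. -/
def IsImprimitive {X : Type} (G : Subgroup (Equiv.Perm X)) : Prop :=
  ∃ S : Set X, MulAction.IsBlock G S ∧ ¬ MulAction.IsTrivialBlock S

/-- A witness set of the projection `π : C → ℙ¹`: polynomials that witness `C`, that is, `C` is an
irreducible component of their common zero set, and a point `q` outside the branch locus,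
which gives the witness point set `π⁻¹(q)`. -/
structure WitnessSet (C : Set (PSpace n × PSpace 1)) where
  eqs : Finset (MvPolynomial (Fin (n + 1) ⊕ Fin (1 + 1)) ℂ)
  bihomogeneous : ∀ f ∈ eqs, ∃ d, IsBihomogeneous f d
  component : Maximal (fun S : Set (PSpace n × PSpace 1) =>
    @IsIrreducible _ (zariski (PSpace n × PSpace 1)) S ∧ ∀ x ∈ S, ∀ f ∈ eqs, evalAt f x = 0) C
  q : PSpace 1
  q_notMem : q ∉ branchLocus C

namespace WitnessSet

variable {C : Set (PSpace n × PSpace 1)} (W : WitnessSet C)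

/-- The witness points: the elements of `π⁻¹(q)`. -/
abbrev Point : Type := fiber C W.q

/-- The Galois/monodromy group, acting on the witness points. -/
abbrev galoisGroup : Subgroup (Equiv.Perm W.Point) := monodromyGroup C W.q W.q_notMem

end WitnessSet

/-! ### Decompositions of the projection and factors of the witness set -/

/-- A decomposition `π = α ∘ β` (postfix notation: first `α`, then `β`), trivial or not, of the
projection `π : C → ℙ¹`: over a nonempty open set `U ⊆ ℙ¹`, `π` factors as
`π⁻¹(U) → V → U` with `α`, `β` finite morphisms of the given degrees, through a variety `V`.
Being finite over `U`, `V` is quasi-projective, so it is taken inside a projective space. -/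
structure Decomposition (C : Set (PSpace n × PSpace 1)) where
  U : Set (PSpace 1)
  U_open : IsOpen[zariski (PSpace 1)] U
  U_nonempty : U.Nonempty
  m : ℕ
  V : Set (PSpace m)
  V_locallyClosed : @IsLocallyClosed _ (zariski (PSpace m)) V
  V_irreducible : @IsIrreducible _ (zariski (PSpace m)) V
  α : PSpace n × PSpace 1 → PSpace m
  β : PSpace m → PSpace 1
  α_finite : IsFiniteMorphism α (C ∩ Prod.snd ⁻¹' U) V
  β_finite : IsFiniteMorphism β V U
  comp_eq : ∀ x ∈ C ∩ Prod.snd ⁻¹' U, β (α x) = x.2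
  degα : ℕ
  degβ : ℕ
  degα_pos : 0 < degα
  degβ_pos : 0 < degβ
  degα_spec : HasDegree α (C ∩ Prod.snd ⁻¹' U) V degα
  degβ_spec : HasDegree β V U degβ

namespace Decomposition

variable {C : Set (PSpace n × PSpace 1)} (D : Decomposition C)

/-- The base point `q` of a witness set is general for the decomposition: `π` factors over `q`,
and `q` is not a branch point of `β`. -/
def IsGeneral (q : PSpace 1) : Prop :=
  q ∈ D.U ∧ (D.V ∩ D.β ⁻¹' {q}).encard = D.degβ

/-- An `α`-factor: `deg α` witness points that map to the same point under `α`. -/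
def IsAlphaFactor {q : PSpace 1} (A : Set (fiber C q)) : Prop :=
  A.encard = D.degα ∧ ∀ x ∈ A, ∀ y ∈ A, D.α x = D.α y

/-- A `β`-factor: `deg β` witness points that map to distinct points under `α`. -/
def IsBetaFactor {q : PSpace 1} (B : Set (fiber C q)) : Prop :=
  B.encard = D.degβ ∧ ∀ x ∈ B, ∀ y ∈ B, D.α x = D.α y → x = y

end Decomposition

/-- `B` is a set of representatives for the sets `γ A`, `γ ∈ G`: it meets each in exactly one
point. -/
def IsSetOfRepresentatives {X : Type} (G : Subgroup (Equiv.Perm X)) (A B : Set X) : Prop :=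
  ∀ γ ∈ G, ∃! x, x ∈ (γ • A) ∩ B

end Curve

end Decomposable

end

noncomputable section

universe u v

namespace Decomposable

/-! ### Extension of homomorphisms to the complex numbers -/

section HomExtension

open Polynomial

/-! Off the branch locus, `C` is a finite covering of degree `d = a * b`, and irreducibility of `C`
makes the monodromy group transitive on `π⁻¹(q)` (`IsCover.exists_monodromy_eq`). The theorem
follows from a dictionary between decompositions for which `q` is general and invariant equivalence
relations on `π⁻¹(q)` with classes of equal size.

From a decomposition to a relation: two witness points are equivalent when `α` identifies them.
Since `α` is continuous for the classical topology, unequal values stay unequal nearby. Since finite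
morphisms of positive degree are surjective (`IsFiniteMorphism.surjOn`), `α` takes exactly `deg β`
values on every good fiber, so equal values stay equal too. The relation is therefore locally
constant off finitely many fibers. A loop may cross these, but there the relation is still constant
on punctured discs, and this suffices for invariance (`IsCover.iff_of_mem_monodromyGroup`).
Transitivity and a count show that the classes have `deg α` elements (`Decomposition.encard_class`).
So the `α`-factors are the classes, these are blocks whose translates are the other classes, and
`deg β` points have distinct images under `α` iff they meet each class exactly once.

From a block to a decomposition: the translates of `A` partition `π⁻¹(q)` (`blockSetoid`), and
transport along paths spreads the partition to the other fibers (`ExtRel`). Summing a suitable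
polynomial in a separating function over each class gives a function `e` that is constant on the
classes, holomorphic along local sections and, after multiplication with a polynomial, of polynomial
growth; such functions are called tame. Norms and traces of tame functions are rational in the
coordinate of `ℙ¹`, by removable singularities and Cauchy's estimates. Lagrange interpolation then
makes every tame function a rational function on `C` (`SepChart.Tame.exists_eq`). The map `y ↦
(π(y), e(y))` onto a plane curve is the desired `α` (`IsCover.exists_tame_of_setoid`,
`SepChart.exists_decomposition`). Finiteness holds because regular functions are tame and so satisfy
their characteristic polynomials.

The algebraic input is a function that separates the points of the fibers, with a relation of degree
exactly `d` over the coordinate whose leading coefficient does not vanish at `q`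
(`IsIrreducibleAlgebraic.exists_separating_relation`). It rests on extending homomorphisms to `ℂ`
along finitely generated extensions of rings. -/

theorem exists_pseudo_division {R : Type*} [CommRing R] (m : R[X]) (hm : 0 < m.natDegree)
    (p : R[X]) : ∃ (k : ℕ) (s r : R[X]),
      C (m.leadingCoeff ^ k) * p = m * s + r ∧ r.natDegree < m.natDegree := by
  induction hN : p.natDegree using Nat.strong_induction_on generalizing p with
  | _ N ih =>
    by_cases hlt : p.natDegree < m.natDegree
    · exact ⟨0, 0, p, by simp, hlt⟩
    · push Not at hlt
      -- Scaling `p` by the leading coefficient of `m` lets the top term be cancelled without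
      -- division; the exponent `k` counts these scalings.
      set p' := C m.leadingCoeff * p - m * (C p.leadingCoeff * X ^ (p.natDegree - m.natDegree))
        with hp'
      have hdeg : p'.natDegree < N := by
        have h1 : p'.natDegree ≤ p.natDegree := by
          refine (natDegree_sub_le _ _).trans (max_le (natDegree_C_mul_le _ _) ?_)
          refine natDegree_mul_le.trans ?_
          have := natDegree_C_mul_X_pow_le p.leadingCoeff (p.natDegree - m.natDegree)
          omega
        have h2 : p'.coeff p.natDegree = 0 := by
          have e1 : p.natDegree = m.natDegree + (p.natDegree - m.natDegree) := by omega
          rw [hp', coeff_sub, coeff_C_mul, ← mul_assoc]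
          nth_rw 3 [e1]
          rw [coeff_mul_X_pow, coeff_mul_C]
          simp
        rw [← hN]
        refine lt_of_le_of_ne h1 fun h => ?_
        have h3 : p'.leadingCoeff = 0 := by rw [leadingCoeff, h, h2]
        rw [leadingCoeff_eq_zero] at h3
        rw [h3, natDegree_zero] at h
        omega
      obtain ⟨k, s, r, h, hr⟩ := ih _ hdeg p' rfl
      refine ⟨k + 1, s + C (m.leadingCoeff ^ k) *
        (C p.leadingCoeff * X ^ (p.natDegree - m.natDegree)), r, ?_, hr⟩
      have : C m.leadingCoeff * p =
          p' + m * (C p.leadingCoeff * X ^ (p.natDegree - m.natDegree)) := by rw [hp']; ring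
      rw [pow_succ, C_mul, mul_assoc, this, mul_add, h]
      ring

/-- A relation of least degree stands in for the minimal polynomial over a fraction field. It need
not be monic, so division by it is pseudo-division. -/
theorem exists_minimal_annihilator {R A : Type*} [CommRing R] [CommRing A] [Algebra R A] {x : A}
    (hx : IsAlgebraic R x) : ∃ m : R[X], aeval x m = 0 ∧ m ≠ 0 ∧
      ∀ p : R[X], aeval x p = 0 → p.natDegree < m.natDegree → p = 0 := by
  classical
  have hex : ∃ N, ∃ p : R[X], aeval x p = 0 ∧ p ≠ 0 ∧ p.natDegree = N := by
    obtain ⟨p, h1, h2⟩ := hx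
    exact ⟨_, p, h2, h1, rfl⟩
  obtain ⟨p, hp, hp0, hN⟩ := Nat.find_spec hex
  refine ⟨p, hp, hp0, fun r hr hlt => ?_⟩
  by_contra hj
  rw [hN] at hlt
  exact Nat.find_min hex hlt ⟨r, hr, hj, rfl⟩

theorem natDegree_pos_of_aeval_eq_zero {R A : Type*} [CommRing R] [CommRing A] [Algebra R A]
    (hinj : Function.Injective (algebraMap R A)) {x : A} {m : R[X]} (hm : aeval x m = 0)
    (hm0 : m ≠ 0) : 0 < m.natDegree := by
  rw [Nat.pos_iff_ne_zero]
  intro h0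
  rw [eq_C_of_natDegree_eq_zero h0, aeval_C] at hm
  have : m.coeff 0 = 0 := hinj (by rw [hm, map_zero])
  rw [eq_C_of_natDegree_eq_zero h0, this] at hm0
  simp at hm0

/-- The pseudo-remainder of `p` modulo `m` annihilates `x`, so it is zero by minimality. Hence a
root of the specialised `m` is a root of every specialised relation, as long as the leading
coefficient survives `φ`. -/
theorem eval₂_eq_zero_of_minimal {R A : Type*} [CommRing R] [IsDomain R] [CommRing A] [Algebra R A]
    {x : A} {m : R[X]} (hm : aeval x m = 0) (hpos : 0 < m.natDegree)
    (hmin : ∀ p : R[X], aeval x p = 0 → p.natDegree < m.natDegree → p = 0)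
    {K : Type*} [Field K] (φ : R →+* K) {z : K} (hz : eval₂ φ z m = 0)
    (hlc : φ m.leadingCoeff ≠ 0) (p : R[X]) (hp : aeval x p = 0) : eval₂ φ z p = 0 := by
  obtain ⟨k, s, r, h, hr⟩ := exists_pseudo_division m hpos p
  have hr0 : r = 0 := by
    refine hmin r ?_ hr
    have := congrArg (aeval x) h
    simpa [hp, hm] using this.symm
  have := congrArg (eval₂ φ z) h
  rw [eval₂_mul, eval₂_add, eval₂_mul, hz, hr0, eval₂_C, map_pow, zero_mul, eval₂_zero,
    add_zero] at this
  exact (mul_eq_zero.mp this).resolve_left (pow_ne_zero _ hlc)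

/-- The nonzero element `U(x)` satisfies an equation `q` with nonzero constant term. Splitting off
that term and substituting `U` shows that `U` is invertible modulo the relations of `x`, up to the
scalar `p₀`. -/
theorem exists_C_eq_mul_add {R A : Type*} [CommRing R] [IsDomain R] [CommRing A] [IsDomain A]
    [Algebra R A] {x : A} (hx : IsAlgebraic R x) (U : R[X]) (hU : aeval x U ≠ 0) :
    ∃ (p₀ : R) (V W : R[X]), p₀ ≠ 0 ∧ aeval x W = 0 ∧ C p₀ = U * V + W := by
  have halg : IsAlgebraic R (aeval x U) :=
    Algebra.isAlgebraic_adjoin_singleton_iff.mpr hx _ (aeval_mem_adjoin_singleton _ _)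
  obtain ⟨q, hq0, hq⟩ := halg.exists_nonzero_coeff_and_aeval_eq_zero
    (mem_nonZeroDivisors_of_ne_zero hU)
  refine ⟨q.coeff 0, -(q.divX.comp U), q.comp U, hq0, by rw [aeval_comp, hq], ?_⟩
  nth_rw 3 [← divX_mul_X_add q]
  rw [add_comp, mul_comp, X_comp, C_comp]
  ring

/-- A value `z` for `x` has to be a root of all specialised relations but not of `U`. If `x` is
algebraic, any root of the specialised minimal relation works, and the identity for `p₀` keeps it
away from the roots of `U`. If `x` is transcendental there are no relations, and `U` has only
finitely many roots. -/
theorem exists_hom_extension_step {R A : Type*} [CommRing R] [IsDomain R] [CommRing A] [IsDomain A]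
    [Algebra R A] (hinj : Function.Injective (algebraMap R A)) (x : A) (U : R[X])
    (hU : aeval x U ≠ 0) :
    ∃ u : R, u ≠ 0 ∧ ∀ φ : R →+* ℂ, φ u ≠ 0 →
      ∃ z : ℂ, (∀ p : R[X], aeval x p = 0 → eval₂ φ z p = 0) ∧ eval₂ φ z U ≠ 0 := by
  by_cases hx : IsAlgebraic R x
  · obtain ⟨m, hm, hm0, hmin⟩ := exists_minimal_annihilator hx
    obtain ⟨p₀, V, W, hp₀, hW, hrel⟩ := exists_C_eq_mul_add hx U hU
    refine ⟨m.leadingCoeff * p₀, mul_ne_zero (leadingCoeff_ne_zero.mpr hm0) hp₀, fun φ hφ => ?_⟩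
    rw [map_mul] at hφ
    have hpos := natDegree_pos_of_aeval_eq_zero hinj hm hm0
    obtain ⟨z, hz⟩ := IsAlgClosed.exists_root (m.map φ) (by
      rw [degree_map_eq_of_leadingCoeff_ne_zero _ (left_ne_zero_of_mul hφ)]
      exact (natDegree_pos_iff_degree_pos.mp hpos).ne')
    have hker := eval₂_eq_zero_of_minimal hm hpos hmin φ (z := z)
      (by rw [← eval_map]; exact hz) (left_ne_zero_of_mul hφ)
    refine ⟨z, hker, fun h0 => right_ne_zero_of_mul hφ ?_⟩
    have := congrArg (eval₂ φ z) hrel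
    rwa [eval₂_C, eval₂_add, eval₂_mul, h0, hker W hW, zero_mul, add_zero] at this
  · have htr : ∀ p : R[X], aeval x p = 0 → p = 0 := fun p hp => by
      by_contra h
      exact hx ⟨p, h, hp⟩
    have hU0 : U ≠ 0 := by rintro rfl; simp at hU
    refine ⟨U.leadingCoeff, leadingCoeff_ne_zero.mpr hU0, fun φ hφ => ?_⟩
    have hne : U.map φ ≠ 0 := fun h => hφ (by
      have := congrArg (fun q => q.coeff U.natDegree) h
      simpa using this)
    obtain ⟨z, hz⟩ := Polynomial.exists_eval_ne_zero_of_natDegree_lt_card _ hne (by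
      exact lt_of_lt_of_le Cardinal.natCast_lt_aleph0 (Cardinal.aleph0_le_mk ℂ))
    exact ⟨z, fun p hp => by rw [htr p hp, eval₂_zero], by rwa [eval_map] at hz⟩

/-- Extension of homomorphisms to `ℂ` along a finitely generated extension. -/
theorem exists_hom_extension_fin {A : Type u} [CommRing A] [IsDomain A] (n : ℕ) :
    ∀ {P : Type v} [CommRing P] (F : P →+* A) (x : Fin n → A),
    Subring.closure (Set.range F ∪ Set.range x) = ⊤ → ∀ v : A, v ≠ 0 →
    ∃ u : P, F u ≠ 0 ∧ ∀ φ : P →+* ℂ, (∀ p, F p = 0 → φ p = 0) → φ u ≠ 0 →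
      ∃ ψ : A →+* ℂ, ψ.comp F = φ ∧ ψ v ≠ 0 := by
  induction n with
  | zero =>
    intro P _ F x hgen v hv
    have hsurj : Function.Surjective F := by
      rw [← RingHom.range_eq_top, ← hgen, Set.range_eq_empty x, Set.union_empty,
        ← RingHom.coe_range, Subring.closure_eq]
    obtain ⟨u, rfl⟩ := hsurj v
    refine ⟨u, hv, fun φ hφ hu => ?_⟩
    refine ⟨F.liftOfSurjective hsurj ⟨φ, fun p hp => hφ p hp⟩, ?_, ?_⟩
    · exact RingHom.liftOfRightInverse_comp _ _ _ _
    · rwa [RingHom.liftOfRightInverse_comp_apply]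
  | succ n ih =>
    intro P _ F x hgen v hv
    -- The generator `x 0` is absorbed into the base. The new base map is usually not injective,
    -- which is why the statement asks only that `φ` kill the kernel of `F`.
    let F' : P[X] →+* A := eval₂RingHom F (x 0)
    have hgen' : Subring.closure (Set.range F' ∪ Set.range (Fin.tail x)) = ⊤ := by
      rw [eq_top_iff, ← hgen, Subring.closure_le]
      rintro _ (⟨p, rfl⟩ | ⟨i, rfl⟩)
      · exact Subring.subset_closure (Or.inl ⟨C p, by simp [F']⟩)
      · refine Fin.cases ?_ (fun i => ?_) i
        · exact Subring.subset_closure (Or.inl ⟨X, by simp [F']⟩)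
        · exact Subring.subset_closure (Or.inr ⟨i, rfl⟩)
    obtain ⟨U, hU, hext⟩ := ih F' (Fin.tail x) hgen' v hv
    have hmap : ∀ p : P[X], aeval (x 0) (p.map F.rangeRestrict) = F' p := fun p => by
      rw [aeval_def, eval₂_map]; rfl
    -- The step for one generator needs a domain embedded in `A`, so it is applied over the range of
    -- `F`, to which `φ` descends.
    obtain ⟨u', hu', hstep⟩ := exists_hom_extension_step (R := F.range)
      Subtype.val_injective (x 0) (U.map F.rangeRestrict) (by rwa [hmap])
    obtain ⟨_, u, rfl⟩ := u'
    refine ⟨u, fun h => hu' (Subtype.ext h), fun φ hφ hu => ?_⟩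
    have hk : ∀ p, F.rangeRestrict p = 0 → φ p = 0 := fun p hp =>
      hφ p (congrArg Subtype.val hp)
    let φ' : F.range →+* ℂ :=
      F.rangeRestrict.liftOfSurjective F.rangeRestrict_surjective ⟨φ, fun p hp => hk p hp⟩
    have hφ' : ∀ p, φ' (F.rangeRestrict p) = φ p := fun p =>
      RingHom.liftOfRightInverse_comp_apply _ _ _ _ _
    have hcomp : φ'.comp F.rangeRestrict = φ := RingHom.ext hφ'
    obtain ⟨z, hz, hzU⟩ := hstep φ' (by
      have := hφ' u
      rw [← this] at hu
      exact hu)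
    obtain ⟨ψ, hψ, hψv⟩ := hext (eval₂RingHom φ z) (fun p hp => by
        have := hz (p.map F.rangeRestrict) (by rwa [hmap])
        rwa [eval₂_map, hcomp] at this)
      (by rwa [eval₂_map, hcomp] at hzU)
    refine ⟨ψ, RingHom.ext fun p => ?_, hψv⟩
    have := congrArg (fun f => f (C p)) hψ
    simpa [F'] using this

end HomExtension
end Decomposable
end

noncomputable section

namespace Decomposable

/-! ### Irreducible affine algebraic sets with a function whose general fibers are finite -/

section AffineAlgebra

open Polynomial

variable {σ : Type}

/-- `S` is an irreducible algebraic subset of `ℂ^σ`. -/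
structure IsIrreducibleAlgebraic (S : Set (σ → ℂ)) : Prop where
  nonempty : S.Nonempty
  closed : ∀ w, (∀ p : MvPolynomial σ ℂ, (∀ s ∈ S, p.eval s = 0) → p.eval w = 0) → w ∈ S
  prime : ∀ p q : MvPolynomial σ ℂ, (∀ s ∈ S, p.eval s * q.eval s = 0) →
    (∀ s ∈ S, p.eval s = 0) ∨ (∀ s ∈ S, q.eval s = 0)

variable {S : Set (σ → ℂ)}

/-- The coordinate ring of an algebraic set. -/
abbrev CoordRing (S : Set (σ → ℂ)) : Type := MvPolynomial σ ℂ ⧸ MvPolynomial.vanishingIdeal ℂ S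

theorem coordRing_mk_eq_zero {p : MvPolynomial σ ℂ} :
    (Ideal.Quotient.mk (MvPolynomial.vanishingIdeal ℂ S) p = 0) ↔ ∀ s ∈ S, p.eval s = 0 := by
  rw [Ideal.Quotient.eq_zero_iff_mem, MvPolynomial.mem_vanishingIdeal_iff]
  simp only [MvPolynomial.aeval_eq_eval]

theorem IsIrreducibleAlgebraic.isDomain
    (hS : IsIrreducibleAlgebraic S) : IsDomain (CoordRing S) := by
  rw [Ideal.Quotient.isDomain_iff_prime]
  have hmem : ∀ p : MvPolynomial σ ℂ, p ∈ MvPolynomial.vanishingIdeal ℂ S ↔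
      ∀ s ∈ S, p.eval s = 0 := fun p => by
    rw [← coordRing_mk_eq_zero, Ideal.Quotient.eq_zero_iff_mem]
  refine ⟨fun h => ?_, fun {p q} h => ?_⟩
  · obtain ⟨s, hs⟩ := hS.nonempty
    have := (hmem 1).mp (by rw [h]; trivial) s hs
    simp at this
  · rw [hmem] at h ⊢
    rw [hmem]
    exact hS.prime p q (fun s hs => by simpa using h s hs)

/-- The substitution `G ↦ G(t, h)` into a polynomial in two variables. -/
def subst₂ (t h : MvPolynomial σ ℂ) : ℂ[X][X] →+* MvPolynomial σ ℂ :=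
  eval₂RingHom (aeval t : ℂ[X] →ₐ[ℂ] MvPolynomial σ ℂ).toRingHom h

theorem eval_aeval_poly (t : MvPolynomial σ ℂ) (p : ℂ[X]) (w : σ → ℂ) :
    (aeval t p).eval w = p.eval (t.eval w) := by
  induction p using Polynomial.induction_on' with
  | add p q hp hq => simp [hp, hq]
  | monomial n a => simp [aeval_monomial]

theorem eval_subst₂ (t h : MvPolynomial σ ℂ) (G : ℂ[X][X]) (w : σ → ℂ) :
    (subst₂ t h G).eval w = G.evalEval (t.eval w) (h.eval w) := by
  induction G using Polynomial.induction_on' with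
  | add p q hp hq => simp [hp, hq]
  | monomial n a =>
    simp [subst₂, evalEval, eval₂_monomial, eval_aeval_poly, eval_monomial]

/-- Points of an irreducible algebraic set with prescribed values of two functions. -/
theorem IsIrreducibleAlgebraic.exists_point [Finite σ]
    (hS : IsIrreducibleAlgebraic S) (t h : MvPolynomial σ ℂ) :
    ∃ u : ℂ[X][X], (¬ ∀ w ∈ S, u.evalEval (t.eval w) (h.eval w) = 0) ∧
      ∀ c z : ℂ, (∀ G : ℂ[X][X], (∀ w ∈ S, G.evalEval (t.eval w) (h.eval w) = 0) →
        G.evalEval c z = 0) → u.evalEval c z ≠ 0 →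
        ∃ w ∈ S, t.eval w = c ∧ h.eval w = z := by
  have := hS.isDomain
  obtain ⟨n, ⟨e⟩⟩ := Finite.exists_equiv_fin σ
  let π := Ideal.Quotient.mk (MvPolynomial.vanishingIdeal ℂ S)
  let F : ℂ[X][X] →+* CoordRing S := π.comp (subst₂ t h)
  have hF : ∀ G, F G = 0 ↔ ∀ w ∈ S, G.evalEval (t.eval w) (h.eval w) = 0 := fun G => by
    simp only [F, RingHom.comp_apply, π, coordRing_mk_eq_zero, eval_subst₂]
  let x : Fin n → CoordRing S := fun i => π (MvPolynomial.X (e.symm i))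
  have hgen : Subring.closure (Set.range F ∪ Set.range x) = ⊤ := by
    rw [eq_top_iff]
    rintro a -
    obtain ⟨p, rfl⟩ := Ideal.Quotient.mk_surjective a
    induction p using MvPolynomial.induction_on with
    | C a =>
      refine Subring.subset_closure (Or.inl ⟨C (C a), ?_⟩)
      simp only [F, RingHom.comp_apply, π]
      congr 1
      simp [subst₂]
    | add p q hp hq => rw [map_add]; exact add_mem hp hq
    | mul_X p i hp =>
      rw [map_mul]
      exact mul_mem hp (Subring.subset_closure (Or.inr ⟨e i, by simp [x, π]⟩))
  -- Evaluation at `(c, z)` is to be extended to the coordinate ring; `v = 1` imposes no condition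
  -- on the extension.
  obtain ⟨u, hu, hext⟩ := exists_hom_extension_fin n F x hgen 1 one_ne_zero
  refine ⟨u, fun h => hu ((hF u).mpr h), fun c z hker huc => ?_⟩
  obtain ⟨ψ, hψ, -⟩ := hext (evalEvalRingHom c z)
    (fun G hG => by simpa using hker G ((hF G).mp hG)) (by simpa using huc)
  have hψF : ∀ G, ψ (π (subst₂ t h G)) = G.evalEval c z := fun G => by
    have := congrArg (fun f => f G) hψ
    simpa [evalEval, F] using this
  -- The extension fixes the constants, so it is evaluation at the images of the coordinate
  -- functions; since it kills the vanishing ideal, this point lies on `S`.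
  let w : σ → ℂ := fun i => ψ (π (MvPolynomial.X i))
  have hev : ∀ p : MvPolynomial σ ℂ, ψ (π p) = p.eval w := fun p => by
    induction p using MvPolynomial.induction_on with
    | C a =>
      have := hψF (C (C a))
      simpa [subst₂] using this
    | add p q hp hq => simp [hp, hq]
    | mul_X p i hp => rw [map_mul, map_mul, hp, map_mul, MvPolynomial.eval_X]
  refine ⟨w, hS.closed w fun p hp => ?_, ?_, ?_⟩
  · rw [← hev, coordRing_mk_eq_zero.mpr hp, map_zero]
  · rw [← hev]
    have := hψF (C X)
    simpa [subst₂, evalEval] using this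
  · rw [← hev]
    have := hψF X
    simpa [subst₂] using this

variable {t : MvPolynomial σ ℂ} {d : ℕ}

theorem poly_eq_zero_of_comp_eq_zero
    (hinf : ((fun w => t.eval w) '' S : Set ℂ).Infinite) {p : ℂ[X]} (hp : ∀ w ∈ S, p.eval (t.eval w) = 0) : p = 0 := by
  refine Polynomial.eq_zero_of_infinite_isRoot p (hinf.mono ?_)
  rintro _ ⟨w, hw, rfl⟩
  exact hp w hw

/-- If `t` and `a` were algebraically independent on `S`, every pair `(c, z)` off the curve `u = 0`
would come from a point of `S`. For general `c` the fiber over `c` would then be infinite, against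
the bound `d`. -/
theorem IsIrreducibleAlgebraic.exists_relation [Finite σ]
    (hS : IsIrreducibleAlgebraic S)
    (hfin : ∃ F : Set ℂ, F.Finite ∧ ∀ c ∉ F, {w ∈ S | t.eval w = c}.encard ≤ d) (a : MvPolynomial σ ℂ) :
    ∃ G : ℂ[X][X], G ≠ 0 ∧ ∀ w ∈ S, G.evalEval (t.eval w) (a.eval w) = 0 := by
  by_contra hcon
  push Not at hcon
  obtain ⟨u, hu, hext⟩ := hS.exists_point t a
  have hu0 : u ≠ 0 := by rintro rfl; exact hu (by simp)
  obtain ⟨F, hF, hFc⟩ := hfin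
  have hlc : u.leadingCoeff ≠ 0 := leadingCoeff_ne_zero.mpr hu0
  obtain ⟨c, hc⟩ := (hF.union (finite_setOfPred_isRoot hlc)).exists_notMem
  simp only [Set.mem_union, not_or] at hc
  have hv : u.map (evalRingHom c) ≠ 0 := fun h0 => hc.2 (by
    have := congrArg (fun q => q.coeff u.natDegree) h0
    simpa using this)
  have hinf' : ({z | ¬ (u.map (evalRingHom c)).IsRoot z} : Set ℂ).Infinite :=
    (finite_setOfPred_isRoot hv).infinite_compl
  have hsub : {z | ¬ (u.map (evalRingHom c)).IsRoot z} ⊆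
      (fun w => a.eval w) '' {w ∈ S | t.eval w = c} := by
    intro z hz
    obtain ⟨w, hw, h1, h2⟩ := hext c z (fun G hG => by
        by_cases hG0 : G = 0
        · simp [hG0]
        · obtain ⟨w, hw, hne⟩ := hcon G hG0
          exact absurd (hG w hw) hne) (by
        rw [← map_evalRingHom_eval]; exact hz)
    exact ⟨w, ⟨hw, h1⟩, h2⟩
  refine hinf' ((Set.Finite.image _ ?_).subset hsub)
  exact Set.finite_of_encard_le_coe (hFc c hc.1)

/-- The coordinate ring as an algebra over the polynomials in `t`. -/
@[reducible] def CoordRing.algebraPoly (S : Set (σ → ℂ)) (t : MvPolynomial σ ℂ) : Algebra ℂ[X] (CoordRing S) :=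
  ((Ideal.Quotient.mk (MvPolynomial.vanishingIdeal ℂ S)).comp
    (aeval t : ℂ[X] →ₐ[ℂ] MvPolynomial σ ℂ).toRingHom).toAlgebra

theorem CoordRing.aeval_eq_zero (a : MvPolynomial σ ℂ) (G : ℂ[X][X]) :
    let _ := CoordRing.algebraPoly S t
    (aeval (Ideal.Quotient.mk (MvPolynomial.vanishingIdeal ℂ S) a) G = 0 ↔
      ∀ w ∈ S, G.evalEval (t.eval w) (a.eval w) = 0) := by
  let _ := CoordRing.algebraPoly S t
  have : aeval (Ideal.Quotient.mk (MvPolynomial.vanishingIdeal ℂ S) a) G =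
      Ideal.Quotient.mk (MvPolynomial.vanishingIdeal ℂ S) (subst₂ t a G) := by
    rw [aeval_def, subst₂, coe_eval₂RingHom, hom_eval₂]
    rfl
  show aeval (Ideal.Quotient.mk (MvPolynomial.vanishingIdeal ℂ S) a) G = 0 ↔ _
  rw [this, coordRing_mk_eq_zero]
  simp only [eval_subst₂]

theorem CoordRing.algebraMap_injective
    (hinf : ((fun w => t.eval w) '' S : Set ℂ).Infinite) :
    let _ := CoordRing.algebraPoly S t
    Function.Injective (algebraMap ℂ[X] (CoordRing S)) := by
  let _ := CoordRing.algebraPoly S t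
  rw [injective_iff_map_eq_zero]
  intro p hp
  refine poly_eq_zero_of_comp_eq_zero hinf fun w hw => ?_
  have h1 : Ideal.Quotient.mk (MvPolynomial.vanishingIdeal ℂ S) (aeval t p) = 0 := hp
  have := coordRing_mk_eq_zero.mp h1 w hw
  rwa [eval_aeval_poly] at this

theorem CoordRing.isAlgebraic [Finite σ]
    (hS : IsIrreducibleAlgebraic S)
    (hfin : ∃ F : Set ℂ, F.Finite ∧ ∀ c ∉ F, {w ∈ S | t.eval w = c}.encard ≤ d) (a : MvPolynomial σ ℂ) :
    let _ := CoordRing.algebraPoly S t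
    IsAlgebraic ℂ[X] (Ideal.Quotient.mk (MvPolynomial.vanishingIdeal ℂ S) a) := by
  let _ := CoordRing.algebraPoly S t
  obtain ⟨G, hG, h⟩ := hS.exists_relation hfin a
  exact ⟨G, hG, (CoordRing.aeval_eq_zero a G).mpr h⟩

/-- The nonzero class of `a` satisfies an equation over the polynomials in `t` with nonzero constant
term, and this constant term vanishes at `t(w)` whenever `a(w) = 0`. -/
theorem IsIrreducibleAlgebraic.finite_zeros [Finite σ]
    (hS : IsIrreducibleAlgebraic S)
    (hfin : ∃ F : Set ℂ, F.Finite ∧ ∀ c ∉ F, {w ∈ S | t.eval w = c}.encard ≤ d) {a : MvPolynomial σ ℂ}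
    (ha : ¬ ∀ w ∈ S, a.eval w = 0) :
    ∃ F : Set ℂ, F.Finite ∧ ∀ w ∈ S, t.eval w ∉ F → a.eval w ≠ 0 := by
  let _ := CoordRing.algebraPoly S t
  have := hS.isDomain
  obtain ⟨q, hq0, hq⟩ := (CoordRing.isAlgebraic hS hfin a).exists_nonzero_coeff_and_aeval_eq_zero
    (mem_nonZeroDivisors_of_ne_zero (fun h => ha (coordRing_mk_eq_zero.mp h)))
  refine ⟨_, finite_setOfPred_isRoot hq0, fun w hw hF h0 => hF ?_⟩
  have := (CoordRing.aeval_eq_zero a q).mp hq w hw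
  rw [h0, ← divX_mul_X_add q] at this
  simpa [evalEval] using this

/-- If every coefficient vanished at `c`, then `X - c` would divide the content. -/
theorem map_evalRingHom_ne_zero_of_isPrimitive {Q : ℂ[X][X]} (hQ : Q.IsPrimitive) (c : ℂ) :
    Q.map (evalRingHom c) ≠ 0 := by
  intro h0
  have hdvd : C (X - C c) ∣ Q := by
    rw [C_dvd_iff_dvd_coeff]
    intro i
    rw [dvd_iff_isRoot]
    have := congrArg (fun q => q.coeff i) h0
    simpa using this
  exact not_isUnit_X_sub_C c (hQ _ hdvd)

/-- The polynomial relation between `t` and a function `h` that separates the points of a fiber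
with the maximal number of points. -/
theorem IsIrreducibleAlgebraic.exists_separating_relation [Finite σ]
    (hS : IsIrreducibleAlgebraic S)
    (hinf : ((fun w => t.eval w) '' S : Set ℂ).Infinite)
    (hfin : ∃ F : Set ℂ, F.Finite ∧ ∀ c ∉ F, {w ∈ S | t.eval w = c}.encard ≤ d) (h : MvPolynomial σ ℂ) (c₀ : ℂ)
    (hd : d ≤ ((fun w => h.eval w) '' {w ∈ S | t.eval w = c₀}).encard) :
    ∃ Q : ℂ[X][X], (∀ w ∈ S, Q.evalEval (t.eval w) (h.eval w) = 0) ∧ Q.natDegree = d ∧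
      Q.leadingCoeff.eval c₀ ≠ 0 ∧
      ∃ F : Set ℂ, F.Finite ∧ ∀ c ∉ F, Q.leadingCoeff.eval c ≠ 0 ∧
        {w ∈ S | t.eval w = c}.encard = d ∧ Set.InjOn (fun w => h.eval w) {w ∈ S | t.eval w = c} := by
  let _ := CoordRing.algebraPoly S t
  have := hS.isDomain
  have hinj := CoordRing.algebraMap_injective hinf
  have halg := CoordRing.isAlgebraic hS hfin h
  obtain ⟨m, hm, hm0, hmin⟩ := exists_minimal_annihilator halg
  set η := Ideal.Quotient.mk (MvPolynomial.vanishingIdeal ℂ S) h with hη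
  -- The primitive part specialises to a nonzero polynomial everywhere, in particular at `c₀`, where
  -- its roots are counted below.
  let Q := m.primPart
  have hQm : Q.natDegree = m.natDegree := natDegree_primPart m
  have hQ : aeval η Q = 0 := by
    have h1 := m.eq_C_content_mul_primPart
    rw [h1, map_mul, aeval_C] at hm
    refine (mul_eq_zero.mp hm).resolve_left fun h0 => hm0 ?_
    have h2 : m.content = 0 := hinj (by rw [h0, map_zero])
    rwa [content_eq_zero_iff] at h2
  have hprim : Q.IsPrimitive := isPrimitive_primPart m
  have hQ0 : Q ≠ 0 := hprim.ne_zero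
  rw [← hQm] at hmin
  have hpos := natDegree_pos_of_aeval_eq_zero hinj hQ hQ0
  have hlc0 : Q.leadingCoeff ≠ 0 := leadingCoeff_ne_zero.mpr hQ0
  have hQS := (CoordRing.aeval_eq_zero h Q).mp hQ
  -- general points
  obtain ⟨F₁, hF₁, hF₁c⟩ := hfin
  obtain ⟨F₂, hF₂, hF₂w⟩ := hS.finite_zeros ⟨F₁, hF₁, hF₁c⟩ (a := subst₂ t h (derivative Q)) (by
    intro h0
    have h1 := (CoordRing.aeval_eq_zero h (derivative Q)).mpr (fun w hw => by
      rw [← eval_subst₂]; exact h0 w hw)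
    have h2 := hmin _ h1 (natDegree_derivative_lt hpos.ne')
    have := derivative_eq_zero.mp h2
    omega)
  obtain ⟨u, hu, hext⟩ := hS.exists_point t h
  obtain ⟨p₀, V, W, hp₀, hW, hrel⟩ := exists_C_eq_mul_add halg u
    (fun h0 => hu ((CoordRing.aeval_eq_zero h u).mp h0))
  have hker : ∀ c z, Q.leadingCoeff.eval c ≠ 0 → Q.evalEval c z = 0 →
      ∀ G : ℂ[X][X], aeval η G = 0 → G.evalEval c z = 0 := by
    intro c z hc hz G hG
    have := eval₂_eq_zero_of_minimal hQ hpos hmin (evalRingHom c) (z := z)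
      (by rw [← eval_map, map_evalRingHom_eval, hz]) hc G hG
    rwa [← eval_map, map_evalRingHom_eval] at this
  have hroot : ∀ c z, Q.leadingCoeff.eval c ≠ 0 → p₀.eval c ≠ 0 → Q.evalEval c z = 0 →
      ∃ w ∈ S, t.eval w = c ∧ h.eval w = z := by
    intro c z hc hpc hz
    refine hext c z (fun G hG => hker c z hc hz G ((CoordRing.aeval_eq_zero h G).mpr hG)) ?_
    intro h0
    have := congrArg (evalEvalRingHom c z) hrel
    simp only [coe_evalEvalRingHom, map_add, map_mul] at this
    rw [h0, hker c z hc hz W hW, zero_mul, add_zero] at this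
    exact hpc (by simpa [evalEval] using this)
  -- For general `c` the values of `h` on the fiber are exactly the roots of `Q(c, ·)`. They are
  -- simple because the derivative of `Q`, being of smaller degree, is not a relation and so
  -- vanishes on `S` only over finitely many `c`.
  have hgen : ∀ c, c ∉ F₁ → c ∉ F₂ → Q.leadingCoeff.eval c ≠ 0 → p₀.eval c ≠ 0 →
      ((fun w => h.eval w) '' {w ∈ S | t.eval w = c}).encard = Q.natDegree := by
    intro c hc₁ hc₂ hc hpc
    have hmap : (Q.map (evalRingHom c)).natDegree = Q.natDegree :=
      natDegree_map_of_leadingCoeff_ne_zero _ hc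
    have hne : Q.map (evalRingHom c) ≠ 0 := map_evalRingHom_ne_zero_of_isPrimitive hprim c
    have hset : ((fun w => h.eval w) '' {w ∈ S | t.eval w = c}) =
        ((Q.map (evalRingHom c)).roots.toFinset : Set ℂ) := by
      ext z
      rw [Finset.mem_coe, Multiset.mem_toFinset, mem_roots hne, IsRoot.def, map_evalRingHom_eval]
      constructor
      · rintro ⟨w, ⟨hw, rfl⟩, rfl⟩
        exact hQS w hw
      · intro hz
        obtain ⟨w, hw, h1, h2⟩ := hroot c z hc hpc hz
        exact ⟨w, ⟨hw, h1⟩, h2⟩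
    have hnodup : (Q.map (evalRingHom c)).roots.Nodup := by
      rw [Multiset.nodup_iff_count_le_one]
      intro z
      rw [count_roots]
      by_contra hcount
      push Not at hcount
      have h1 : (Q.map (evalRingHom c)).IsRoot z ∧
          (derivative (Q.map (evalRingHom c))).IsRoot z :=
        (one_lt_rootMultiplicity_iff_isRoot hne).mp hcount
      obtain ⟨w, hw, h2, h3⟩ := hroot c z hc hpc (by
        rw [← map_evalRingHom_eval]; exact h1.1)
      refine hF₂w w hw (by rwa [h2]) ?_
      rw [eval_subst₂, h2, h3, ← map_evalRingHom_eval, ← derivative_map]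
      exact h1.2
    rw [hset, Set.encard_coe_eq_coe_finsetCard, Multiset.toFinset_card_of_nodup hnodup,
      (IsAlgClosed.splits (Q.map (evalRingHom c))).natDegree_eq_card_roots.symm, hmap]
  have hFfin : (F₁ ∪ F₂ ∪ {c | Q.leadingCoeff.IsRoot c} ∪ {c | p₀.IsRoot c}).Finite :=
    ((hF₁.union hF₂).union (finite_setOfPred_isRoot hlc0)).union (finite_setOfPred_isRoot hp₀)
  -- the degree of the relation
  have hled : Q.natDegree ≤ d := by
    obtain ⟨c, hc⟩ := hFfin.exists_notMem
    simp only [Set.mem_union, not_or] at hc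
    have h1 := hgen c hc.1.1.1 hc.1.1.2 hc.1.2 hc.2
    have h2 := (Set.encard_image_le (fun w => h.eval w) {w ∈ S | t.eval w = c}).trans (hF₁c c hc.1.1.1)
    rw [h1] at h2
    exact_mod_cast h2
  have hne₀ := map_evalRingHom_ne_zero_of_isPrimitive hprim c₀
  -- Over `c₀` there are at least `d` values of `h`, all roots of the nonzero polynomial `Q(c₀, ·)`.
  -- Together with the upper bound from a general fiber this fixes the degree of `Q` and shows that
  -- it does not drop at `c₀`.
  have hge : d ≤ (Q.map (evalRingHom c₀)).natDegree := by
    have hsub : ((fun w => h.eval w) '' {w ∈ S | t.eval w = c₀}) ⊆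
        ((Q.map (evalRingHom c₀)).roots.toFinset : Set ℂ) := by
      rintro _ ⟨w, ⟨hw, rfl⟩, rfl⟩
      rw [Finset.mem_coe, Multiset.mem_toFinset, mem_roots hne₀, IsRoot.def, map_evalRingHom_eval]
      exact hQS w hw
    have h1 := hd.trans (Set.encard_le_encard hsub)
    rw [Set.encard_coe_eq_coe_finsetCard] at h1
    have h2 : d ≤ (Q.map (evalRingHom c₀)).roots.toFinset.card := by exact_mod_cast h1
    exact h2.trans ((Multiset.toFinset_card_le _).trans (card_roots' _))
  have hdeg : Q.natDegree = d := le_antisymm hled (hge.trans natDegree_map_le)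
  refine ⟨Q, hQS, hdeg, ?_, _, hFfin, fun c hc => ?_⟩
  · intro h0
    have h1 : (Q.map (evalRingHom c₀)).natDegree = Q.natDegree :=
      le_antisymm natDegree_map_le (hled.trans hge)
    refine hne₀ (leadingCoeff_eq_zero.mp ?_)
    rw [leadingCoeff, h1, coeff_map]
    exact h0
  · simp only [Set.mem_union, not_or] at hc
    have h1 := hgen c hc.1.1.1 hc.1.1.2 hc.1.2 hc.2
    have h2 := hF₁c c hc.1.1.1
    have h3 := Set.encard_image_le (fun w => h.eval w) {w ∈ S | t.eval w = c}
    rw [h1, hdeg] at h3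
    have h4 := le_antisymm h2 h3
    refine ⟨hc.1.2, h4, ?_⟩
    refine (Set.finite_of_encard_le_coe h2).injOn_of_encard_image_eq ?_
    rw [h1, h4, hdeg]

end AffineAlgebra

end Decomposable
end

noncomputable section

namespace Decomposable

/-! ### The classical topology of projective spaces -/

section ClassicalTopology

open Filter

variable {n m : ℕ}

/-- The nonzero vectors of `ℂⁿ⁺¹`. -/
abbrev NZ (n : ℕ) : Type := {v : Fin (n + 1) → ℂ // v ≠ 0}

theorem mk'_rep (p : PSpace n) : Projectivization.mk' ℂ (⟨p.rep, p.rep_nonzero⟩ : NZ n) = p :=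
  p.mk_rep

theorem continuous_coord (i : Fin (n + 1)) :
    Continuous fun v : NZ n => (v : Fin (n + 1) → ℂ) i :=
  (continuous_apply i).comp continuous_subtype_val

theorem continuous_lin_coord (ℓ : Fin (n + 1) → ℂ) :
    Continuous fun v : NZ n => ∑ i, ℓ i * (v : Fin (n + 1) → ℂ) i :=
  continuous_finsetSum _ fun i _ => continuous_const.mul (continuous_coord i)

theorem continuous_mk' : Continuous (Projectivization.mk' ℂ : NZ n → PSpace n) :=
  continuous_coinduced_rng

theorem mk'_eq_mk'_iff (v w : NZ n) :
    (Projectivization.mk' ℂ v : PSpace n) = Projectivization.mk' ℂ w ↔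
      ∃ a : ℂˣ, a • (w : Fin (n + 1) → ℂ) = v := by
  rw [Projectivization.mk'_eq_mk, Projectivization.mk'_eq_mk, Projectivization.mk_eq_mk_iff]

/-- The saturation of an open set is the union of its rescalings by units, hence open. -/
theorem isOpenQuotientMap_mk' :
    IsOpenQuotientMap (Projectivization.mk' ℂ : NZ n → PSpace n) := by
  refine ⟨fun p => ⟨⟨p.rep, p.rep_nonzero⟩, p.mk_rep⟩, continuous_mk', fun O hO => ?_⟩
  have hset : Projectivization.mk' ℂ ⁻¹' ((Projectivization.mk' ℂ : NZ n → PSpace n) '' O) =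
      ⋃ a : ℂˣ, (fun v : NZ n =>
        (⟨a • (v : Fin (n + 1) → ℂ), by
          rw [Units.smul_def]; exact smul_ne_zero a.ne_zero v.2⟩ : NZ n)) ⁻¹' O := by
    ext v
    simp only [Set.mem_preimage, Set.mem_image, Set.mem_iUnion]
    constructor
    · rintro ⟨w, hw, h⟩
      obtain ⟨a, ha⟩ := (mk'_eq_mk'_iff w v).mp h
      exact ⟨a, by convert hw⟩
    · rintro ⟨a, ha⟩
      exact ⟨_, ha, (mk'_eq_mk'_iff _ v).mpr ⟨a, rfl⟩⟩
  rw [isOpen_coinduced]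
  rw [hset]
  refine isOpen_iUnion fun a => hO.preimage ?_
  exact (continuous_subtype_val.const_smul a).subtype_mk _

instance compactSpace_pSpace : CompactSpace (PSpace n) := by
  have : CompactSpace (Metric.sphere (0 : Fin (n + 1) → ℂ) 1) :=
    isCompact_iff_compactSpace.mp (isCompact_sphere _ _)
  let f : Metric.sphere (0 : Fin (n + 1) → ℂ) 1 → PSpace n := fun v =>
    Projectivization.mk' ℂ ⟨v, fun h => by
      have := v.2
      rw [h] at this
      simp at this⟩
  have hf : Continuous f := continuous_mk'.comp (continuous_subtype_val.subtype_mk _)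
  have hsurj : Function.Surjective f := fun p => by
    have hp : ‖p.rep‖ ≠ 0 := norm_ne_zero_iff.mpr p.rep_nonzero
    have hp' : ((‖p.rep‖ : ℝ) : ℂ) ≠ 0 := Complex.ofReal_ne_zero.mpr hp
    refine ⟨⟨((‖p.rep‖ : ℂ)⁻¹) • p.rep, by simp [norm_smul, hp]⟩, ?_⟩
    conv_rhs => rw [← mk'_rep p]
    exact (mk'_eq_mk'_iff _ _).mpr ⟨(Units.mk0 _ hp')⁻¹, by simp [Units.smul_def]⟩
  exact hsurj.compactSpace hf

/-- The square of an open quotient map is a quotient map, so it is enough that the pairs of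
proportional nonzero vectors form a closed set; they are cut out by the `2 × 2` minors. -/
instance t2Space_pSpace : T2Space (PSpace n) := by
  rw [t2_iff_isClosed_diagonal]
  have hq := (isOpenQuotientMap_mk' (n := n)).prodMap (isOpenQuotientMap_mk' (n := n))
  rw [← hq.isQuotientMap.isClosed_preimage]
  have : (Prod.map (Projectivization.mk' ℂ) (Projectivization.mk' ℂ) ⁻¹'
      Set.diagonal (PSpace n)) = ⋂ i, ⋂ j, {v | (v.1 : Fin (n + 1) → ℂ) i * (v.2 : Fin (n + 1) → ℂ) j =
        (v.1 : Fin (n + 1) → ℂ) j * (v.2 : Fin (n + 1) → ℂ) i} := by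
    ext ⟨v, w⟩
    simp only [Set.mem_preimage, Prod.map_apply, Set.mem_diagonal_iff, mk'_eq_mk'_iff,
      Set.mem_iInter, Set.mem_ofPred_eq]
    constructor
    · rintro ⟨a, ha⟩ i j
      rw [← ha]
      simp [Units.smul_def]
      ring
    · intro h
      obtain ⟨i, hi⟩ := Function.ne_iff.mp w.2
      obtain ⟨k, hk⟩ := Function.ne_iff.mp v.2
      have hi' : (w : Fin (n + 1) → ℂ) i ≠ 0 := hi
      have hvi : (v : Fin (n + 1) → ℂ) i ≠ 0 := fun h0 => by
        have := h i k
        rw [h0, zero_mul] at this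
        exact mul_ne_zero hk hi this.symm
      refine ⟨Units.mk0 ((v : Fin (n + 1) → ℂ) i / (w : Fin (n + 1) → ℂ) i)
        (div_ne_zero hvi hi), ?_⟩
      ext j
      have := h i j
      simp only [Units.smul_def, Units.val_mk0, Pi.smul_apply, smul_eq_mul]
      field_simp
      linear_combination this
  rw [this]
  refine isClosed_iInter fun i => isClosed_iInter fun j => isClosed_eq ?_ ?_
  · exact ((continuous_coord i).comp continuous_fst).mul ((continuous_coord j).comp continuous_snd)
  · exact ((continuous_coord j).comp continuous_fst).mul ((continuous_coord i).comp continuous_snd)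

/-- A representative of `[v]` is a multiple of `v`. -/
theorem exists_rep_mk' (v : NZ n) :
    ∃ a : ℂ, a ≠ 0 ∧ (Projectivization.mk' ℂ v : PSpace n).rep = a • (v : Fin (n + 1) → ℂ) := by
  obtain ⟨a, ha⟩ := Projectivization.exists_smul_eq_mk_rep ℂ (v : Fin (n + 1) → ℂ) v.2
  exact ⟨a, a.ne_zero, ha.symm⟩

theorem IsBihomogeneous.eval_smul {F : MvPolynomial (Fin (n + 1) ⊕ Fin (m + 1)) ℂ} {d : ℕ × ℕ}
    (hF : IsBihomogeneous F d) (a b : ℂ) (x : Fin (n + 1) → ℂ) (t : Fin (m + 1) → ℂ) :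
    MvPolynomial.eval (Sum.elim (a • x) (b • t)) F =
      a ^ d.1 * b ^ d.2 * MvPolynomial.eval (Sum.elim x t) F := by
  rw [MvPolynomial.eval_eq, MvPolynomial.eval_eq, Finset.mul_sum]
  refine Finset.sum_congr rfl fun e he => ?_
  have hw := hF (MvPolynomial.mem_support_iff.mp he)
  have h1 : ∑ i, e (Sum.inl i) = d.1 := by
    rw [← hw, Finsupp.weight_apply, Finsupp.sum_fintype _ _ (by simp)]
    simp [Prod.fst_sum]
  have h2 : ∑ i, e (Sum.inr i) = d.2 := by
    rw [← hw, Finsupp.weight_apply, Finsupp.sum_fintype _ _ (by simp)]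
    simp [Prod.snd_sum]
  rw [Finset.prod_subset (Finset.subset_univ e.support) (fun i _ hi => by
      rw [Finsupp.notMem_support_iff.mp hi, pow_zero]),
    Finset.prod_subset (Finset.subset_univ e.support) (fun i _ hi => by
      rw [Finsupp.notMem_support_iff.mp hi, pow_zero])]
  simp only [Fintype.prod_sum_type, Sum.elim_inl, Sum.elim_inr, Pi.smul_apply, smul_eq_mul,
    mul_pow, Finset.prod_mul_distrib, Finset.prod_pow_eq_pow_sum, h1, h2]
  ring

theorem evalAt_mk' {F : MvPolynomial (Fin (n + 1) ⊕ Fin (m + 1)) ℂ} {d : ℕ × ℕ}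
    (hF : IsBihomogeneous F d) (v : NZ n)
    (w : NZ m) :
    ∃ a : ℂ, a ≠ 0 ∧ ∃ b : ℂ, b ≠ 0 ∧ 
      (Projectivization.mk' ℂ v : PSpace n).rep = a • (v : Fin (n + 1) → ℂ) ∧
      (Projectivization.mk' ℂ w : PSpace m).rep = b • (w : Fin (m + 1) → ℂ) ∧
      evalAt F (Projectivization.mk' ℂ v, Projectivization.mk' ℂ w) =
        a ^ d.1 * b ^ d.2 * MvPolynomial.eval (Sum.elim v w) F := by
  obtain ⟨a, ha, hv⟩ := exists_rep_mk' v
  obtain ⟨b, hb, hw⟩ := exists_rep_mk' w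
  refine ⟨a, ha, b, hb, hv, hw, ?_⟩
  rw [evalAt, hv, hw, hF.eval_smul]

theorem continuous_eval_sumElim (F : MvPolynomial (Fin (n + 1) ⊕ Fin (m + 1)) ℂ) :
    Continuous fun v : NZ n × NZ m =>
      MvPolynomial.eval (Sum.elim (v.1 : Fin (n + 1) → ℂ) (v.2 : Fin (m + 1) → ℂ)) F := by
  refine (MvPolynomial.continuous_eval F).comp (continuous_pi fun i => ?_)
  rcases i with i | i
  · exact (continuous_apply i).comp (continuous_subtype_val.comp continuous_fst)
  · exact (continuous_apply i).comp (continuous_subtype_val.comp continuous_snd)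

theorem isOpen_evalAt_ne_zero {F : MvPolynomial (Fin (n + 1) ⊕ Fin (m + 1)) ℂ} {d : ℕ × ℕ}
    (hF : IsBihomogeneous F d) : IsOpen {p : PSpace n × PSpace m | evalAt F p ≠ 0} := by
  have hq := (isOpenQuotientMap_mk' (n := n)).prodMap (isOpenQuotientMap_mk' (n := m))
  rw [← hq.isQuotientMap.isOpen_preimage]
  convert isOpen_compl_singleton.preimage (continuous_eval_sumElim F) using 1
  ext ⟨v, w⟩
  obtain ⟨a, ha, b, hb, -, -, h⟩ := evalAt_mk' hF v w
  simp only [Set.mem_preimage, Prod.map_apply, Set.mem_ofPred_eq, h, Set.mem_compl_iff,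
    Set.mem_singleton_iff, ne_eq, mul_eq_zero, not_or]
  exact ⟨fun h => h.2, fun h => ⟨⟨pow_ne_zero _ ha, pow_ne_zero _ hb⟩, h⟩⟩

theorem continuousAt_evalAt_div {F G : MvPolynomial (Fin (n + 1) ⊕ Fin (m + 1)) ℂ} {d : ℕ × ℕ}
    (hF : IsBihomogeneous F d) (hG : IsBihomogeneous G d) {p : PSpace n × PSpace m}
    (hp : evalAt G p ≠ 0) : ContinuousAt (fun x => evalAt F x / evalAt G x) p := by
  have hq := (isOpenQuotientMap_mk' (n := n)).prodMap (isOpenQuotientMap_mk' (n := m))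
  obtain ⟨⟨v, w⟩, rfl⟩ := hq.surjective p
  rw [← hq.continuousAt_comp_iff]
  obtain ⟨a, ha, b, hb, -, -, h⟩ := evalAt_mk' hG v w
  have heq : (fun x => evalAt F x / evalAt G x) ∘
      Prod.map (Projectivization.mk' ℂ) (Projectivization.mk' ℂ) =
      fun v => MvPolynomial.eval (Sum.elim (v.1 : Fin (n + 1) → ℂ) (v.2 : Fin (m + 1) → ℂ)) F /
        MvPolynomial.eval (Sum.elim (v.1 : Fin (n + 1) → ℂ) (v.2 : Fin (m + 1) → ℂ)) G := by
    ext ⟨v, w⟩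
    obtain ⟨a, ha, b, hb, hv, hw, h⟩ := evalAt_mk' hF v w
    have h' : evalAt G (Projectivization.mk' ℂ v, Projectivization.mk' ℂ w) =
        a ^ d.1 * b ^ d.2 * MvPolynomial.eval (Sum.elim v w) G := by
      rw [evalAt, hv, hw, hG.eval_smul]
    simp only [Function.comp_apply, Prod.map_apply, h, h']
    rw [mul_div_mul_left]
    exact mul_ne_zero (pow_ne_zero _ ha) (pow_ne_zero _ hb)
  rw [heq]
  refine ((continuous_eval_sumElim F).continuousAt).div
    ((continuous_eval_sumElim G).continuousAt) ?_
  rw [Prod.map_apply, h] at hp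
  exact right_ne_zero_of_mul hp

theorem isOpen_of_zariski {O : Set (PSpace n × PSpace m)}
    (hO : IsOpen[zariski (PSpace n × PSpace m)] O) : IsOpen O := by
  have hle : (inferInstance : TopologicalSpace (PSpace n × PSpace m)) ≤ zariski _ := by
    refine le_generateFrom ?_
    rintro _ ⟨d, φ, ⟨F, hF, rfl⟩, rfl⟩
    exact isOpen_evalAt_ne_zero hF
  exact hle _ hO

theorem isClosed_of_zariski {Z : Set (PSpace n × PSpace m)}
    (hZ : IsClosed[zariski (PSpace n × PSpace m)] Z) : IsClosed Z := by
  rw [← isOpen_compl_iff]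
  exact isOpen_of_zariski hZ.isOpen_compl

/-! ### Linear forms and affine charts -/

/-- The value of a linear form at the coordinates of a point. -/
def lin (ℓ : Fin (n + 1) → ℂ) (p : PSpace n) : ℂ := ∑ i, ℓ i * p.rep i

theorem lin_mk' (ℓ : Fin (n + 1) → ℂ) (v : NZ n) {a : ℂ}
    (h : (Projectivization.mk' ℂ v : PSpace n).rep = a • (v : Fin (n + 1) → ℂ)) :
    lin ℓ (Projectivization.mk' ℂ v) = a * ∑ i, ℓ i * (v : Fin (n + 1) → ℂ) i := by
  rw [lin, h, Finset.mul_sum]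
  exact Finset.sum_congr rfl fun i _ => by simp; ring

theorem isOpen_lin_ne_zero (ℓ : Fin (n + 1) → ℂ) : IsOpen {p : PSpace n | lin ℓ p ≠ 0} := by
  rw [← isOpenQuotientMap_mk'.isQuotientMap.isOpen_preimage]
  convert (isOpen_compl_singleton (x := (0 : ℂ))).preimage (continuous_lin_coord ℓ) using 1
  ext v
  obtain ⟨a, ha, h⟩ := exists_rep_mk' v
  simp only [Set.mem_preimage, Set.mem_ofPred_eq, lin_mk' ℓ v h, Set.mem_compl_iff,
    Set.mem_singleton_iff, ne_eq, mul_eq_zero, ha, false_or]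

theorem continuousAt_lin_div (ℓ ℓ' : Fin (n + 1) → ℂ) {p : PSpace n} (hp : lin ℓ' p ≠ 0) :
    ContinuousAt (fun x => lin ℓ x / lin ℓ' x) p := by
  obtain ⟨v, rfl⟩ := isOpenQuotientMap_mk'.surjective p
  rw [← isOpenQuotientMap_mk'.continuousAt_comp_iff]
  obtain ⟨a, ha, h⟩ := exists_rep_mk' v
  have heq : (fun x => lin ℓ x / lin ℓ' x) ∘ Projectivization.mk' ℂ =
      fun v : NZ n => (∑ i, ℓ i * (v : Fin (n + 1) → ℂ) i) /
        (∑ i, ℓ' i * (v : Fin (n + 1) → ℂ) i) := by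
    ext v
    obtain ⟨a, ha, h⟩ := exists_rep_mk' v
    rw [Function.comp_apply, lin_mk' ℓ v h, lin_mk' ℓ' v h, mul_div_mul_left _ _ ha]
  rw [heq]
  rw [lin_mk' ℓ' v h] at hp
  exact (continuous_lin_coord ℓ).continuousAt.div (continuous_lin_coord ℓ').continuousAt
    (right_ne_zero_of_mul hp)

theorem lin_single (i : Fin (n + 1)) (p : PSpace n) : lin (Pi.single i 1) p = p.rep i := by
  simp [lin, Pi.single_apply]

theorem isOpen_rep_ne_zero (j : Fin (n + 1)) : IsOpen {p : PSpace n | p.rep j ≠ 0} := by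
  simpa only [lin_single] using isOpen_lin_ne_zero (Pi.single j 1)

theorem continuousAt_rep_div (i j : Fin (n + 1)) {p : PSpace n} (hp : p.rep j ≠ 0) :
    ContinuousAt (fun x : PSpace n => x.rep i / x.rep j) p := by
  have := continuousAt_lin_div (Pi.single i 1) (Pi.single j 1) (p := p)
    (by rwa [lin_single])
  simpa only [lin_single] using this

/-- Points with the same ratios of coordinates agree. -/
theorem eq_of_rep_div_lin {p p' : PSpace n} (ℓ : Fin (n + 1) → ℂ) (hp : lin ℓ p ≠ 0)
    (hp' : lin ℓ p' ≠ 0) (h : ∀ i, p.rep i / lin ℓ p = p'.rep i / lin ℓ p') : p = p' := by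
  rw [← p.mk_rep, ← p'.mk_rep, Projectivization.mk_eq_mk_iff']
  refine ⟨lin ℓ p / lin ℓ p', ?_⟩
  ext i
  have := h i
  field_simp at this
  simp only [Pi.smul_apply, smul_eq_mul]
  field_simp
  linear_combination -this

/-- The point of `ℙ¹` with affine coordinate `c` in the chart where the coordinate `j` is `1`. -/
def affPt (j : Fin 2) (c : ℂ) : PSpace 1 :=
  Projectivization.mk' ℂ ⟨Function.update (fun _ => c) j 1, fun h => by
    have := congrFun h j
    simp at this⟩

/-- The affine coordinate of a point of `ℙ¹` in the chart where the coordinate `j` is `1`. -/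
def affCrd (j : Fin 2) (p : PSpace 1) : ℂ := p.rep (1 - j) / p.rep j

theorem one_sub_ne (j : Fin 2) : 1 - j ≠ j := by fin_cases j <;> decide

theorem affPt_rep (j : Fin 2) (c : ℂ) :
    ∃ a : ℂ, a ≠ 0 ∧ (affPt j c).rep j = a ∧ (affPt j c).rep (1 - j) = a * c := by
  obtain ⟨a, ha, h⟩ := exists_rep_mk' (n := 1) ⟨Function.update (fun _ => c) j 1, fun h => by
    have := congrFun h j
    simp at this⟩
  refine ⟨a, ha, ?_, ?_⟩
  · rw [affPt, h]; simp
  · rw [affPt, h]; simp [one_sub_ne]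

theorem affPt_rep_ne_zero (j : Fin 2) (c : ℂ) : (affPt j c).rep j ≠ 0 := by
  obtain ⟨a, ha, h, -⟩ := affPt_rep j c
  rwa [h]

theorem affCrd_affPt (j : Fin 2) (c : ℂ) : affCrd j (affPt j c) = c := by
  obtain ⟨a, ha, h, h'⟩ := affPt_rep j c
  rw [affCrd, h, h']
  field_simp

theorem affPt_affCrd {j : Fin 2} {p : PSpace 1} (hp : p.rep j ≠ 0) :
    affPt j (affCrd j p) = p := by
  rw [affPt]
  conv_rhs => rw [← mk'_rep p]
  rw [mk'_eq_mk'_iff]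
  refine ⟨(Units.mk0 _ hp)⁻¹, ?_⟩
  ext i
  by_cases hi : i = j
  · subst hi; simp [Units.smul_def, hp]
  · have : i = 1 - j := by fin_cases i <;> fin_cases j <;> simp_all
    subst this
    simp [Units.smul_def, hi, affCrd]
    field_simp

theorem continuous_affPt (j : Fin 2) : Continuous (affPt j) := by
  refine continuous_mk'.comp (Continuous.subtype_mk ?_ _)
  exact Continuous.update (by fun_prop) _ continuous_const

theorem continuousAt_affCrd {j : Fin 2} {p : PSpace 1} (hp : p.rep j ≠ 0) :
    ContinuousAt (affCrd j) p :=
  continuousAt_rep_div _ _ hp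

theorem exists_rep_ne_zero (p : PSpace n) : ∃ j, p.rep j ≠ 0 := by
  by_contra! h
  exact p.rep_nonzero (funext h)

theorem affPt_injective (j : Fin 2) : Function.Injective (affPt j) :=
  Function.LeftInverse.injective (affCrd_affPt j)

theorem tendsto_affCrd {j : Fin 2} (c : ℂ) : Tendsto (affCrd j) (𝓝 (affPt j c)) (𝓝 c) := by
  have := continuousAt_affCrd (affPt_rep_ne_zero j c)
  rwa [ContinuousAt, affCrd_affPt] at this

/-- Neighbourhoods in `ℙ¹` in terms of the affine coordinate. -/
theorem eventually_nhds_affPt {j : Fin 2} {c : ℂ} {P : PSpace 1 → Prop} :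
    (∀ᶠ p in 𝓝 (affPt j c), P p) ↔ ∀ᶠ t in 𝓝 c, P (affPt j t) := by
  constructor
  · exact fun h => (continuous_affPt j).continuousAt.eventually h
  · intro h
    have h1 := (tendsto_affCrd (j := j) c).eventually h
    have h2 := (isOpen_rep_ne_zero j).mem_nhds (affPt_rep_ne_zero j c)
    filter_upwards [h1, h2] with p hp hpj
    rwa [affPt_affCrd hpj] at hp

end ClassicalTopology

end Decomposable
end

noncomputable section

namespace Decomposable

/-! ### The Zariski topology -/

section Zariski

/-- The forms of an ambient space are closed under products. -/
class MulForms (M : Type) [HasForms M] : Prop where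
  one : ∃ d, (fun _ => 1) ∈ HasForms.form (M := M) d
  mul : ∀ {d e : HasForms.Deg M} {φ ψ : M → ℂ}, φ ∈ HasForms.form d → ψ ∈ HasForms.form e →
    ∃ f, (fun x => φ x * ψ x) ∈ HasForms.form (M := M) f

instance (N : ℕ) : MulForms (Fin N → ℂ) where
  one := ⟨(), 1, by simp⟩
  mul := by
    rintro - - _ _ ⟨F, rfl⟩ ⟨G, rfl⟩
    exact ⟨(), F * G, by simp⟩

instance (n : ℕ) : MulForms (PSpace n) where
  one := ⟨(0 : ℕ), 1, MvPolynomial.isHomogeneous_one _ _, by simp⟩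
  mul := by
    rintro d e _ _ ⟨F, hF, rfl⟩ ⟨G, hG, rfl⟩
    exact ⟨((show ℕ from d) + (show ℕ from e) : ℕ), F * G, MvPolynomial.IsHomogeneous.mul hF hG, by simp⟩

instance (n m : ℕ) : MulForms (PSpace n × PSpace m) where
  one := ⟨((0, 0) : ℕ × ℕ), 1, MvPolynomial.isWeightedHomogeneous_one _ _, by
    ext; simp [evalAt]⟩
  mul := by
    rintro d e _ _ ⟨F, hF, rfl⟩ ⟨G, hG, rfl⟩
    exact ⟨((show ℕ × ℕ from d) + (show ℕ × ℕ from e) : ℕ × ℕ), F * G, MvPolynomial.IsWeightedHomogeneous.mul hF hG, by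
      ext; simp [evalAt]⟩

variable {M : Type} [HasForms M]

theorem isOpen_form_ne_zero {d : HasForms.Deg M} {φ : M → ℂ} (hφ : φ ∈ HasForms.form d) :
    IsOpen[zariski M] {x | φ x ≠ 0} :=
  TopologicalSpace.isOpen_generateFrom_of_mem ⟨d, φ, hφ, rfl⟩

/-- Products of forms are forms, so the nonvanishing sets are stable under intersection and are a
basis, not just a subbasis. -/
theorem exists_form_of_isOpen [MulForms M] {O : Set M} (hO : IsOpen[zariski M] O) {p : M}
    (hp : p ∈ O) : ∃ d, ∃ φ ∈ HasForms.form (M := M) d, φ p ≠ 0 ∧ ∀ x, φ x ≠ 0 → x ∈ O := by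
  induction hO with
  | basic s hs =>
    obtain ⟨d, φ, hφ, rfl⟩ := hs
    exact ⟨d, φ, hφ, hp, fun x hx => hx⟩
  | univ =>
    obtain ⟨d, hd⟩ := MulForms.one (M := M)
    exact ⟨d, _, hd, one_ne_zero, fun _ _ => trivial⟩
  | inter s t _ _ ihs iht =>
    obtain ⟨d, φ, hφ, h1, h2⟩ := ihs hp.1
    obtain ⟨e, ψ, hψ, h3, h4⟩ := iht hp.2
    obtain ⟨f, hf⟩ := MulForms.mul hφ hψ
    exact ⟨f, _, hf, mul_ne_zero h1 h3, fun x hx =>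
      ⟨h2 x (left_ne_zero_of_mul hx), h4 x (right_ne_zero_of_mul hx)⟩⟩
  | sUnion 𝒮 _ ih =>
    obtain ⟨s, hs, hps⟩ := hp
    obtain ⟨d, φ, hφ, h1, h2⟩ := ih s hs hps
    exact ⟨d, φ, hφ, h1, fun x hx => ⟨s, hs, h2 x hx⟩⟩

end Zariski

/-! ### Bihomogenization and the affine charts of `ℙⁿ × ℙᵐ` -/

section Bihomogeneous

variable {n m : ℕ}

/-- The linear form with coefficients `ℓ` in the first set of variables. -/
def linPoly (ℓ : Fin (n + 1) → ℂ) : MvPolynomial (Fin (n + 1) ⊕ Fin (m + 1)) ℂ :=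
  ∑ i, MvPolynomial.C (ℓ i) * MvPolynomial.X (Sum.inl i)

theorem isBihomogeneous_linPoly (ℓ : Fin (n + 1) → ℂ) :
    IsBihomogeneous (linPoly ℓ : MvPolynomial (Fin (n + 1) ⊕ Fin (m + 1)) ℂ) (1, 0) := by
  refine MvPolynomial.IsWeightedHomogeneous.sum _ _ _ fun i _ => ?_
  have := (MvPolynomial.isWeightedHomogeneous_C
    (Sum.elim (fun _ => ((1, 0) : ℕ × ℕ)) (fun _ => ((0, 1) : ℕ × ℕ)) :
      Fin (n + 1) ⊕ Fin (m + 1) → ℕ × ℕ) (ℓ i)).mul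
    (MvPolynomial.isWeightedHomogeneous_X ℂ _ (Sum.inl i))
  simpa using this

theorem isBihomogeneous_X_inl (i : Fin (n + 1)) :
    IsBihomogeneous (MvPolynomial.X (Sum.inl i) : MvPolynomial (Fin (n + 1) ⊕ Fin (m + 1)) ℂ)
      (1, 0) :=
  MvPolynomial.isWeightedHomogeneous_X ℂ _ (Sum.inl i)

theorem isBihomogeneous_X_inr (i : Fin (m + 1)) :
    IsBihomogeneous (MvPolynomial.X (Sum.inr i) : MvPolynomial (Fin (n + 1) ⊕ Fin (m + 1)) ℂ)
      (0, 1) :=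
  MvPolynomial.isWeightedHomogeneous_X ℂ _ (Sum.inr i)

theorem isBihomogeneous_C (a : ℂ) :
    IsBihomogeneous (MvPolynomial.C a : MvPolynomial (Fin (n + 1) ⊕ Fin (m + 1)) ℂ) (0, 0) :=
  MvPolynomial.isWeightedHomogeneous_C _ a

theorem evalAt_linPoly (ℓ : Fin (n + 1) → ℂ) (p : PSpace n × PSpace m) :
    evalAt (linPoly ℓ) p = lin ℓ p.1 := by
  simp [evalAt, linPoly, lin]

theorem evalAt_mem_form {F : MvPolynomial (Fin (n + 1) ⊕ Fin (m + 1)) ℂ} {d : ℕ × ℕ}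
    (hF : IsBihomogeneous F d) :
    evalAt F ∈ HasForms.form (M := PSpace n × PSpace m) d := ⟨F, hF, rfl⟩

/-- Normalized coordinates of the points where the form `ℓ` and the coordinate `j` do not
vanish. -/
def normCrd (ℓ : Fin (n + 1) → ℂ) (j : Fin (m + 1)) (p : PSpace n × PSpace m) :
    Fin (n + 1) ⊕ Fin (m + 1) → ℂ :=
  Sum.elim (fun i => p.1.rep i / lin ℓ p.1) (fun i => p.2.rep i / p.2.rep j)

/-- A power of `ℓ · t_j` clears the denominators of the normalized coordinates. All large exponents
are provided so that two polynomials can be brought to the same bidegree. -/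
theorem exists_bihomogenization (ℓ : Fin (n + 1) → ℂ) (j : Fin (m + 1))
    (F : MvPolynomial (Fin (n + 1) ⊕ Fin (m + 1)) ℂ) :
    ∃ N₀ : ℕ, ∀ N ≥ N₀, ∃ G : MvPolynomial (Fin (n + 1) ⊕ Fin (m + 1)) ℂ,
      IsBihomogeneous G (N, N) ∧ ∀ p : PSpace n × PSpace m, lin ℓ p.1 ≠ 0 → p.2.rep j ≠ 0 →
        evalAt G p = (lin ℓ p.1 * p.2.rep j) ^ N * F.eval (normCrd ℓ j p) := by
  have hbase : ∀ N : ℕ, IsBihomogeneous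
      ((linPoly ℓ * MvPolynomial.X (Sum.inr j)) ^ N :
        MvPolynomial (Fin (n + 1) ⊕ Fin (m + 1)) ℂ) (N, N) := fun N => by
    have := ((isBihomogeneous_linPoly (m := m) ℓ).mul (isBihomogeneous_X_inr j)).pow N
    simpa [IsBihomogeneous] using this
  induction F using MvPolynomial.induction_on with
  | C a =>
    refine ⟨0, fun N _ => ⟨(linPoly ℓ * MvPolynomial.X (Sum.inr j)) ^ N * MvPolynomial.C a, ?_,
      fun p hp hpj => ?_⟩⟩
    · have := (hbase N).mul (isBihomogeneous_C a)
      simpa [IsBihomogeneous] using this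
    · simp only [evalAt, map_mul, map_pow, MvPolynomial.eval_C, MvPolynomial.eval_X, Sum.elim_inr]
      congr 3
      exact evalAt_linPoly ℓ p
  | add F G hF hG =>
    obtain ⟨N₁, h₁⟩ := hF
    obtain ⟨N₂, h₂⟩ := hG
    refine ⟨max N₁ N₂, fun N hN => ?_⟩
    obtain ⟨F', hF', h⟩ := h₁ N (le_of_max_le_left hN)
    obtain ⟨G', hG', h'⟩ := h₂ N (le_of_max_le_right hN)
    refine ⟨F' + G', hF'.add hG', fun p hp hpj => ?_⟩
    have e1 := h p hp hpj
    have e2 := h' p hp hpj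
    simp only [evalAt, map_add] at e1 e2 ⊢
    rw [e1, e2]; ring
  | mul_X F i hF =>
    obtain ⟨N₁, h₁⟩ := hF
    refine ⟨N₁ + 1, fun N hN => ?_⟩
    obtain ⟨N', rfl⟩ : ∃ N', N = N' + 1 := ⟨N - 1, by omega⟩
    obtain ⟨F', hF', h⟩ := h₁ N' (by omega)
    rcases i with i | i
    · refine ⟨F' * (MvPolynomial.X (Sum.inl i) * MvPolynomial.X (Sum.inr j)), ?_,
        fun p hp hpj => ?_⟩
      · have := MvPolynomial.IsWeightedHomogeneous.mul hF'
          ((isBihomogeneous_X_inl (m := m) i).mul (isBihomogeneous_X_inr j))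
        simpa [IsBihomogeneous] using this
      · have e1 := h p hp hpj
        simp only [evalAt, map_mul, MvPolynomial.eval_X, Sum.elim_inl, Sum.elim_inr, normCrd]
          at e1 ⊢
        rw [e1]; field_simp; ring
    · refine ⟨F' * (linPoly ℓ * MvPolynomial.X (Sum.inr i)), ?_, fun p hp hpj => ?_⟩
      · have := MvPolynomial.IsWeightedHomogeneous.mul hF'
          ((isBihomogeneous_linPoly (m := m) ℓ).mul (isBihomogeneous_X_inr i))
        simpa [IsBihomogeneous] using this
      · have e1 := h p hp hpj
        have e2 := evalAt_linPoly (m := m) ℓ p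
        simp only [evalAt, map_mul, MvPolynomial.eval_X, Sum.elim_inr, normCrd] at e1 e2 ⊢
        rw [e1, e2]; field_simp; ring

/-- The part of `C` in an affine chart. -/
def chart (C : Set (PSpace n × PSpace m)) (ℓ : Fin (n + 1) → ℂ) (j : Fin (m + 1)) :
    Set (PSpace n × PSpace m) := {p ∈ C | lin ℓ p.1 ≠ 0 ∧ p.2.rep j ≠ 0}

theorem normCrd_injOn (ℓ : Fin (n + 1) → ℂ) (j : Fin (m + 1)) :
    Set.InjOn (normCrd ℓ j) {p : PSpace n × PSpace m | lin ℓ p.1 ≠ 0 ∧ p.2.rep j ≠ 0} := by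
  rintro ⟨x, t⟩ ⟨hx, ht⟩ ⟨x', t'⟩ ⟨hx', ht'⟩ h
  refine Prod.ext ?_ ?_
  · exact eq_of_rep_div_lin ℓ hx hx' fun i => congrFun h (Sum.inl i)
  · refine eq_of_rep_div_lin (Pi.single j 1) (by simpa [lin_single] using ht)
      (by simpa [lin_single] using ht') fun i => ?_
    have := congrFun h (Sum.inr i)
    simpa [lin_single, normCrd] using this

theorem isOpen_chart (ℓ : Fin (n + 1) → ℂ) (j : Fin (m + 1)) :
    IsOpen[zariski (PSpace n × PSpace m)] {p | lin ℓ p.1 ≠ 0 ∧ p.2.rep j ≠ 0} := by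
  have h := isOpen_form_ne_zero (evalAt_mem_form
    (MvPolynomial.IsWeightedHomogeneous.mul (isBihomogeneous_linPoly (m := m) ℓ)
      (isBihomogeneous_X_inr j)))
  convert h using 1
  ext p
  have := evalAt_linPoly (m := m) ℓ p
  simp only [evalAt, map_mul, MvPolynomial.eval_X, Sum.elim_inr] at this ⊢
  simp [this]

/-- The part of an irreducible closed set in an affine chart is an irreducible algebraic set. -/
theorem isIrreducibleAlgebraic_chart {C : Set (PSpace n × PSpace m)}
    (hcl : IsClosed[zariski (PSpace n × PSpace m)] C)
    (hirr : @IsIrreducible _ (zariski (PSpace n × PSpace m)) C) {ℓ : Fin (n + 1) → ℂ}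
    {j : Fin (m + 1)} (hne : (chart C ℓ j).Nonempty) :
    IsIrreducibleAlgebraic (normCrd ℓ j '' chart C ℓ j) where
  nonempty := hne.image _
  closed w hw := by
    -- The equations `ℓ = 1` and `t_j = 1` hold on the image of the chart, hence at `w`. So both
    -- halves of `w` are nonzero vectors and define a point of `ℙⁿ × ℙᵐ`.
    have h1 : ∑ i, ℓ i * w (Sum.inl i) = 1 := by
      have := hw (linPoly ℓ - 1) (by
        rintro _ ⟨p, ⟨-, hp, -⟩, rfl⟩
        simp only [linPoly, normCrd, map_sub, map_sum, map_mul, MvPolynomial.eval_C,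
          MvPolynomial.eval_X, Sum.elim_inl, map_one, ← mul_div_assoc, ← Finset.sum_div]
        rw [← lin, div_self hp, sub_self])
      simpa [linPoly, sub_eq_zero] using this
    have h2 : w (Sum.inr j) = 1 := by
      have := hw (MvPolynomial.X (Sum.inr j) - 1) (by
        rintro _ ⟨p, ⟨-, -, hp⟩, rfl⟩
        simp [normCrd, hp])
      simpa [sub_eq_zero] using this
    let x : NZ n := ⟨w ∘ Sum.inl, fun h0 => by
      have : ∀ i, w (Sum.inl i) = 0 := fun i => congrFun h0 i
      simp [this] at h1⟩
    let t : NZ m := ⟨w ∘ Sum.inr, fun h0 => by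
      have : w (Sum.inr j) = 0 := congrFun h0 j
      simp [this] at h2⟩
    obtain ⟨a, ha, hxa⟩ := exists_rep_mk' x
    obtain ⟨b, hb, htb⟩ := exists_rep_mk' t
    have hlin : lin ℓ (Projectivization.mk' ℂ x) = a := by
      rw [lin_mk' ℓ x hxa]
      show a * ∑ i, ℓ i * w (Sum.inl i) = a
      rw [h1, mul_one]
    have htj : (Projectivization.mk' ℂ t).rep j = b := by
      rw [htb]
      show b * w (Sum.inr j) = b
      rw [h2, mul_one]
    refine ⟨(Projectivization.mk' ℂ x, Projectivization.mk' ℂ t), ⟨?_, ?_, ?_⟩, ?_⟩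
    · by_contra hp
      obtain ⟨d, φ, ⟨F, hF, rfl⟩, h3, h4⟩ := exists_form_of_isOpen hcl.isOpen_compl hp
      refine h3 ?_
      have hw0 : F.eval w = 0 := hw F (by
        rintro _ ⟨p, ⟨hpC, hp, hpj⟩, rfl⟩
        by_contra hne
        refine h4 p ?_ hpC
        intro h0
        apply hne
        have e : normCrd ℓ j p =
            Sum.elim ((lin ℓ p.1)⁻¹ • p.1.rep) ((p.2.rep j)⁻¹ • p.2.rep) := by
          ext i
          rcases i with i | i <;> simp [normCrd, div_eq_inv_mul]
        rw [e, hF.eval_smul]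
        rw [evalAt] at h0
        rw [h0, mul_zero])
      rw [evalAt, hxa, htb, hF.eval_smul]
      have : Sum.elim (x : Fin (n + 1) → ℂ) (t : Fin (m + 1) → ℂ) = w := by
        ext i; rcases i with i | i <;> rfl
      rw [this, hw0, mul_zero]
    · rwa [hlin]
    · rwa [htj]
    · ext i
      rcases i with i | i
      · show (Projectivization.mk' ℂ x).rep i / lin ℓ (Projectivization.mk' ℂ x) = _
        rw [hlin, hxa]
        show a * w (Sum.inl i) / a = _
        field_simp
      · show (Projectivization.mk' ℂ t).rep i / (Projectivization.mk' ℂ t).rep j = _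
        rw [htj, htb]
        show b * w (Sum.inr i) / b = _
        field_simp
  prime P Q hPQ := by
    by_contra! hcon
    obtain ⟨⟨_, ⟨p, hp, rfl⟩, hP⟩, ⟨_, ⟨q, hq, rfl⟩, hQ⟩⟩ := hcon
    obtain ⟨N₁, h₁⟩ := exists_bihomogenization ℓ j P
    obtain ⟨N₂, h₂⟩ := exists_bihomogenization ℓ j Q
    obtain ⟨F, hF, hF'⟩ := h₁ N₁ le_rfl
    obtain ⟨G, hG, hG'⟩ := h₂ N₂ le_rfl
    -- Two polynomials that do not vanish identically have nonempty open nonvanishing sets in `C`;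
    -- by irreducibility these meet, and there the product is nonzero.
    have hOF := @IsOpen.inter _ (zariski (PSpace n × PSpace m)) _ _ (isOpen_chart ℓ j)
      (isOpen_form_ne_zero (evalAt_mem_form hF))
    have hOG := @IsOpen.inter _ (zariski (PSpace n × PSpace m)) _ _ (isOpen_chart ℓ j)
      (isOpen_form_ne_zero (evalAt_mem_form hG))
    obtain ⟨r, hrC, ⟨hr, hr1⟩, -, hr2⟩ := hirr.2 _ _ hOF hOG
      ⟨p, hp.1, hp.2, by
        show evalAt F p ≠ 0
        rw [hF' p hp.2.1 hp.2.2]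
        exact mul_ne_zero (pow_ne_zero _ (mul_ne_zero hp.2.1 hp.2.2)) hP⟩
      ⟨q, hq.1, hq.2, by
        show evalAt G q ≠ 0
        rw [hG' q hq.2.1 hq.2.2]
        exact mul_ne_zero (pow_ne_zero _ (mul_ne_zero hq.2.1 hq.2.2)) hQ⟩
    have h1 : evalAt F r ≠ 0 := hr1
    have h2 : evalAt G r ≠ 0 := hr2
    rw [hF' r hr.1 hr.2] at h1
    rw [hG' r hr.1 hr.2] at h2
    exact mul_ne_zero (right_ne_zero_of_mul h1) (right_ne_zero_of_mul h2)
      (hPQ _ ⟨r, ⟨hrC, hr⟩, rfl⟩)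

end Bihomogeneous

end Decomposable
end

noncomputable section

namespace Decomposable

/-! ### General points of the projective line -/

section ProjectiveLine

open Polynomial

theorem eq_affPt_of_rep_eq_zero {j : Fin 2} {p : PSpace 1} (hp : p.rep j = 0) :
    p = affPt (1 - j) 0 := by
  obtain ⟨i, hi⟩ := exists_rep_ne_zero p
  have hij : i = 1 - j := by
    fin_cases i <;> fin_cases j <;> simp_all
  subst hij
  rw [← affPt_affCrd hi]
  congr 1
  have : 1 - (1 - j) = j := by fin_cases j <;> rfl
  rw [affCrd, this, hp, zero_div]

theorem eval_smul_of_isHomogeneous {σ : Type} [Fintype σ] {F : MvPolynomial σ ℂ} {d : ℕ}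
    (hF : F.IsHomogeneous d) (a : ℂ) (x : σ → ℂ) : F.eval (a • x) = a ^ d * F.eval x := by
  rw [MvPolynomial.eval_eq', MvPolynomial.eval_eq', Finset.mul_sum]
  refine Finset.sum_congr rfl fun e he => ?_
  have hw : ∑ i, e i = d := by
    rw [← hF (MvPolynomial.mem_support_iff.mp he), Finsupp.weight_apply,
      Finsupp.sum_fintype _ _ (by simp)]
    simp
  simp only [Pi.smul_apply, smul_eq_mul, mul_pow, Finset.prod_mul_distrib,
    Finset.prod_pow_eq_pow_sum, hw]
  ring

/-- In an affine coordinate, the complement of a nonempty basic open set lies in the zeros of a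
nonzero polynomial in one variable; only the point at infinity is left over. -/
theorem finite_compl_of_isOpen {O : Set (PSpace 1)} (hO : IsOpen[zariski (PSpace 1)] O)
    (hne : O.Nonempty) : Oᶜ.Finite := by
  obtain ⟨p, hp⟩ := hne
  obtain ⟨d, φ, ⟨F, hF, rfl⟩, h1, h2⟩ := exists_form_of_isOpen hO hp
  obtain ⟨j, hj⟩ := exists_rep_ne_zero p
  -- the dehomogenization of `F`
  let f : ℂ[X] := MvPolynomial.aeval (Function.update (fun _ => X) j 1) F
  have hf : ∀ c, f.eval c = F.eval (Function.update (fun _ => c) j 1) := fun c => by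
    have : (evalRingHom c : ℂ[X] →+* ℂ) (MvPolynomial.aeval (Function.update (fun _ => X) j 1) F)
        = F.eval (Function.update (fun _ => c) j 1) := by
      rw [MvPolynomial.aeval_def, MvPolynomial.hom_eval₂, ← MvPolynomial.eval₂_id]
      congr 1
      · ext; simp
      · ext i
        by_cases hi : i = j
        · subst hi; simp
        · simp [hi]
    exact this
  have hval : ∀ c, ∃ a : ℂ, a ≠ 0 ∧ F.eval (affPt j c).rep = a * f.eval c := fun c => by
    obtain ⟨a, ha, h⟩ := exists_rep_mk' (n := 1) ⟨Function.update (fun _ => c) j 1, fun h => by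
      have := congrFun h j
      simp at this⟩
    refine ⟨a ^ (show ℕ from d), pow_ne_zero _ ha, ?_⟩
    rw [affPt, h, hf]
    exact eval_smul_of_isHomogeneous hF a _
  have hf0 : f ≠ 0 := by
    intro h0
    obtain ⟨a, ha, h⟩ := hval (affCrd j p)
    rw [affPt_affCrd hj, h0, eval_zero, mul_zero] at h
    exact h1 h
  refine (((finite_setOfPred_isRoot hf0).image (affPt j)).union
    (Set.finite_singleton (affPt (1 - j) 0))).subset fun x hx => ?_
  by_cases hxj : x.rep j = 0
  · exact Or.inr (eq_affPt_of_rep_eq_zero hxj)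
  · refine Or.inl ⟨affCrd j x, ?_, affPt_affCrd hxj⟩
    by_contra hroot
    obtain ⟨a, ha, h⟩ := hval (affCrd j x)
    refine hx (h2 x ?_)
    show F.eval x.rep ≠ 0
    rw [affPt_affCrd hxj] at h
    rw [h]
    exact mul_ne_zero ha hroot

instance infinite_projectiveLine : Infinite (PSpace 1) :=
  Infinite.of_injective (affPt 0) (affPt_injective 0)

/-- The pairs whose second component avoids a point. -/
theorem isOpen_snd_ne {n : ℕ} (z : PSpace 1) :
    IsOpen[zariski (PSpace n × PSpace 1)] {p | p.2 ≠ z} := by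
  let F : MvPolynomial (Fin (n + 1) ⊕ Fin (1 + 1)) ℂ :=
    MvPolynomial.C (z.rep 0) * MvPolynomial.X (Sum.inr 1) -
      MvPolynomial.C (z.rep 1) * MvPolynomial.X (Sum.inr 0)
  have hF : IsBihomogeneous F (0, 1) := by
    have h1 := (isBihomogeneous_C (n := n) (m := 1) (z.rep 0)).mul (isBihomogeneous_X_inr 1)
    have h2 := (isBihomogeneous_C (n := n) (m := 1) (z.rep 1)).mul (isBihomogeneous_X_inr 0)
    simpa [IsBihomogeneous] using h1.sub h2
  convert isOpen_form_ne_zero (evalAt_mem_form hF) using 1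
  ext p
  simp only [Set.mem_ofPred_eq, ne_eq, not_iff_not]
  have hval : evalAt F p = z.rep 0 * p.2.rep 1 - z.rep 1 * p.2.rep 0 := by simp [evalAt, F]
  rw [hval, sub_eq_zero]
  constructor
  · rintro rfl; ring
  · intro h
    rw [← p.2.mk_rep, ← z.mk_rep, Projectivization.mk_eq_mk_iff']
    obtain ⟨j, hj⟩ := exists_rep_ne_zero z
    refine ⟨p.2.rep j / z.rep j, ?_⟩
    have key : ∀ i j : Fin 2, z.rep j * p.2.rep i = z.rep i * p.2.rep j := by
      rw [Fin.forall_fin_two]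
      constructor <;> rw [Fin.forall_fin_two] <;> constructor
      · ring
      · linear_combination -h
      · linear_combination h
      · ring
    ext i
    simp only [Pi.smul_apply, smul_eq_mul]
    field_simp
    linear_combination -key i j

theorem isOpen_snd_notMem {n : ℕ} {Z : Set (PSpace 1)} (hZ : Z.Finite) :
    IsOpen[zariski (PSpace n × PSpace 1)] {p | p.2 ∉ Z} := by
  have h := @Set.Finite.isOpen_biInter _ (PSpace 1) (zariski (PSpace n × PSpace 1)) Z
    (fun z => {p | p.2 ≠ z}) hZ (fun z _ => isOpen_snd_ne z)
  convert h using 1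
  ext p
  simp only [Set.mem_iInter, Set.mem_ofPred_eq]
  exact ⟨fun h z hz e => h (e ▸ hz), fun h hp => h _ hp rfl⟩

end ProjectiveLine

/-! ### Curves over the projective line -/

section Curves

open Polynomial

variable {n : ℕ} {C : Set (PSpace n × PSpace 1)} {d : ℕ}

theorem finite_setOf_encard_fiber_ne
    (hd : HasDegree Prod.snd C (Set.univ : Set (PSpace 1)) d) :
    {q | (fiber C q).encard ≠ d}.Finite := by
  obtain ⟨W, hW, hne, h⟩ := hd
  rw [Set.univ_inter] at hne h
  refine (finite_compl_of_isOpen hW hne).subset fun q hq hqW => hq (h q hqW)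

theorem hasDegree_unique {d' : ℕ} (hd : HasDegree Prod.snd C (Set.univ : Set (PSpace 1)) d)
    (hd' : HasDegree Prod.snd C (Set.univ : Set (PSpace 1)) d') : d = d' := by
  obtain ⟨q, hq⟩ := ((finite_setOf_encard_fiber_ne hd).union
    (finite_setOf_encard_fiber_ne hd')).exists_notMem
  simp only [Set.mem_union, Set.mem_ofPred_eq, not_or, not_not] at hq
  exact_mod_cast hq.1.symm.trans hq.2

theorem notMem_branchLocus (hd : HasDegree Prod.snd C (Set.univ : Set (PSpace 1)) d)
    {q : PSpace 1} : q ∉ branchLocus C ↔ (fiber C q).encard = d := by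
  simp only [branchLocus, Set.mem_ofPred_eq, not_not]
  constructor
  · rintro ⟨d', hd', h⟩
    rwa [hasDegree_unique hd hd']
  · exact fun h => ⟨d, hd, h⟩

theorem finite_branchLocus (hd : HasDegree Prod.snd C (Set.univ : Set (PSpace 1)) d) :
    (branchLocus C).Finite :=
  (finite_setOf_encard_fiber_ne hd).subset fun _ hq h =>
    absurd hq ((notMem_branchLocus hd).mpr h)

/-- A curve in `ℙⁿ × ℙ¹` with general fibers of `d` points over `ℙ¹`. -/
structure IsCover (C : Set (PSpace n × PSpace 1)) (d : ℕ) : Prop where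
  closed : IsClosed[zariski (PSpace n × PSpace 1)] C
  irreducible : @IsIrreducible _ (zariski (PSpace n × PSpace 1)) C
  degree : HasDegree Prod.snd C (Set.univ : Set (PSpace 1)) d
  pos : 0 < d

theorem eval_normCrd_X_inr (ℓ : Fin (n + 1) → ℂ) (j : Fin 2) (p : PSpace n × PSpace 1) :
    (MvPolynomial.X (Sum.inr (1 - j)) : MvPolynomial (Fin (n + 1) ⊕ Fin 2) ℂ).eval
      (normCrd ℓ j p) = affCrd j p.2 := by
  simp [normCrd, affCrd]

theorem eval_normCrd_linPoly (ℓ ℓ' : Fin (n + 1) → ℂ) (j : Fin 2) (p : PSpace n × PSpace 1) :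
    (linPoly ℓ' : MvPolynomial (Fin (n + 1) ⊕ Fin 2) ℂ).eval
      (normCrd ℓ j p) = lin ℓ' p.1 / lin ℓ p.1 := by
  simp only [linPoly, normCrd, map_sum, map_mul, MvPolynomial.eval_C, MvPolynomial.eval_X,
    Sum.elim_inl, lin, Finset.sum_div]
  exact Finset.sum_congr rfl fun i _ => by ring

/-- Otherwise the chart would lie over finitely many points of `ℙ¹`. The part of `C` off those
fibers is open and nonempty, so by irreducibility it would meet the chart. -/
theorem IsCover.infinite_image (hC : IsCover C d) {ℓ : Fin (n + 1) → ℂ} {j : Fin 2}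
    (hne : (chart C ℓ j).Nonempty) :
    ((fun w => (MvPolynomial.X (Sum.inr (1 - j)) : MvPolynomial (Fin (n + 1) ⊕ Fin 2) ℂ).eval w) ''
      (normCrd ℓ j '' chart C ℓ j) : Set ℂ).Infinite := by
  intro hfin
  have hset : (fun w => (MvPolynomial.X (Sum.inr (1 - j)) :
      MvPolynomial (Fin (n + 1) ⊕ Fin 2) ℂ).eval w) '' (normCrd ℓ j '' chart C ℓ j) =
      (fun p => affCrd j p.2) '' chart C ℓ j := by
    rw [Set.image_image]
    simp only [eval_normCrd_X_inr]
  rw [hset] at hfin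
  have hZ := hfin.image (affPt j)
  obtain ⟨q, hq⟩ := (hZ.union (finite_setOf_encard_fiber_ne hC.degree)).exists_notMem
  simp only [Set.mem_union, Set.mem_ofPred_eq, not_or, not_not] at hq
  obtain ⟨y, hy⟩ : (fiber C q).Nonempty := by
    rw [← Set.encard_pos, hq.2]
    exact_mod_cast hC.pos
  obtain ⟨x, hx⟩ := hne
  obtain ⟨r, hrC, hr1, hr2⟩ := hC.irreducible.2 _ _ (isOpen_chart ℓ j) (isOpen_snd_notMem hZ)
    ⟨x, hx⟩ ⟨y, hy.1, fun h => hq.1 (by rwa [← hy.2])⟩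
  exact hr2 ⟨_, ⟨r, ⟨hrC, hr1⟩, rfl⟩, affPt_affCrd hr1.2⟩

theorem setOf_eval_normCrd (ℓ : Fin (n + 1) → ℂ) (j : Fin 2) (c : ℂ) :
    {w ∈ normCrd ℓ j '' chart C ℓ j | (MvPolynomial.X (Sum.inr (1 - j)) :
      MvPolynomial (Fin (n + 1) ⊕ Fin 2) ℂ).eval w = c} =
      normCrd ℓ j '' {p ∈ fiber C (affPt j c) | lin ℓ p.1 ≠ 0} := by
  ext w
  constructor
  · rintro ⟨⟨p, hp, rfl⟩, h⟩
    rw [eval_normCrd_X_inr] at h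
    refine ⟨p, ⟨⟨hp.1, ?_⟩, hp.2.1⟩, rfl⟩
    rw [Set.mem_preimage, Set.mem_singleton_iff, ← h, affPt_affCrd hp.2.2]
  · rintro ⟨p, ⟨⟨hpC, hp⟩, hp1⟩, rfl⟩
    rw [Set.mem_preimage, Set.mem_singleton_iff] at hp
    refine ⟨⟨p, ⟨hpC, hp1, by rw [hp]; exact affPt_rep_ne_zero j c⟩, rfl⟩, ?_⟩
    rw [eval_normCrd_X_inr, hp, affCrd_affPt]

theorem IsCover.exists_finite_encard_le (hC : IsCover C d) (ℓ : Fin (n + 1) → ℂ) (j : Fin 2) :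
    ∃ F : Set ℂ, F.Finite ∧ ∀ c ∉ F, {w ∈ normCrd ℓ j '' chart C ℓ j |
      (MvPolynomial.X (Sum.inr (1 - j)) : MvPolynomial (Fin (n + 1) ⊕ Fin 2) ℂ).eval w =
        c}.encard ≤ d := by
  refine ⟨affPt j ⁻¹' {p | (fiber C p).encard ≠ d},
    (finite_setOf_encard_fiber_ne hC.degree).preimage (affPt_injective j).injOn, fun c hc => ?_⟩
  simp only [Set.mem_preimage, Set.mem_ofPred_eq, not_not] at hc
  rw [setOf_eval_normCrd, ← hc]
  exact (Set.encard_image_le _ _).trans (Set.encard_le_encard fun p hp => hp.1)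

/-- Linear forms whose quotient separates finitely many points. -/
theorem exists_separating_forms {Z : Set (PSpace n)} (hZ : Z.Finite) :
    ∃ ℓ₀ ℓ₁ : Fin (n + 1) → ℂ, (∀ p ∈ Z, lin ℓ₀ p ≠ 0) ∧
      Set.InjOn (fun p => lin ℓ₁ p / lin ℓ₀ p) Z := by
  have hdual : ∀ f : Module.Dual ℂ (Fin (n + 1) → ℂ), ∃ ℓ : Fin (n + 1) → ℂ,
      ∀ v, f v = ∑ i, ℓ i * v i := fun f => by
    refine ⟨fun i => f (Pi.single i 1), fun v => ?_⟩
    conv_lhs => rw [← Finset.univ_sum_single v]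
    rw [map_sum]
    refine Finset.sum_congr rfl fun i _ => ?_
    have : (Pi.single i (v i) : Fin (n + 1) → ℂ) = v i • Pi.single i 1 := by
      rw [← Pi.single_smul]; simp
    rw [this, map_smul, smul_eq_mul, mul_comm]
  have := hZ.to_subtype
  obtain ⟨f, hf⟩ := Module.exists_dual_forall_apply_ne_zero (K := ℂ) (fun p : Z => p.1.rep)
    (fun p => p.1.rep_nonzero)
  obtain ⟨ℓ₀, hℓ₀⟩ := hdual f
  have h0 : ∀ p ∈ Z, lin ℓ₀ p ≠ 0 := fun p hp => by
    rw [lin, ← hℓ₀]; exact hf ⟨p, hp⟩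
  -- The vector attached to two distinct points is nonzero because their coordinates normalized by
  -- `ℓ₀` differ; a functional that is nonzero on all these vectors separates the quotients.
  obtain ⟨g, hg⟩ := Module.exists_dual_forall_apply_ne_zero (K := ℂ)
    (fun pp : {pp : Z × Z // pp.1 ≠ pp.2} =>
      lin ℓ₀ pp.1.2.1 • pp.1.1.1.rep - lin ℓ₀ pp.1.1.1 • pp.1.2.1.rep)
    (fun ⟨⟨p, p'⟩, hne⟩ h => hne (Subtype.ext (by
      refine eq_of_rep_div_lin ℓ₀ (h0 p p.2) (h0 p' p'.2) fun i => ?_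
      have hi := congrFun h i
      simp only [Pi.sub_apply, Pi.smul_apply, smul_eq_mul, Pi.zero_apply] at hi
      have h1 := h0 p p.2
      have h2 := h0 p' p'.2
      field_simp
      linear_combination hi)))
  obtain ⟨ℓ₁, hℓ₁⟩ := hdual g
  refine ⟨ℓ₀, ℓ₁, h0, fun p hp p' hp' h => ?_⟩
  by_contra hne
  refine hg ⟨⟨⟨p, hp⟩, ⟨p', hp'⟩⟩, fun h => hne (congrArg Subtype.val h)⟩ ?_
  rw [map_sub, map_smul, map_smul, hℓ₁, hℓ₁, ← lin, ← lin]
  have h1 := h0 p hp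
  have h2 := h0 p' hp'
  simp only at h
  field_simp at h
  simp only [smul_eq_mul]
  linear_combination h

/-- A function `lin ℓ₁ / lin ℓ₀` that separates the points of the fibers of `C` outside the
finite set `F` of values of the affine coordinate, and the relation `Q` that it satisfies. -/
structure SepChart (C : Set (PSpace n × PSpace 1)) (d : ℕ) where
  j : Fin 2
  ℓ₀ : Fin (n + 1) → ℂ
  ℓ₁ : Fin (n + 1) → ℂ
  Q : ℂ[X][X]
  F : Set ℂ
  finite : F.Finite
  natDegree : Q.natDegree = d
  relation : ∀ p ∈ chart C ℓ₀ j, Q.evalEval (affCrd j p.2) (lin ℓ₁ p.1 / lin ℓ₀ p.1) = 0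
  leadingCoeff : ∀ c ∉ F, Q.leadingCoeff.eval c ≠ 0
  encard : ∀ c ∉ F, (fiber C (affPt j c)).encard = d
  lin_ne_zero : ∀ c ∉ F, ∀ p ∈ fiber C (affPt j c), lin ℓ₀ p.1 ≠ 0
  injOn : ∀ c ∉ F, Set.InjOn (fun p => lin ℓ₁ p.1 / lin ℓ₀ p.1) (fiber C (affPt j c))

/-- The forms are chosen to separate the points over `q`. The resulting relation of degree `d`
forces the quotient to separate almost every fiber, and the finite exceptional set can be chosen to
avoid the coordinate of `q`. -/
theorem IsCover.exists_sepChart (hC : IsCover C d) {q : PSpace 1} (hq : q ∉ branchLocus C) :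
    ∃ K : SepChart C d, ∃ c ∉ K.F, affPt K.j c = q := by
  rw [notMem_branchLocus hC.degree] at hq
  obtain ⟨j, hj⟩ := exists_rep_ne_zero q
  have hqfin : (fiber C q).Finite := Set.finite_of_encard_eq_coe hq
  obtain ⟨ℓ₀, ℓ₁, h0, hinj⟩ := exists_separating_forms (hqfin.image Prod.fst)
  have h0' : ∀ p ∈ fiber C q, lin ℓ₀ p.1 ≠ 0 := fun p hp => h0 _ ⟨p, hp, rfl⟩
  have hinj' : Set.InjOn (fun p : PSpace n × PSpace 1 => lin ℓ₁ p.1 / lin ℓ₀ p.1)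
      (fiber C q) := fun p hp p' hp' h =>
    Prod.ext (hinj ⟨p, hp, rfl⟩ ⟨p', hp', rfl⟩ h) (hp.2.trans hp'.2.symm)
  set c₀ := affCrd j q with hc₀
  have hc₀q : affPt j c₀ = q := affPt_affCrd hj
  have hne : (chart C ℓ₀ j).Nonempty := by
    obtain ⟨y, hy⟩ : (fiber C q).Nonempty := by
      rw [← Set.encard_pos, hq]
      exact_mod_cast hC.pos
    exact ⟨y, hy.1, h0' y hy, by rw [show y.2 = q from hy.2]; exact hj⟩
  have hS := isIrreducibleAlgebraic_chart hC.closed hC.irreducible hne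
  obtain ⟨F₁, hF₁, hF₁c⟩ := hC.exists_finite_encard_le ℓ₀ j
  obtain ⟨Q, hQ, hdeg, hlc, F, hF, hFc⟩ := hS.exists_separating_relation (hC.infinite_image hne)
    (hC.exists_finite_encard_le ℓ₀ j) (linPoly ℓ₁) c₀ (by
      rw [setOf_eval_normCrd, hc₀q, Set.image_image]
      simp only [eval_normCrd_linPoly]
      rw [Set.InjOn.encard_image]
      · rw [← hq]
        exact Set.encard_le_encard fun p hp => ⟨hp, h0' p hp⟩
      · exact hinj'.mono fun p hp => hp.1)
  have hB := (finite_setOf_encard_fiber_ne hC.degree).preimage (affPt_injective j).injOn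
  -- The value `c₀` is removed from the exceptional set: over it the separation holds by the choice
  -- of the forms, and the leading coefficient is known to be nonzero.
  have key : ∀ c ∉ (F ∪ affPt j ⁻¹' {p | (fiber C p).encard ≠ d}) \ {c₀},
      Q.leadingCoeff.eval c ≠ 0 ∧ (fiber C (affPt j c)).encard = d ∧
      (∀ p ∈ fiber C (affPt j c), lin ℓ₀ p.1 ≠ 0) ∧
      Set.InjOn (fun p => lin ℓ₁ p.1 / lin ℓ₀ p.1) (fiber C (affPt j c)) := by
    intro c hc
    by_cases hcc : c = c₀
    · subst hcc
      rw [hc₀q]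
      exact ⟨hlc, hq, h0', hinj'⟩
    · simp only [Set.mem_sdiff, Set.mem_singleton_iff, hcc, not_false_eq_true, and_true,
        Set.mem_union, Set.mem_preimage, Set.mem_ofPred_eq, not_or, not_not] at hc
      obtain ⟨h1, h2, h3⟩ := hFc c hc.1
      rw [setOf_eval_normCrd, Set.InjOn.encard_image] at h2
      swap
      · refine (normCrd_injOn ℓ₀ j).mono ?_
        rintro p ⟨hp1, hp2⟩
        exact ⟨hp2, by rw [show p.2 = affPt j c from hp1.2]; exact affPt_rep_ne_zero j c⟩
      have hsub : {p ∈ fiber C (affPt j c) | lin ℓ₀ p.1 ≠ 0} = fiber C (affPt j c) := by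
        refine Set.Finite.eq_of_subset_of_encard_le
          (Set.finite_of_encard_eq_coe h2) (fun p (hp : p ∈ fiber C _ ∧ _) => hp.1) ?_
        rw [h2, hc.2]
      refine ⟨h1, hc.2, fun p hp => ?_, ?_⟩
      · rw [← hsub] at hp
        exact hp.2
      · rw [setOf_eval_normCrd, hsub] at h3
        intro p hp p' hp' h
        have hp1 : ∀ p ∈ fiber C (affPt j c), lin ℓ₀ p.1 ≠ 0 ∧ p.2.rep j ≠ 0 := fun p hp => by
          rw [← hsub] at hp
          exact ⟨hp.2, by rw [show p.2 = affPt j c from hp.1.2]; exact affPt_rep_ne_zero j c⟩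
        refine normCrd_injOn ℓ₀ j (hp1 p hp) (hp1 p' hp') (h3 ⟨p, hp, rfl⟩ ⟨p', hp', rfl⟩ ?_)
        simpa only [eval_normCrd_linPoly] using h
  refine ⟨⟨j, ℓ₀, ℓ₁, Q, _, (hF.union hB).subset Set.sdiff_subset, hdeg, ?_, fun c hc => (key c hc).1,
    fun c hc => (key c hc).2.1, fun c hc => (key c hc).2.2.1, fun c hc => (key c hc).2.2.2⟩,
    c₀, by simp, hc₀q⟩
  intro p hp
  have := hQ _ ⟨p, hp, rfl⟩
  rwa [eval_normCrd_X_inr, eval_normCrd_linPoly] at this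

end Curves

end Decomposable
end

noncomputable section

namespace Decomposable

/-! ### The covering of the complement of the branch locus -/

section Covering

open Filter Polynomial

variable {n : ℕ} {C : Set (PSpace n × PSpace 1)} {d : ℕ}

/-- Points of the fibers near a given fiber are near that fiber. -/
theorem IsCover.eventually_fiber (hC : IsCover C d) {q : PSpace 1}
    {P : PSpace n × PSpace 1 → Prop} (hP : ∀ p ∈ fiber C q, ∀ᶠ y in 𝓝 p, P y) :
    ∀ᶠ t in 𝓝 q, ∀ y ∈ fiber C t, P y := by
  -- Projection along the compact space `ℙⁿ` is closed, so the fibers that leave the interior of the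
  -- good set lie over a closed set.
  have hcl : IsClosed (Prod.snd '' (C \ interior {y | P y})) :=
    isClosedMap_snd_of_compactSpace _ ((isClosed_of_zariski hC.closed).sdiff isOpen_interior)
  have hq : q ∉ Prod.snd '' (C \ interior {y | P y}) := by
    rintro ⟨p, ⟨hpC, hp⟩, hpq⟩
    exact hp (mem_interior_iff_mem_nhds.mpr (hP p ⟨hpC, hpq⟩))
  filter_upwards [hcl.isOpen_compl.mem_nhds hq] with t ht y hy
  by_contra hne
  exact ht ⟨y, ⟨hy.1, fun h => hne (interior_subset h)⟩, hy.2⟩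

theorem IsCover.finite_fiber (hC : IsCover C d) {q : PSpace 1} (hq : q ∉ branchLocus C) :
    (fiber C q).Finite :=
  Set.finite_of_encard_eq_coe ((notMem_branchLocus hC.degree).mp hq)

open Classical in
/-- The fiber as a finset. -/
def fib (C : Set (PSpace n × PSpace 1)) (q : PSpace 1) : Finset (PSpace n × PSpace 1) :=
  if h : (fiber C q).Finite then h.toFinset else ∅

theorem coe_fib {q : PSpace 1} (h : (fiber C q).Finite) : (fib C q : Set _) = fiber C q := by
  rw [fib, dif_pos h, Set.Finite.coe_toFinset]

theorem mem_fib {q : PSpace 1} (h : (fiber C q).Finite) {y : PSpace n × PSpace 1} :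
    y ∈ fib C q ↔ y ∈ fiber C q := by
  rw [← coe_fib h, Finset.mem_coe]

theorem card_fib {q : PSpace 1} (h : (fiber C q).encard = d) : (fib C q).card = d := by
  rw [← coe_fib (Set.finite_of_encard_eq_coe h), Set.encard_coe_eq_coe_finsetCard] at h
  exact_mod_cast h

/-- The separating function of a chart. -/
def SepChart.fn (K : SepChart C d) (p : PSpace n × PSpace 1) : ℂ := lin K.ℓ₁ p.1 / lin K.ℓ₀ p.1

theorem SepChart.notMem_branchLocus (K : SepChart C d) (hC : IsCover C d) {c : ℂ} (hc : c ∉ K.F) :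
    affPt K.j c ∉ branchLocus C :=
  (Decomposable.notMem_branchLocus hC.degree).mpr (K.encard c hc)

theorem SepChart.finite_fiber (K : SepChart C d) {c : ℂ} (hc : c ∉ K.F) :
    (fiber C (affPt K.j c)).Finite :=
  Set.finite_of_encard_eq_coe (K.encard c hc)

theorem SepChart.evalEval_eq_zero (K : SepChart C d) {c : ℂ} (hc : c ∉ K.F)
    {y : PSpace n × PSpace 1} (hy : y ∈ fiber C (affPt K.j c)) : K.Q.evalEval c (K.fn y) = 0 := by
  have h2 : y.2 = affPt K.j c := hy.2
  have := K.relation y ⟨hy.1, K.lin_ne_zero c hc y hy, by rw [h2]; exact affPt_rep_ne_zero _ _⟩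
  rwa [h2, affCrd_affPt] at this

/-- The specialised relation has degree `d`, and the `d` distinct values of the separating function
are roots of it; so these are all the roots, and they are simple. -/
theorem SepChart.map_eq_prod (K : SepChart C d) {c : ℂ} (hc : c ∉ K.F) :
    K.Q.map (evalRingHom c) = Polynomial.C (K.Q.leadingCoeff.eval c) *
      ∏ y ∈ fib C (affPt K.j c), (X - Polynomial.C (K.fn y)) := by
  classical
  have hfin := K.finite_fiber hc
  have hlc := K.leadingCoeff c hc
  have hdeg : (K.Q.map (evalRingHom c)).natDegree = d := by
    exact (natDegree_map_of_leadingCoeff_ne_zero _ hlc).trans K.natDegree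
  have hne : K.Q.map (evalRingHom c) ≠ 0 := fun h0 => hlc (by
    have := congrArg (fun q => q.coeff K.Q.natDegree) h0
    simpa using this)
  have hinj : Set.InjOn K.fn (fib C (affPt K.j c)) := by
    rw [coe_fib hfin]; exact K.injOn c hc
  have hle : ((fib C (affPt K.j c)).image K.fn).val ≤ (K.Q.map (evalRingHom c)).roots := by
    rw [Finset.val_le_iff_val_subset]
    intro z hz
    obtain ⟨y, hy, rfl⟩ := Finset.mem_image.mp hz
    rw [mem_fib hfin] at hy
    rw [mem_roots hne, IsRoot.def, map_evalRingHom_eval]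
    exact K.evalEval_eq_zero hc hy
  have hroots : ((fib C (affPt K.j c)).image K.fn).val = (K.Q.map (evalRingHom c)).roots := by
    refine Multiset.eq_of_le_of_card_le hle ?_
    refine (card_roots' _).trans ?_
    rw [hdeg, Finset.card_val, Finset.card_image_of_injOn hinj, card_fib (K.encard c hc)]
  have h := (IsAlgClosed.splits (K.Q.map (evalRingHom c))).eq_prod_roots
  rw [← hroots] at h
  rw [h]
  congr 1
  · rw [leadingCoeff_map_of_leadingCoeff_ne_zero _ hlc]
    rfl
  · rw [Finset.image_val_of_injOn hinj, Multiset.map_map]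
    rfl

theorem SepChart.evalEval_eq_prod (K : SepChart C d) {c : ℂ} (hc : c ∉ K.F) (z : ℂ) :
    K.Q.evalEval c z = K.Q.leadingCoeff.eval c *
      ∏ y ∈ fib C (affPt K.j c), (z - K.fn y) := by
  rw [← map_evalRingHom_eval, K.map_eq_prod hc]
  simp [eval_prod]

theorem SepChart.continuousAt_fn (K : SepChart C d) {p : PSpace n × PSpace 1}
    (hp : lin K.ℓ₀ p.1 ≠ 0) : ContinuousAt K.fn p :=
  (continuousAt_lin_div K.ℓ₁ K.ℓ₀ hp).comp continuousAt_fst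

theorem SepChart.eventually_notMem (K : SepChart C d) {c : ℂ} (hc : c ∉ K.F) :
    ∀ᶠ t in 𝓝 c, t ∉ K.F :=
  K.finite.isClosed.isOpen_compl.mem_nhds hc

theorem continuous_evalEval_left (Q : ℂ[X][X]) (z : ℂ) : Continuous fun c => Q.evalEval c z := by
  simp only [evalEval]
  exact (Q.eval (Polynomial.C z)).continuous

/-- The projection to `ℙ¹` is open at the points outside the branch locus. -/
theorem IsCover.eventually_exists_mem (hC : IsCover C d) {q : PSpace 1} (hq : q ∉ branchLocus C)
    {p : PSpace n × PSpace 1} (hp : p ∈ fiber C q) {O : Set (PSpace n × PSpace 1)} (hO : O ∈ 𝓝 p) :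
    ∀ᶠ t in 𝓝 q, ∃ y ∈ fiber C t, y ∈ O := by
  obtain ⟨K, c₀, hc₀, rfl⟩ := hC.exists_sepChart hq
  have hfin := K.finite_fiber hc₀
  -- `δ` separates the value at `p` from the values at the other points of the fiber; half of the
  -- radius makes the inequality strict.
  obtain ⟨δ, hδ, hδp⟩ : ∃ δ > 0, ∀ y ∈ fiber C (affPt K.j c₀), y ≠ p →
      δ < ‖K.fn p - K.fn y‖ := by
    have h1 : (K.fn '' (fiber C (affPt K.j c₀) \ {p})).Finite := (hfin.sdiff).image _
    have h2 : K.fn p ∉ K.fn '' (fiber C (affPt K.j c₀) \ {p}) := by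
      rintro ⟨y, ⟨hy, hyp⟩, h⟩
      exact hyp (K.injOn c₀ hc₀ hy hp h)
    obtain ⟨ε, hε, hball⟩ := Metric.isOpen_iff.mp h1.isClosed.isOpen_compl _ h2
    refine ⟨ε / 2, by positivity, fun y hy hyp => ?_⟩
    by_contra! hle
    refine @hball (K.fn y) ?_ ⟨y, ⟨hy, hyp⟩, rfl⟩
    rw [Metric.mem_ball, dist_comm, dist_eq_norm]
    linarith
  have hnear : ∀ᶠ t in 𝓝 (affPt K.j c₀), ∀ y ∈ fiber C t, y ∈ O ∨ δ < ‖K.fn p - K.fn y‖ := by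
    refine hC.eventually_fiber fun y hy => ?_
    by_cases hyp : y = p
    · subst hyp
      filter_upwards [hO] with x hx using Or.inl hx
    · have hcont : ContinuousAt (fun x => ‖K.fn p - K.fn x‖) y :=
        (continuousAt_const.sub (K.continuousAt_fn (K.lin_ne_zero c₀ hc₀ y hy))).norm
      filter_upwards [hcont.eventually (lt_mem_nhds (hδp y hy hyp))] with x hx using Or.inr hx
  rw [eventually_nhds_affPt] at hnear ⊢
  -- `Q(c, fn p)` tends to `0` as `c` tends to `c₀`. If no point over `c` were in `O`, all `d`
  -- factors in the product formula would exceed `δ`, so its norm would be at least that of the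
  -- leading coefficient times `δ ^ d`.
  have hsmall : ∀ᶠ c in 𝓝 c₀, ‖K.Q.evalEval c (K.fn p)‖ < ‖K.Q.leadingCoeff.eval c‖ * δ ^ d := by
    have h1 : ContinuousAt (fun c => ‖K.Q.leadingCoeff.eval c‖ * δ ^ d -
        ‖K.Q.evalEval c (K.fn p)‖) c₀ :=
      ((K.Q.leadingCoeff.continuous.norm.mul continuous_const).sub
        (continuous_evalEval_left K.Q (K.fn p)).norm).continuousAt
    have h2 : 0 < ‖K.Q.leadingCoeff.eval c₀‖ * δ ^ d - ‖K.Q.evalEval c₀ (K.fn p)‖ := by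
      rw [K.evalEval_eq_zero hc₀ hp, norm_zero, sub_zero]
      exact mul_pos (norm_pos_iff.mpr (K.leadingCoeff c₀ hc₀)) (pow_pos hδ d)
    filter_upwards [h1.eventually (lt_mem_nhds h2)] with c hc
    linarith
  filter_upwards [hnear, hsmall, K.eventually_notMem hc₀] with c h1 h2 h3
  by_contra! hcon
  refine absurd h2 (not_lt.mpr ?_)
  rw [K.evalEval_eq_prod h3, norm_mul, norm_prod]
  refine mul_le_mul_of_nonneg_left ?_ (norm_nonneg _)
  have hpow : δ ^ d = ∏ _y ∈ fib C (affPt K.j c), δ := by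
    rw [Finset.prod_const, card_fib (K.encard c h3)]
  rw [hpow]
  refine Finset.prod_le_prod (fun _ _ => hδ.le) fun y hy => ?_
  rw [mem_fib (K.finite_fiber h3)] at hy
  exact ((h1 y hy).resolve_left (hcon y hy)).le

theorem IsCover.eventually_notMem_branchLocus (hC : IsCover C d) {q : PSpace 1}
    (hq : q ∉ branchLocus C) : ∀ᶠ t in 𝓝 q, t ∉ branchLocus C :=
  (finite_branchLocus hC.degree).isClosed.isOpen_compl.mem_nhds hq

theorem IsCover.encard_fiber (hC : IsCover C d) {q : PSpace 1} (hq : q ∉ branchLocus C) :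
    (fiber C q).encard = d := (notMem_branchLocus hC.degree).mp hq

/-- Disjoint neighbourhoods of the points of a fiber, each of which meets every nearby fiber in
exactly one point. -/
theorem IsCover.exists_separation (hC : IsCover C d) {q : PSpace 1} (hq : q ∉ branchLocus C) :
    ∃ O : fiber C q → Set (PSpace n × PSpace 1), (∀ p, IsOpen (O p) ∧ (p : _ × _) ∈ O p) ∧
      (Pairwise fun p p' => Disjoint (O p) (O p')) ∧
      ∀ᶠ t in 𝓝 q, t ∉ branchLocus C ∧ (∀ p, ∃ y ∈ fiber C t, y ∈ O p) ∧
        ∀ p, ∀ y ∈ fiber C t, ∀ y' ∈ fiber C t, y ∈ O p → y' ∈ O p → y = y' := by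
  have hfin := hC.finite_fiber hq
  have := hfin.to_subtype
  obtain ⟨V, hV, hdisj⟩ := hfin.t2_separation
  refine ⟨fun p => V p, fun p => ⟨(hV p).2, (hV p).1⟩, fun p p' hne =>
    hdisj p.2 p'.2 fun h => hne (Subtype.ext h), ?_⟩
  have hex : ∀ᶠ t in 𝓝 q, ∀ p : fiber C q, ∃ y ∈ fiber C t, y ∈ V p := by
    rw [eventually_all]
    exact fun p => hC.eventually_exists_mem hq p.2 ((hV p).2.mem_nhds (hV p).1)
  filter_upwards [hC.eventually_notMem_branchLocus hq, hex] with t ht hext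
  refine ⟨ht, hext, ?_⟩
  choose f hf hfV using hext
  have hinj : Function.Injective f := fun p p' h => by
    by_contra hne
    exact Set.disjoint_left.mp (hdisj p.2 p'.2 fun h => hne (Subtype.ext h)) (hfV p)
      (h ▸ hfV p')
  -- Both fibers have `d` points, so the points found in the disjoint neighbourhoods exhaust the
  -- fiber over `t`.
  have hrange : Set.range f = fiber C t := by
    refine (Set.finite_range f).eq_of_subset_of_encard_le (Set.range_subset_iff.mpr hf) ?_
    rw [hC.encard_fiber ht, ← Set.image_univ, hinj.injOn.encard_image, Set.encard_univ,
      ENat.card_coe_set_eq, hC.encard_fiber hq]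
  have huniq : ∀ p : fiber C q, ∀ y ∈ fiber C t, y ∈ V p → y = f p := by
    intro p y hy hyp
    rw [← hrange] at hy
    obtain ⟨p', rfl⟩ := hy
    by_contra hne
    exact Set.disjoint_left.mp (hdisj p'.2 p.2 fun h => hne (by rw [Subtype.ext h])) (hfV p') hyp
  exact fun p y hy y' hy' h h' => (huniq p y hy h).trans (huniq p y' hy' h').symm

/-- `s p` is a local section of the covering near `q` through the point `p` of the fiber. -/
structure IsSections (C : Set (PSpace n × PSpace 1)) (q : PSpace 1)
    (s : fiber C q → PSpace 1 → PSpace n × PSpace 1) : Prop where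
  apply_self : ∀ p, s p q = p
  eventually : ∀ᶠ t in 𝓝 q, t ∉ branchLocus C ∧ (∀ p, s p t ∈ fiber C t) ∧
    (Function.Injective fun p => s p t) ∧ (∀ y ∈ fiber C t, ∃ p, s p t = y) ∧
    ∀ p, ContinuousAt (s p) t

/-- The section through `p` picks the unique point of each nearby fiber in the neighbourhood `O p`.
It is continuous because the projection is open at all of these points. -/
theorem IsCover.exists_sections (hC : IsCover C d) {q : PSpace 1} (hq : q ∉ branchLocus C) :
    ∃ s, IsSections C q s := by
  classical
  obtain ⟨O, hO, hdisj, hev⟩ := hC.exists_separation hq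
  have := (hC.finite_fiber hq).to_subtype
  let s : fiber C q → PSpace 1 → PSpace n × PSpace 1 := fun p t =>
    if h : ∃ y ∈ fiber C t, y ∈ O p then h.choose else p
  have hs : ∀ p t, (∃ y ∈ fiber C t, y ∈ O p) → s p t ∈ fiber C t ∧ s p t ∈ O p := by
    intro p t h
    simp only [s, dif_pos h]
    exact h.choose_spec
  obtain ⟨N, hN, hNo, hqN⟩ := eventually_nhds_iff.mp hev
  refine ⟨s, fun p => ?_, ?_⟩
  · have h1 := hs p q ⟨p, p.2, (hO p).2⟩
    exact (hN q hqN).2.2 p _ h1.1 _ p.2 h1.2 (hO p).2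
  · filter_upwards [hNo.mem_nhds hqN] with t ht
    obtain ⟨htB, hex, huniq⟩ := hN t ht
    have hinj : Function.Injective fun p => s p t := fun p p' h => by
      by_contra hne
      refine Set.disjoint_left.mp (hdisj hne) (hs p t (hex p)).2 ?_
      have h' : s p t = s p' t := h
      rw [h']
      exact (hs p' t (hex p')).2
    refine ⟨htB, fun p => (hs p t (hex p)).1, hinj, ?_, fun p => ?_⟩
    · have hrange : Set.range (fun p => s p t) = fiber C t := by
        refine (Set.finite_range _).eq_of_subset_of_encard_le
          (Set.range_subset_iff.mpr fun p => (hs p t (hex p)).1) ?_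
        rw [hC.encard_fiber htB, ← Set.image_univ, hinj.injOn.encard_image, Set.encard_univ,
          ENat.card_coe_set_eq, hC.encard_fiber hq]
      intro y hy
      rw [← hrange] at hy
      exact hy
    · intro V hV
      have h1 := hs p t (hex p)
      have h2 := hC.eventually_exists_mem htB h1.1 (inter_mem hV ((hO p).1.mem_nhds h1.2))
      rw [Filter.mem_map]
      filter_upwards [h2, hNo.mem_nhds ht] with t' ht' ht'N
      obtain ⟨y, hy, hyV, hyO⟩ := ht'
      have h3 := hs p t' ⟨y, hy, hyO⟩
      have : y = s p t' := (hN t' ht'N).2.2 p _ hy _ h3.1 hyO h3.2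
      rw [Set.mem_preimage, ← this]
      exact hyV

/-- The projection of a curve to `ℙ¹`. -/
def proj (C : Set (PSpace n × PSpace 1)) (x : C) : PSpace 1 := x.1.2

theorem continuous_proj : Continuous (proj C) := continuous_snd.comp continuous_subtype_val

/-- Local injectivity is the separation of nearby fibers, and openness is
`IsCover.eventually_exists_mem`. -/
theorem IsCover.isLocalHomeomorphOn (hC : IsCover C d) :
    IsLocalHomeomorphOn (proj C) (proj C ⁻¹' (branchLocus C)ᶜ) := by
  rintro x hx
  have hq : proj C x ∉ branchLocus C := hx
  obtain ⟨O, hO, hdisj, hev⟩ := hC.exists_separation hq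
  obtain ⟨N, hN, hNo, hqN⟩ := eventually_nhds_iff.mp hev
  let p : fiber C (proj C x) := ⟨x, x.2, rfl⟩
  let S : Set C := Subtype.val ⁻¹' O p ∩ proj C ⁻¹' N
  have hSo : IsOpen S :=
    ((hO p).1.preimage continuous_subtype_val).inter (hNo.preimage continuous_proj)
  have hinj : Set.InjOn (proj C) S := by
    rintro y ⟨hyO, hyN⟩ y' ⟨hyO', hyN'⟩ h
    exact Subtype.ext ((hN _ hyN).2.2 p y ⟨y.2, rfl⟩ y' ⟨y'.2, h.symm⟩ hyO hyO')
  have hopen : IsOpenMap (S.domRestrict (proj C)) := by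
    rw [isOpenMap_iff_nhds_le]
    intro y U hU
    rw [Filter.mem_map] at hU
    have hyN : proj C y ∉ branchLocus C := (hN _ y.2.2).1
    obtain ⟨U', hU', hU'o, hyU'⟩ := mem_nhds_iff.mp hU
    obtain ⟨V, hVo, rfl⟩ := isOpen_induced_iff.mp hU'o
    have hVS : V ∩ S ∈ 𝓝 (y : C) := (hVo.inter hSo).mem_nhds ⟨hyU', y.2⟩
    obtain ⟨V', hV', hV'S⟩ := mem_nhds_induced _ _ _ |>.mp hVS
    filter_upwards [hC.eventually_exists_mem hyN (p := (y : C)) ⟨y.1.2, rfl⟩ hV'] with t ht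
    obtain ⟨w, hw, hwV⟩ := ht
    have hwS : (⟨w, hw.1⟩ : C) ∈ V ∩ S := hV'S hwV
    have := hU' (show (⟨⟨w, hw.1⟩, hwS.2⟩ : S) ∈ Subtype.val ⁻¹' V from hwS.1)
    have h2 : S.domRestrict (proj C) ⟨⟨w, hw.1⟩, hwS.2⟩ ∈ U := this
    rwa [show S.domRestrict (proj C) ⟨⟨w, hw.1⟩, hwS.2⟩ = t from hw.2] at h2
  have : Nonempty C := ⟨x⟩
  refine ⟨OpenPartialHomeomorph.ofContinuousOpenRestrict (hinj.bijOn_image.toPartialEquiv)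
    continuous_proj.continuousOn hopen hSo, ⟨(hO p).2, hqN⟩, rfl⟩

/-- Compactness of the curve upgrades the local homeomorphism to a covering. -/
theorem IsCover.isCoveringMap (hC : IsCover C d) :
    IsCoveringMap ((branchLocus C)ᶜ.restrictPreimage (proj C)) := by
  have : CompactSpace C :=
    isCompact_iff_compactSpace.mp (isClosed_of_zariski hC.closed).isCompact
  exact (IsCoveringMapOn.of_isLocalHomeomorphOn continuous_proj
    hC.isLocalHomeomorphOn).isCoveringMap_restrictPreimage

/-- `Γ` is a lift of `γ` to `C`. -/
def IsLift (C : Set (PSpace n × PSpace 1)) {q q' : PSpace 1} (γ : Path q q')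
    {p p' : PSpace n × PSpace 1} (Γ : Path p p') : Prop :=
  ∀ s, Γ s ∈ C ∧ (Γ s).2 = γ s

theorem IsCover.exists_lift (hC : IsCover C d) {q q' : PSpace 1} (γ : Path q q')
    (hγ : ∀ s, γ s ∉ branchLocus C) {p : PSpace n × PSpace 1} (hp : p ∈ fiber C q) :
    ∃ p' ∈ fiber C q', ∃ Γ : Path p p', IsLift C γ Γ := by
  let γ' : C(unitInterval, ((branchLocus C)ᶜ : Set (PSpace 1))) :=
    ⟨fun s => ⟨γ s, hγ s⟩, γ.continuous.subtype_mk _⟩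
  have hpq : p.2 = q := hp.2
  have hqB : q ∉ branchLocus C := by have := hγ 0; rwa [γ.source] at this
  obtain ⟨Γ, hΓ, hΓ0⟩ := hC.isCoveringMap.exists_path_lifts γ'
    ⟨⟨p, hp.1⟩, show p.2 ∉ _ by rwa [hpq]⟩ (Subtype.ext (by
      show γ 0 = p.2
      rw [γ.source, hpq]))
  have hΓs : ∀ s, (Γ s).1.1.2 = γ s := fun s => congrArg Subtype.val (congrFun hΓ s)
  refine ⟨(Γ 1).1.1, ⟨(Γ 1).1.2, ?_⟩, ⟨⟨fun s => (Γ s).1.1, ?_⟩, ?_, rfl⟩, fun s =>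
    ⟨(Γ s).1.2, hΓs s⟩⟩
  · rw [Set.mem_preimage, Set.mem_singleton_iff, hΓs, γ.target]
  · exact continuous_subtype_val.comp (continuous_subtype_val.comp Γ.continuous)
  · show (Γ 0).1.1 = p
    rw [hΓ0]

/-- Lifts that agree somewhere agree everywhere. -/
theorem IsCover.lift_unique (hC : IsCover C d) {q q' : PSpace 1} {γ : Path q q'}
    (hγ : ∀ s, γ s ∉ branchLocus C) {p₁ p₁' p₂ p₂' : PSpace n × PSpace 1} {Γ₁ : Path p₁ p₁'}
    {Γ₂ : Path p₂ p₂'} (h₁ : IsLift C γ Γ₁) (h₂ : IsLift C γ Γ₂) {s₀ : unitInterval}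
    (h : Γ₁ s₀ = Γ₂ s₀) (s : unitInterval) : Γ₁ s = Γ₂ s := by
  let g : ∀ {p p' : PSpace n × PSpace 1} (Γ : Path p p') (_ : IsLift C γ Γ),
      unitInterval → proj C ⁻¹' (branchLocus C)ᶜ := fun Γ h s =>
    ⟨⟨Γ s, (h s).1⟩, show (Γ s).2 ∉ _ by rw [(h s).2]; exact hγ s⟩
  have hg : ∀ {p p' : PSpace n × PSpace 1} (Γ : Path p p') (h : IsLift C γ Γ),
      Continuous (g Γ h) := fun Γ h => (Γ.continuous.subtype_mk _).subtype_mk _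
  have := hC.isCoveringMap.eq_of_comp_eq (hg Γ₁ h₁) (hg Γ₂ h₂)
    (funext fun s => Subtype.ext ((h₁ s).2.trans (h₂ s).2.symm)) s₀
    (Subtype.ext (Subtype.ext h))
  exact congrArg (fun x => x.1.1) (congrFun this s)

end Covering

end Decomposable
end

noncomputable section

namespace Decomposable

/-! ### Monodromy and locally constant relations -/

section Monodromy

open Filter

variable {n : ℕ} {C : Set (PSpace n × PSpace 1)} {d : ℕ}

theorem IsLift.trans {q₀ q₁ q₂ : PSpace 1} {γ : Path q₀ q₁} {δ : Path q₁ q₂}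
    {p₀ p₁ p₂ : PSpace n × PSpace 1} {Γ : Path p₀ p₁} {Δ : Path p₁ p₂} (hΓ : IsLift C γ Γ)
    (hΔ : IsLift C δ Δ) : IsLift C (γ.trans δ) (Γ.trans Δ) := fun s => by
  rw [Path.trans_apply, Path.trans_apply]
  split_ifs
  · exact hΓ _
  · exact hΔ _

theorem IsLift.symm {q₀ q₁ : PSpace 1} {γ : Path q₀ q₁} {p₀ p₁ : PSpace n × PSpace 1}
    {Γ : Path p₀ p₁} (hΓ : IsLift C γ Γ) : IsLift C γ.symm Γ.symm := fun _ => hΓ _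

theorem trans_notMem {B : Set (PSpace 1)} {q₀ q₁ q₂ : PSpace 1} {γ : Path q₀ q₁}
    {δ : Path q₁ q₂} (hγ : ∀ s, γ s ∉ B) (hδ : ∀ s, δ s ∉ B) (s : unitInterval) :
    γ.trans δ s ∉ B := by
  rw [Path.trans_apply]
  split_ifs
  · exact hγ _
  · exact hδ _

theorem IsLift.source_mem {q₀ q₁ : PSpace 1} {γ : Path q₀ q₁} {p₀ p₁ : PSpace n × PSpace 1}
    {Γ : Path p₀ p₁} (hΓ : IsLift C γ Γ) : p₀ ∈ fiber C q₀ := by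
  have := hΓ 0
  rw [Γ.source, γ.source] at this
  exact this

theorem IsLift.target_mem {q₀ q₁ : PSpace 1} {γ : Path q₀ q₁} {p₀ p₁ : PSpace n × PSpace 1}
    {Γ : Path p₀ p₁} (hΓ : IsLift C γ Γ) : p₁ ∈ fiber C q₁ := by
  have := hΓ 1
  rw [Γ.target, γ.target] at this
  exact this

theorem IsCover.lift_target_unique (hC : IsCover C d) {q q' : PSpace 1} {γ : Path q q'}
    (hγ : ∀ s, γ s ∉ branchLocus C) {p p₁ p₂ : PSpace n × PSpace 1} {Γ₁ : Path p p₁}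
    {Γ₂ : Path p p₂} (h₁ : IsLift C γ Γ₁) (h₂ : IsLift C γ Γ₂) : p₁ = p₂ := by
  have := hC.lift_unique hγ h₁ h₂ (s₀ := 0) (by rw [Γ₁.source, Γ₂.source]) 1
  rwa [Γ₁.target, Γ₂.target] at this

/-- Lifting the reversed path inverts the lifting of the path, by uniqueness of lifts. -/
theorem IsCover.exists_transport (hC : IsCover C d) {q q' : PSpace 1} (γ : Path q q')
    (hγ : ∀ s, γ s ∉ branchLocus C) :
    ∃ L : fiber C q ≃ fiber C q', ∀ p : fiber C q,
      ∃ Γ : Path (p : PSpace n × PSpace 1) (L p : PSpace n × PSpace 1), IsLift C γ Γ := by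
  choose f hf Γ hΓ using fun p : fiber C q => hC.exists_lift γ hγ p.2
  choose g hg Δ hΔ using fun p : fiber C q' => hC.exists_lift γ.symm (fun s => hγ _) p.2
  refine ⟨⟨fun p => ⟨f p, hf p⟩, fun p => ⟨g p, hg p⟩, fun p => Subtype.ext ?_,
    fun p => Subtype.ext ?_⟩, fun p => ⟨Γ p, hΓ p⟩⟩
  · exact hC.lift_target_unique (γ := γ.symm) (fun s => hγ (unitInterval.symm s)) (hΔ ⟨f p, hf p⟩)
      (hΓ p).symm
  · have := (hΔ p).symm
    rw [Path.symm_symm] at this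
    exact hC.lift_target_unique hγ (hΓ ⟨g p, hg p⟩) this

theorem IsCover.exists_mem_monodromyGroup (hC : IsCover C d) {q : PSpace 1}
    (hq : q ∉ branchLocus C) (γ : Path q q) (hγ : ∀ s, γ s ∉ branchLocus C) :
    ∃ σ ∈ monodromyGroup C q hq, ∀ (p p' : fiber C q)
      (Γ : Path (p : PSpace n × PSpace 1) (p' : PSpace n × PSpace 1)), IsLift C γ Γ → σ p = p' := by
  obtain ⟨L, hL⟩ := hC.exists_transport γ hγ
  refine ⟨L, ⟨γ, hγ, hL⟩, fun p p' Γ hΓ => ?_⟩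
  obtain ⟨Δ, hΔ⟩ := hL p
  exact Subtype.ext (hC.lift_target_unique hγ hΔ hΓ)

/-- The relation on the fibers of `C` obtained by transporting a relation on the fiber over `q`
along paths. -/
def ExtRel (C : Set (PSpace n × PSpace 1)) {q : PSpace 1} (r : fiber C q → fiber C q → Prop)
    (y y' : PSpace n × PSpace 1) : Prop :=
  ∃ (t : PSpace 1) (δ : Path q t), (∀ s, δ s ∉ branchLocus C) ∧
    ∃ (x x' : fiber C q) (Γ : Path (x : PSpace n × PSpace 1) y)
      (Γ' : Path (x' : PSpace n × PSpace 1) y'), IsLift C δ Γ ∧ IsLift C δ Γ' ∧ r x x'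

variable {q : PSpace 1} {r : fiber C q → fiber C q → Prop}

theorem ExtRel.transport {t₀ t₁ : PSpace 1} {η : Path t₀ t₁} (hη : ∀ s, η s ∉ branchLocus C)
    {p p' y y' : PSpace n × PSpace 1} {Λ : Path p y} {Λ' : Path p' y'} (hΛ : IsLift C η Λ)
    (hΛ' : IsLift C η Λ') (h : ExtRel C r p p') : ExtRel C r y y' := by
  obtain ⟨t, δ, hδ, x, x', Γ, Γ', hΓ, hΓ', hr⟩ := h
  have ht : t = t₀ := hΓ.target_mem.2.symm.trans hΛ.source_mem.2
  subst ht
  exact ⟨t₁, δ.trans η, trans_notMem hδ hη, x, x', Γ.trans Λ, Γ'.trans Λ', hΓ.trans hΛ,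
    hΓ'.trans hΛ', hr⟩

theorem extRel_transport_iff {t₀ t₁ : PSpace 1} {η : Path t₀ t₁}
    (hη : ∀ s, η s ∉ branchLocus C) {p p' y y' : PSpace n × PSpace 1} {Λ : Path p y}
    {Λ' : Path p' y'} (hΛ : IsLift C η Λ) (hΛ' : IsLift C η Λ') :
    ExtRel C r p p' ↔ ExtRel C r y y' :=
  ⟨fun h => h.transport hη hΛ hΛ', fun h => h.transport (η := η.symm)
    (fun s => hη (unitInterval.symm s)) hΛ.symm hΛ'.symm⟩

/-- A path that transports `r` back to the fiber over `q` is a loop, and it acts on the fiber by an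
element of the monodromy group, which preserves `r`. -/
theorem IsCover.extRel_iff (hC : IsCover C d) (hq : q ∉ branchLocus C)
    (hr : ∀ σ ∈ monodromyGroup C q hq, ∀ x x', r x x' → r (σ x) (σ x')) (x x' : fiber C q) :
    ExtRel C r x x' ↔ r x x' := by
  constructor
  · rintro ⟨t, δ, hδ, x₀, x₀', Γ, Γ', hΓ, hΓ', h⟩
    have ht : t = q := hΓ.target_mem.2.symm.trans x.2.2
    subst ht
    obtain ⟨σ, hσ, h'⟩ := hC.exists_mem_monodromyGroup hq δ hδ
    rw [← h' x₀ x Γ hΓ, ← h' x₀' x' Γ' hΓ']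
    exact hr σ hσ _ _ h
  · exact fun h => ⟨q, Path.refl q, fun _ => hq, x, x', Path.refl _, Path.refl _,
      fun _ => x.2, fun _ => x'.2, h⟩

theorem IsCover.exists_equiv_extRel (hC : IsCover C d) (hq : q ∉ branchLocus C)
    (hr : ∀ σ ∈ monodromyGroup C q hq, ∀ x x', r x x' → r (σ x) (σ x')) {t : PSpace 1}
    (γ : Path q t) (hγ : ∀ s, γ s ∉ branchLocus C) :
    ∃ L : fiber C q ≃ fiber C t, ∀ x x', ExtRel C r (L x) (L x') ↔ r x x' := by
  obtain ⟨L, hL⟩ := hC.exists_transport γ hγ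
  refine ⟨L, fun x x' => ?_⟩
  obtain ⟨Γ, hΓ⟩ := hL x
  obtain ⟨Γ', hΓ'⟩ := hL x'
  rw [← extRel_transport_iff hγ hΓ hΓ', hC.extRel_iff hq hr]

/-- Nearby points of the complement of the branch locus are joined by paths that local sections
lift. -/
theorem IsSections.eventually_exists_lift {t₀ : PSpace 1}
    {s : fiber C t₀ → PSpace 1 → PSpace n × PSpace 1} (hs : IsSections C t₀ s) :
    ∀ᶠ t in 𝓝 t₀, ∃ η : Path t₀ t, (∀ u, η u ∉ branchLocus C) ∧
      ∀ p : fiber C t₀, ∃ Λ : Path (p : PSpace n × PSpace 1) (s p t), IsLift C η Λ := by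
  obtain ⟨j, hj⟩ := exists_rep_ne_zero t₀
  obtain ⟨c₀, rfl⟩ : ∃ c₀, affPt j c₀ = t₀ := ⟨_, affPt_affCrd hj⟩
  have hev := hs.eventually
  rw [eventually_nhds_affPt] at hev ⊢
  obtain ⟨ε, hε, hball⟩ := Metric.eventually_nhds_iff_ball.mp hev
  refine Metric.eventually_nhds_iff_ball.mpr ⟨ε, hε, fun c hc => ?_⟩
  have hjoin : JoinedIn (Metric.ball c₀ ε) c₀ c :=
    (Metric.isPathConnected_ball hε).joinedIn _ (Metric.mem_ball_self hε) _ hc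
  let κ := hjoin.somePath
  have hκ : ∀ u, κ u ∈ Metric.ball c₀ ε := hjoin.somePath_mem
  refine ⟨κ.map (continuous_affPt j), fun u => (hball _ (hκ u)).1, fun p => ?_⟩
  refine ⟨⟨⟨fun u => s p (affPt j (κ u)), ?_⟩, ?_, ?_⟩, fun u => (hball _ (hκ u)).2.1 p⟩
  · rw [continuous_iff_continuousAt]
    intro u
    exact ((hball _ (hκ u)).2.2.2.2 p).comp (f := fun u => affPt j (κ u))
      ((continuous_affPt j).comp κ.continuous).continuousAt
  · simp [hs.apply_self]
  · simp

/-- Local sections lift short paths, along which the extended relation is transported in both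
directions. -/
theorem IsSections.eventually_extRel_iff {t₀ : PSpace 1}
    {s : fiber C t₀ → PSpace 1 → PSpace n × PSpace 1} (hs : IsSections C t₀ s)
    (r : fiber C q → fiber C q → Prop) :
    ∀ᶠ t in 𝓝 t₀, ∀ p p' : fiber C t₀, ExtRel C r (s p t) (s p' t) ↔ ExtRel C r p p' := by
  filter_upwards [hs.eventually_exists_lift] with t ht p p'
  obtain ⟨η, hη, hΛ⟩ := ht
  obtain ⟨Λ, hΛp⟩ := hΛ p
  obtain ⟨Λ', hΛp'⟩ := hΛ p'
  exact (extRel_transport_iff hη hΛp hΛp').symm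

/-- Paths in the complement of a finite set of values of the affine coordinate. -/
theorem exists_path_affPt (j : Fin 2) {F : Set ℂ} (hF : F.Finite) {c c' : ℂ} (hc : c ∉ F)
    (hc' : c' ∉ F) : ∃ γ : Path (affPt j c) (affPt j c'), ∀ s, ∃ u ∉ F, γ s = affPt j u := by
  have hpc : IsPathConnected Fᶜ := hF.countable.isPathConnected_compl_of_one_lt_rank (by
    rw [Complex.rank_real_complex]; norm_num)
  have hjoin := hpc.joinedIn c hc c' hc'
  exact ⟨hjoin.somePath.map (continuous_affPt j), fun s => ⟨_, hjoin.somePath_mem s, rfl⟩⟩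

theorem SepChart.exists_path (K : SepChart C d) (hC : IsCover C d) {c c' : ℂ} (hc : c ∉ K.F)
    (hc' : c' ∉ K.F) : ∃ γ : Path (affPt K.j c) (affPt K.j c'), ∀ s, γ s ∉ branchLocus C := by
  obtain ⟨γ, hγ⟩ := exists_path_affPt K.j K.finite hc hc'
  refine ⟨γ, fun s => ?_⟩
  obtain ⟨u, hu, h⟩ := hγ s
  rw [h]
  exact K.notMem_branchLocus hC hu

end Monodromy

end Decomposable
end

noncomputable section

namespace Decomposable

/-! ### Holomorphic functions of polynomial growth -/

section PolynomialGrowth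

open Polynomial Filter

/-- Cauchy's estimate on circles of radius tending to infinity kills the Taylor coefficients of
order above `k`. -/
theorem exists_polynomial_of_growth {f : ℂ → ℂ} (hf : Differentiable ℂ f) {A : ℝ} {k : ℕ}
    (hA : ∀ z, ‖f z‖ ≤ A * (1 + ‖z‖) ^ k) : ∃ p : ℂ[X], ∀ z, f z = p.eval z := by
  have hA0 : 0 ≤ A := by
    have := (norm_nonneg _).trans (hA 0)
    simpa using this
  have hzero : ∀ m, k < m → iteratedDeriv m f 0 = 0 := by
    intro m hm
    rw [← norm_le_zero_iff]
    have hlim : Tendsto (fun R : ℝ => m.factorial * (A * 2 ^ k) * (R ^ k / R ^ m)) atTop (𝓝 0) := by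
      have h := (tendsto_pow_div_pow_atTop_zero (𝕜 := ℝ) hm).const_mul (m.factorial * (A * 2 ^ k))
      simpa using h
    refine ge_of_tendsto hlim ?_
    filter_upwards [eventually_ge_atTop 1] with R hR
    have hR0 : 0 < R := by linarith
    have h := Complex.norm_iteratedDeriv_le_of_forall_mem_sphere_norm_le m hR0
      hf.diffContOnCl (c := 0) (C := A * (2 * R) ^ k) (fun z hz => by
        refine (hA z).trans (mul_le_mul_of_nonneg_left ?_ hA0)
        have : ‖z‖ = R := by simpa using hz
        rw [this]
        exact pow_le_pow_left₀ (by linarith) (by linarith) k)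
    refine h.trans (le_of_eq ?_)
    rw [mul_pow]
    ring
  refine ⟨∑ m ∈ Finset.range (k + 1),
    Polynomial.monomial m ((m.factorial : ℂ)⁻¹ * iteratedDeriv m f 0), fun z => ?_⟩
  have h := Complex.hasSum_taylorSeries_of_entire hf 0 z
  rw [← h.tsum_eq, tsum_eq_sum (s := Finset.range (k + 1))]
  · rw [eval_finsetSum]
    refine Finset.sum_congr rfl fun m _ => ?_
    simp
    ring
  · intro m hm
    rw [hzero m (by simpa [Nat.lt_succ_iff] using hm)]
    simp

/-- A function that is holomorphic and locally bounded outside a finite set extends. -/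
theorem exists_extension_of_finite {F : Set ℂ} (hF : F.Finite) {f : ℂ → ℂ}
    (hf : ∀ z ∉ F, DifferentiableAt ℂ f z)
    (hb : ∀ z, ∃ A : ℝ, ∀ᶠ w in 𝓝 z, w ∉ F → ‖f w‖ ≤ A) :
    ∃ g : ℂ → ℂ, Differentiable ℂ g ∧ ∀ z ∉ F, g z = f z := by
  induction F, hF using Set.Finite.induction_on generalizing f with
  | empty => exact ⟨f, fun z => hf z (Set.notMem_empty z), fun _ _ => rfl⟩
  | @insert a F ha hF ih =>
    have hFa : ∀ᶠ w in 𝓝 a, w ∉ F := hF.isClosed.isOpen_compl.mem_nhds ha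
    obtain ⟨A, hA⟩ := hb a
    obtain ⟨U, hU, hUo, haU⟩ := eventually_nhds_iff.mp (hFa.and hA)
    have hmem : U ∈ 𝓝 a := hUo.mem_nhds haU
    have hdiff : DifferentiableOn ℂ f (U \ {a}) := fun z hz =>
      (hf z (by
        rintro (h | h)
        · exact hz.2 h
        · exact (hU z hz.1).1 h)).differentiableWithinAt
    have hbdd : BddAbove (norm ∘ f '' (U \ {a})) := by
      refine ⟨A, ?_⟩
      rintro _ ⟨w, hw, rfl⟩
      refine (hU w hw.1).2 ?_
      rintro (h | h)
      · exact hw.2 h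
      · exact (hU w hw.1).1 h
    -- Riemann's removable singularity theorem at the single point `a`; the other points are left to
    -- the induction.
    have hupd := Complex.differentiableOn_update_limUnder_of_bddAbove hmem hdiff hbdd
    set f' := Function.update f a (limUnder (𝓝[≠] a) f) with hf'
    have heq : ∀ z, z ≠ a → f' z = f z := fun z hz => Function.update_of_ne hz _ _
    have hev : ∀ z, z ≠ a → f' =ᶠ[𝓝 z] f := fun z hz => by
      filter_upwards [isOpen_ne.mem_nhds hz] with w hw using heq w hw
    have hfa : DifferentiableAt ℂ f' a := (hupd a haU).differentiableAt hmem
    obtain ⟨g, hg, hgf⟩ := ih (f := f') (fun z hz => by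
        by_cases hza : z = a
        · rw [hza]; exact hfa
        · exact (hev z hza).differentiableAt_iff.mpr (hf z (by
            rintro (h | h)
            · exact hza h
            · exact hz h)))
      (fun z => by
        by_cases hza : z = a
        · subst hza
          obtain hcont := hfa.continuousAt.norm
          refine ⟨‖f' z‖ + 1, ?_⟩
          filter_upwards [hcont.eventually (gt_mem_nhds (lt_add_one _))] with w hw _ using hw.le
        · obtain ⟨A, hA⟩ := hb z
          refine ⟨A, ?_⟩
          filter_upwards [hA, isOpen_ne.mem_nhds hza] with w hw hwa hwF
          rw [heq w hwa]
          refine hw ?_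
          rintro (h | h)
          · exact hwa h
          · exact hwF h)
    refine ⟨g, hg, fun z hz => ?_⟩
    simp only [Set.mem_insert_iff, not_or] at hz
    rw [hgf z hz.2, heq z hz.1]

/-- A holomorphic function on the complement of a finite set that becomes a function of
polynomial growth after multiplication with a polynomial is rational, and its denominator does
not vanish outside the finite set. -/
theorem exists_rational_of_growth {F : Set ℂ} (hF : F.Finite) {f : ℂ → ℂ}
    (hf : ∀ z ∉ F, DifferentiableAt ℂ f z) {D : ℂ[X]} (hD : D ≠ 0) {A : ℝ} {k : ℕ}
    (hA : ∀ z ∉ F, ‖D.eval z * f z‖ ≤ A * (1 + ‖z‖) ^ k) :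
    ∃ p g : ℂ[X], (∀ z ∉ F, g.eval z ≠ 0) ∧ ∀ z ∉ F, f z = p.eval z / g.eval z := by
  obtain ⟨e, he, hef⟩ := exists_extension_of_finite hF (f := fun z => D.eval z * f z)
    (fun z hz => D.differentiable.differentiableAt.mul (hf z hz)) (fun z => by
      refine ⟨A * (1 + ‖z‖) ^ k + 1, ?_⟩
      have hcont : ContinuousAt (fun w : ℂ => A * (1 + ‖w‖) ^ k) z := by fun_prop
      filter_upwards [hcont.eventually (gt_mem_nhds (lt_add_one _))] with w hw hwF
      exact (hA w hwF).trans hw.le)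
  have hgrow : ∀ z, ‖e z‖ ≤ A * (1 + ‖z‖) ^ k := by
    have hdense : Dense Fᶜ := hF.countable.dense_compl ℝ
    have hcl : IsClosed {z | ‖e z‖ ≤ A * (1 + ‖z‖) ^ k} :=
      isClosed_le he.continuous.norm (by fun_prop)
    intro z
    have hsub : Fᶜ ⊆ {z | ‖e z‖ ≤ A * (1 + ‖z‖) ^ k} := fun z hz => by
      rw [Set.mem_ofPred_eq, hef z hz]
      exact hA z hz
    have := hcl.closure_subset_iff.mpr hsub
    rw [hdense.closure_eq] at this
    exact this trivial
  obtain ⟨P, hP⟩ := exists_polynomial_of_growth he hgrow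
  have hPf : ∀ z ∉ F, D.eval z * f z = P.eval z := fun z hz => by rw [← hP, hef z hz]
  -- reduce the fraction
  have key : ∀ N : ℕ, ∀ P D : ℂ[X], D ≠ 0 → D.natDegree = N →
      (∀ z ∉ F, D.eval z * f z = P.eval z) →
      ∃ p g : ℂ[X], (∀ z ∉ F, g.eval z ≠ 0) ∧ ∀ z ∉ F, f z = p.eval z / g.eval z := by
    intro N
    induction N with
    | zero =>
      intro P D hD hdeg h
      have hc : D = C (D.coeff 0) := eq_C_of_natDegree_eq_zero hdeg
      have hne : ∀ z, D.eval z ≠ 0 := fun z h0 => hD (by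
        rw [hc] at h0 ⊢
        rw [eval_C] at h0
        rw [h0, C_0])
      exact ⟨P, D, fun z _ => hne z, fun z hz => by
        rw [← h z hz]
        have := hne z
        field_simp⟩
    | succ N ih =>
      intro P D hD hdeg h
      by_cases hroot : ∃ z ∉ F, D.eval z = 0
      · obtain ⟨a, ha, hDa⟩ := hroot
        -- A root of the denominator outside `F` is a root of the numerator, so the factor can be
        -- cancelled. At the root itself the cancelled identity follows by continuity.
        have hPa : P.eval a = 0 := by rw [← h a ha, hDa, zero_mul]
        obtain ⟨D', rfl⟩ := dvd_iff_isRoot.mpr hDa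
        obtain ⟨P', rfl⟩ := dvd_iff_isRoot.mpr hPa
        refine ih P' D' (right_ne_zero_of_mul hD) ?_ ?_
        · rw [natDegree_mul (X_sub_C_ne_zero a) (right_ne_zero_of_mul hD), natDegree_X_sub_C] at hdeg
          omega
        · have hoff : ∀ z ∉ F, z ≠ a → D'.eval z * f z = P'.eval z := fun z hz hza => by
            have := h z hz
            simp only [eval_mul, eval_sub, eval_X, eval_C] at this
            refine mul_left_cancel₀ (sub_ne_zero.mpr hza) ?_
            linear_combination this
          intro z hz
          by_cases hza : z = a
          · subst hza
            have h1 : Tendsto (fun w => D'.eval w * f w) (𝓝[≠] z) (𝓝 (D'.eval z * f z)) :=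
              ((D'.continuous.continuousAt.mul (hf z hz).continuousAt)).tendsto.mono_left
                nhdsWithin_le_nhds
            have h2 : Tendsto (fun w => P'.eval w) (𝓝[≠] z) (𝓝 (P'.eval z)) :=
              P'.continuous.continuousAt.tendsto.mono_left nhdsWithin_le_nhds
            refine tendsto_nhds_unique (h1.congr' ?_) h2
            filter_upwards [self_mem_nhdsWithin,
              nhdsWithin_le_nhds (hF.isClosed.isOpen_compl.mem_nhds hz)] with w hw hwF
            exact hoff w hwF hw
          · exact hoff z hz hza
      · push Not at hroot
        exact ⟨P, D, hroot, fun z hz => by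
          rw [← h z hz]
          have := hroot z hz
          field_simp⟩
  exact key _ P D hD rfl hPf

theorem evalEval_eq_sum (R : ℂ[X][X]) (t z : ℂ) :
    R.evalEval t z = ∑ i ∈ Finset.range (R.natDegree + 1), (R.coeff i).eval t * z ^ i := by
  rw [evalEval, eval_eq_sum_range (p := R), eval_finsetSum]
  simp

/-- A continuous root of a polynomial with differentiable coefficients is differentiable where
the root is simple. -/
theorem differentiableAt_of_simple_root {Q : ℂ[X][X]} {φ : ℂ → ℂ} {c : ℂ}
    (hφ : ContinuousAt φ c) (hQ : ∀ᶠ t in 𝓝 c, Q.evalEval t (φ t) = 0)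
    (hQ' : (derivative Q).evalEval c (φ c) ≠ 0) : DifferentiableAt ℂ φ c := by
  have hQc : Q.evalEval c (φ c) = 0 := hQ.self_of_nhds
  obtain ⟨R, hR⟩ : ∃ R, R = Q /ₘ (X - C (C (φ c))) := ⟨_, rfl⟩
  obtain ⟨q, hq⟩ : ∃ q, q = Q.eval (C (φ c)) := ⟨_, rfl⟩
  -- This gives `Q(t, z) = (z - φ c) R(t, z) + (t - c) q₁(t)`, so the difference quotient of `φ` is
  -- `-q₁(t) / R(t, φ t)`. Simplicity of the root means that `R(c, φ c)` is nonzero.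
  have hdiv : (X - C (C (φ c))) * R + C q = Q := by
    rw [hR, hq, add_comm, ← modByMonic_X_sub_C_eq_C_eval, modByMonic_add_div]
  have hqc : q.eval c = 0 := by
    rw [hq]
    exact hQc
  obtain ⟨q₁, hq₁⟩ := dvd_iff_isRoot.mpr hqc
  have hRc : R.evalEval c (φ c) ≠ 0 := by
    rw [← hdiv] at hQ'
    simpa [evalEval] using hQ'
  have hev : ∀ t, Q.evalEval t (φ t) =
      (φ t - φ c) * R.evalEval t (φ t) + (t - c) * q₁.eval t := fun t => by
    rw [← hdiv, hq₁]
    simp [evalEval]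
  have hRt : ContinuousAt (fun t => R.evalEval t (φ t)) c := by
    simp only [evalEval_eq_sum]
    exact tendsto_finsetSum _ fun i _ =>
      (R.coeff i).continuous.continuousAt.mul (hφ.pow i)
  have hder : HasDerivAt φ (-(q₁.eval c) / R.evalEval c (φ c)) c := by
    rw [hasDerivAt_iff_tendsto_slope]
    have hlim : Tendsto (fun t => -(q₁.eval t) / R.evalEval t (φ t)) (𝓝[≠] c)
        (𝓝 (-(q₁.eval c) / R.evalEval c (φ c))) :=
      ((q₁.continuous.continuousAt.neg.div hRt hRc).tendsto).mono_left nhdsWithin_le_nhds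
    refine hlim.congr' ?_
    filter_upwards [self_mem_nhdsWithin, nhdsWithin_le_nhds hQ,
      nhdsWithin_le_nhds (hRt.eventually_ne hRc)] with t ht hQt hRt
    have htc : t - c ≠ 0 := sub_ne_zero.mpr ht
    rw [hev] at hQt
    rw [slope_def_field, div_eq_div_iff hRt htc]
    linear_combination -hQt
  exact hder.differentiableAt

end PolynomialGrowth

end Decomposable
end

noncomputable section

namespace Decomposable

/-! ### Functions on a covering that are holomorphic and of polynomial growth -/

section Tame

open Polynomial Filter

variable {n : ℕ} {C : Set (PSpace n × PSpace 1)} {d : ℕ}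

/-- Needed to add tame functions with different denominators: each bound is multiplied by the growth
of the other denominator. -/
theorem exists_growth (D : ℂ[X]) : ∃ (A : ℝ) (k : ℕ), 0 ≤ A ∧ ∀ z, ‖D.eval z‖ ≤ A * (1 + ‖z‖) ^ k := by
  refine ⟨∑ i ∈ Finset.range (D.natDegree + 1), ‖D.coeff i‖, D.natDegree,
    Finset.sum_nonneg fun i _ => norm_nonneg _, fun z => ?_⟩
  rw [eval_eq_sum_range, Finset.sum_mul]
  refine (norm_sum_le _ _).trans (Finset.sum_le_sum fun i hi => ?_)
  rw [norm_mul, norm_pow]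
  refine mul_le_mul_of_nonneg_left ?_ (norm_nonneg _)
  have hz := norm_nonneg z
  exact (pow_le_pow_left₀ hz (by linarith) i).trans
    (pow_le_pow_right₀ (by linarith) (Nat.lt_succ_iff.mp (Finset.mem_range.mp hi)))

/-- A function of two points of the same fiber that is holomorphic along local sections and
becomes a function of polynomial growth after multiplication with a polynomial. -/
structure SepChart.Tame₂ (K : SepChart C d)
    (E : PSpace n × PSpace 1 → PSpace n × PSpace 1 → ℂ) : Prop where
  diff : ∀ c ∉ K.F, ∀ s, IsSections C (affPt K.j c) s → ∀ p p',
    DifferentiableAt ℂ (fun t => E (s p (affPt K.j t)) (s p' (affPt K.j t))) c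
  growth : ∃ (D : ℂ[X]) (A : ℝ) (k : ℕ), D ≠ 0 ∧ 0 ≤ A ∧ ∀ c ∉ K.F,
    ∀ y ∈ fiber C (affPt K.j c), ∀ y' ∈ fiber C (affPt K.j c),
      ‖D.eval c * E y y'‖ ≤ A * (1 + ‖c‖) ^ k

/-- A function on the covering that is holomorphic along local sections and
becomes a function of polynomial growth after multiplication with a polynomial. -/
def SepChart.Tame (K : SepChart C d) (e : PSpace n × PSpace 1 → ℂ) : Prop :=
  K.Tame₂ fun y _ => e y

variable {K : SepChart C d} {E E' : PSpace n × PSpace 1 → PSpace n × PSpace 1 → ℂ}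
  {e e' : PSpace n × PSpace 1 → ℂ}

theorem IsSections.eventually_affPt {j : Fin 2} {c : ℂ}
    {s : fiber C (affPt j c) → PSpace 1 → PSpace n × PSpace 1}
    (hs : IsSections C (affPt j c) s) {P : PSpace 1 → Prop} (hP : ∀ᶠ t in 𝓝 (affPt j c), P t) :
    ∀ᶠ t in 𝓝 c, P (affPt j t) ∧ (∀ p, s p (affPt j t) ∈ fiber C (affPt j t)) ∧
      (Function.Injective fun p => s p (affPt j t)) ∧
      (∀ y ∈ fiber C (affPt j t), ∃ p, s p (affPt j t) = y) ∧
      ∀ p, ContinuousAt (fun u => s p (affPt j u)) t := by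
  have h := hs.eventually.and hP
  rw [eventually_nhds_affPt] at h
  filter_upwards [h] with t ht
  exact ⟨ht.2, ht.1.2.1, ht.1.2.2.1, ht.1.2.2.2.1, fun p =>
    (ht.1.2.2.2.2 p).comp (f := affPt j) (continuous_affPt j).continuousAt⟩

theorem SepChart.Tame₂.congr (hE : K.Tame₂ E)
    (h : ∀ c ∉ K.F, ∀ y ∈ fiber C (affPt K.j c), ∀ y' ∈ fiber C (affPt K.j c), E' y y' = E y y') :
    K.Tame₂ E' := by
  refine ⟨fun c hc s hs p p' => (hE.diff c hc s hs p p').congr_of_eventuallyEq ?_, ?_⟩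
  · filter_upwards [hs.eventually_affPt (P := fun _ => True) (by simp), K.eventually_notMem hc]
      with t ht htF
    exact h t htF _ (ht.2.1 p) _ (ht.2.1 p')
  · obtain ⟨D, A, k, hD, hA, hb⟩ := hE.growth
    exact ⟨D, A, k, hD, hA, fun c hc y hy y' hy' => by
      rw [h c hc y hy y' hy']; exact hb c hc y hy y' hy'⟩

theorem SepChart.Tame.congr (he : K.Tame e)
    (h : ∀ c ∉ K.F, ∀ y ∈ fiber C (affPt K.j c), e' y = e y) : K.Tame e' :=
  Tame₂.congr he fun c hc y hy _ _ => h c hc y hy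

theorem SepChart.Tame₂.const (K : SepChart C d) (a : ℂ) : K.Tame₂ fun _ _ => a :=
  ⟨fun _ _ _ _ _ _ => differentiableAt_const _, 1, ‖a‖, 0, one_ne_zero, norm_nonneg a,
    fun c _ y _ y' _ => by simp⟩

theorem SepChart.Tame₂.mul (hE : K.Tame₂ E) (hE' : K.Tame₂ E') :
    K.Tame₂ fun y y' => E y y' * E' y y' := by
  refine ⟨fun c hc s hs p p' => (hE.diff c hc s hs p p').mul (hE'.diff c hc s hs p p'), ?_⟩
  obtain ⟨D, A, k, hD, hA, hb⟩ := hE.growth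
  obtain ⟨D', A', k', hD', hA', hb'⟩ := hE'.growth
  refine ⟨D * D', A * A', k + k', mul_ne_zero hD hD', mul_nonneg hA hA',
    fun c hc y hy y' hy' => ?_⟩
  have h := mul_le_mul (hb c hc y hy y' hy') (hb' c hc y hy y' hy') (norm_nonneg _)
    (by positivity)
  rw [← norm_mul] at h
  calc _ = ‖D.eval c * E y y' * (D'.eval c * E' y y')‖ := by rw [eval_mul]; congr 1; ring
    _ ≤ _ := h
    _ = _ := by rw [pow_add]; ring

theorem SepChart.Tame₂.add (hE : K.Tame₂ E) (hE' : K.Tame₂ E') :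
    K.Tame₂ fun y y' => E y y' + E' y y' := by
  refine ⟨fun c hc s hs p p' => (hE.diff c hc s hs p p').add (hE'.diff c hc s hs p p'), ?_⟩
  obtain ⟨D, A, k, hD, hA, hb⟩ := hE.growth
  obtain ⟨D', A', k', hD', hA', hb'⟩ := hE'.growth
  obtain ⟨a, l, ha, hg⟩ := exists_growth D
  obtain ⟨a', l', ha', hg'⟩ := exists_growth D'
  refine ⟨D * D', A * a' + a * A', k + l' + (l + k'), mul_ne_zero hD hD', by positivity,
    fun c hc y hy y' hy' => ?_⟩
  have h1 := mul_le_mul (hb c hc y hy y' hy') (hg' c) (norm_nonneg _) (by positivity)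
  have h2 := mul_le_mul (hg c) (hb' c hc y hy y' hy') (norm_nonneg _) (by positivity)
  rw [← norm_mul] at h1 h2
  have hc1 : 1 ≤ 1 + ‖c‖ := by linarith [norm_nonneg c]
  have hp1 : (1 + ‖c‖) ^ (k + l') ≤ (1 + ‖c‖) ^ (k + l' + (l + k')) :=
    pow_le_pow_right₀ hc1 (by omega)
  have hp2 : (1 + ‖c‖) ^ (l + k') ≤ (1 + ‖c‖) ^ (k + l' + (l + k')) :=
    pow_le_pow_right₀ hc1 (by omega)
  calc _ = ‖D.eval c * E y y' * D'.eval c + D.eval c * (D'.eval c * E' y y')‖ := by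
        rw [eval_mul]; congr 1; ring
    _ ≤ _ := norm_add_le _ _
    _ ≤ A * a' * (1 + ‖c‖) ^ (k + l') + a * A' * (1 + ‖c‖) ^ (l + k') := by
        refine (add_le_add h1 h2).trans (le_of_eq ?_)
        rw [pow_add, pow_add]; ring
    _ ≤ _ := by
        rw [add_mul]
        exact add_le_add (mul_le_mul_of_nonneg_left hp1 (by positivity))
          (mul_le_mul_of_nonneg_left hp2 (by positivity))

theorem SepChart.Tame₂.sub (hE : K.Tame₂ E) (hE' : K.Tame₂ E') :
    K.Tame₂ fun y y' => E y y' - E' y y' := by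
  have := hE.add ((const K (-1)).mul hE')
  exact this.congr fun _ _ _ _ _ _ => by ring

theorem SepChart.Tame₂.sum {ι : Type*} (I : Finset ι)
    {E : ι → PSpace n × PSpace 1 → PSpace n × PSpace 1 → ℂ} (hE : ∀ i ∈ I, K.Tame₂ (E i)) :
    K.Tame₂ fun y y' => ∑ i ∈ I, E i y y' := by
  classical
  induction I using Finset.induction_on with
  | empty => simpa using const K 0
  | insert i I hi ih =>
    simp only [Finset.sum_insert hi]
    exact (hE i (Finset.mem_insert_self _ _)).add
      (ih fun i' hi' => hE i' (Finset.mem_insert_of_mem hi'))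

theorem SepChart.Tame₂.pow (hE : K.Tame₂ E) (m : ℕ) : K.Tame₂ fun y y' => E y y' ^ m := by
  induction m with
  | zero => simpa using const K 1
  | succ m ih => simpa only [pow_succ] using ih.mul hE

theorem SepChart.Tame.left (he : K.Tame e) : K.Tame₂ fun y _ => e y := he

theorem SepChart.Tame.right (he : K.Tame e) : K.Tame₂ fun _ y' => e y' := by
  obtain ⟨D, A, k, hD, hA, hb⟩ := he.growth
  exact ⟨fun c hc s hs p p' => he.diff c hc s hs p' p, D, A, k, hD, hA,
    fun c hc y hy y' hy' => hb c hc y' hy' y hy⟩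

theorem SepChart.Tame.const (K : SepChart C d) (a : ℂ) : K.Tame fun _ => a := Tame₂.const K a

theorem SepChart.Tame.mul (he : K.Tame e) (he' : K.Tame e') : K.Tame fun y => e y * e' y :=
  Tame₂.mul he he'

theorem SepChart.Tame.add (he : K.Tame e) (he' : K.Tame e') : K.Tame fun y => e y + e' y :=
  Tame₂.add he he'

theorem SepChart.Tame.sub (he : K.Tame e) (he' : K.Tame e') : K.Tame fun y => e y - e' y :=
  Tame₂.sub he he'

theorem SepChart.Tame.pow (he : K.Tame e) (m : ℕ) : K.Tame fun y => e y ^ m :=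
  Tame₂.pow he m

theorem SepChart.Tame.sum {ι : Type*} (I : Finset ι) {e : ι → PSpace n × PSpace 1 → ℂ}
    (he : ∀ i ∈ I, K.Tame (e i)) : K.Tame fun y => ∑ i ∈ I, e i y :=
  Tame₂.sum I he

theorem SepChart.Tame.affCrd (K : SepChart C d) : K.Tame fun y => affCrd K.j y.2 := by
  refine ⟨fun c hc s hs p p' => differentiableAt_id.congr_of_eventuallyEq ?_, 1, 1, 1, one_ne_zero,
    zero_le_one, fun c hc y hy y' hy' => ?_⟩
  · filter_upwards [hs.eventually_affPt (P := fun _ => True) (by simp)] with t ht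
    rw [(ht.2.1 p).2, affCrd_affPt, id]
  · beta_reduce
    rw [hy.2, affCrd_affPt]
    simp

theorem SepChart.Tame.eval_polynomial (K : SepChart C d) (P : ℂ[X]) :
    K.Tame fun y => P.eval (Decomposable.affCrd K.j y.2) := by
  induction P using Polynomial.induction_on' with
  | add p q hp hq => simpa using hp.add hq
  | monomial m a =>
    simp only [eval_monomial]
    exact (const K a).mul ((Tame.affCrd K).pow m)

theorem SepChart.sections_bijOn {c : ℂ} {s : fiber C (affPt K.j c) → PSpace 1 → PSpace n × PSpace 1}
    (hs : IsSections C (affPt K.j c) s) (hc : c ∉ K.F) :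
    ∀ᶠ t in 𝓝 c, Set.BijOn (fun p => s p (affPt K.j t)) Set.univ
      (fib C (affPt K.j t) : Set (PSpace n × PSpace 1)) := by
  filter_upwards [hs.eventually_affPt (P := fun _ => True) (by simp), K.eventually_notMem hc]
    with t ht htF
  rw [coe_fib (K.finite_fiber htF)]
  exact ⟨fun p _ => ht.2.1 p, ht.2.2.1.injOn, fun y hy =>
    let ⟨p, hp⟩ := ht.2.2.2.1 y hy
    ⟨p, trivial, hp⟩⟩

/-- Near a base point the local sections enumerate the fibers, so the product is a product of `d`
holomorphic functions; the denominator and the bound are raised to the power `d`. -/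
theorem SepChart.Tame₂.prod_fib (hE : K.Tame₂ E) : K.Tame fun y => ∏ y' ∈ fib C y.2, E y y' := by
  refine ⟨fun c hc s hs p _ => ?_, ?_⟩
  · have := (K.finite_fiber hc).to_subtype
    let _ := Fintype.ofFinite (fiber C (affPt K.j c))
    refine (DifferentiableAt.fun_finsetProd (u := Finset.univ)
      fun p' _ => hE.diff c hc s hs p p').congr_of_eventuallyEq ?_
    filter_upwards [hs.eventually_affPt (P := fun _ => True) (by simp), K.sections_bijOn hs hc]
      with t ht hbij
    rw [show (s p (affPt K.j t)).2 = affPt K.j t from (ht.2.1 p).2]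
    refine (Finset.prod_bij (fun p' _ => s p' (affPt K.j t)) (fun p' _ => ?_) ?_ ?_ ?_).symm
    · exact hbij.1 (Set.mem_univ p')
    · exact fun p₁ _ p₂ _ h => hbij.2.1 trivial trivial h
    · intro y hy
      obtain ⟨p', _, h⟩ := hbij.2.2 hy
      exact ⟨p', Finset.mem_univ _, h⟩
    · exact fun _ _ => rfl
  · obtain ⟨D, A, k, hD, hA, hb⟩ := hE.growth
    refine ⟨D ^ d, A ^ d, k * d, pow_ne_zero _ hD, by positivity, fun c hc y hy _ _ => ?_⟩
    have hcard := card_fib (K.encard c hc)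
    have hpow : D.eval c ^ d = ∏ _y' ∈ fib C (affPt K.j c), D.eval c := by
      rw [Finset.prod_const, hcard]
    have hpow' : (A * (1 + ‖c‖) ^ k) ^ d =
        ∏ _y' ∈ fib C (affPt K.j c), (A * (1 + ‖c‖) ^ k) := by
      rw [Finset.prod_const, hcard]
    beta_reduce
    rw [show y.2 = affPt K.j c from hy.2, eval_pow, hpow, ← Finset.prod_mul_distrib, norm_prod,
      pow_mul, ← mul_pow, hpow']
    refine Finset.prod_le_prod (fun _ _ => norm_nonneg _) fun y' hy' => ?_
    exact hb c hc y hy y' ((mem_fib (K.finite_fiber hc)).mp hy')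

theorem SepChart.Tame₂.sum_fib (hE : K.Tame₂ E) : K.Tame fun y => ∑ y' ∈ fib C y.2, E y y' := by
  refine ⟨fun c hc s hs p _ => ?_, ?_⟩
  · have := (K.finite_fiber hc).to_subtype
    let _ := Fintype.ofFinite (fiber C (affPt K.j c))
    refine (DifferentiableAt.fun_sum (u := Finset.univ)
      fun p' _ => hE.diff c hc s hs p p').congr_of_eventuallyEq ?_
    filter_upwards [hs.eventually_affPt (P := fun _ => True) (by simp), K.sections_bijOn hs hc]
      with t ht hbij
    rw [show (s p (affPt K.j t)).2 = affPt K.j t from (ht.2.1 p).2]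
    refine (Finset.sum_bij (fun p' _ => s p' (affPt K.j t)) (fun p' _ => ?_) ?_ ?_ ?_).symm
    · exact hbij.1 (Set.mem_univ p')
    · exact fun p₁ _ p₂ _ h => hbij.2.1 trivial trivial h
    · intro y hy
      obtain ⟨p', _, h⟩ := hbij.2.2 hy
      exact ⟨p', Finset.mem_univ _, h⟩
    · exact fun _ _ => rfl
  · obtain ⟨D, A, k, hD, hA, hb⟩ := hE.growth
    refine ⟨D, d * A, k, hD, by positivity, fun c hc y hy _ _ => ?_⟩
    have hcard := card_fib (K.encard c hc)
    have hsum : d * A * (1 + ‖c‖) ^ k =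
        ∑ _y' ∈ fib C (affPt K.j c), A * (1 + ‖c‖) ^ k := by
      rw [Finset.sum_const, hcard, nsmul_eq_mul, mul_assoc]
    beta_reduce
    rw [show y.2 = affPt K.j c from hy.2, Finset.mul_sum, hsum]
    refine (norm_sum_le _ _).trans (Finset.sum_le_sum fun y' hy' => ?_)
    exact hb c hc y hy y' ((mem_fib (K.finite_fiber hc)).mp hy')

/-- A relation on the fibers that is locally constant along local sections. -/
def SepChart.LocConst (K : SepChart C d) (R : PSpace n × PSpace 1 → PSpace n × PSpace 1 → Prop) :
    Prop :=
  ∀ c ∉ K.F, ∀ s, IsSections C (affPt K.j c) s → ∀ᶠ t in 𝓝 (affPt K.j c),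
    ∀ p p' : fiber C (affPt K.j c), R (s p t) (s p' t) ↔ R p p'

/-- Along local sections the indicator of the relation is constant, hence tame, and the case
distinction is the combination of `E` and `E'` with this indicator and its complement as
coefficients. -/
theorem SepChart.Tame₂.ite {R : PSpace n × PSpace 1 → PSpace n × PSpace 1 → Prop}
    [∀ y y', Decidable (R y y')]
    (hR : K.LocConst R) (hE : K.Tame₂ E) (hE' : K.Tame₂ E') :
    K.Tame₂ fun y y' => if R y y' then E y y' else E' y y' := by
  have hind : K.Tame₂ fun y y' => if R y y' then 1 else 0 := by
    refine ⟨fun c hc s hs p p' => ?_, 1, 1, 0, one_ne_zero, zero_le_one, fun c _ y _ y' _ => ?_⟩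
    · refine (differentiableAt_const (if R p p' then (1 : ℂ) else 0)).congr_of_eventuallyEq ?_
      filter_upwards [hs.eventually_affPt (hR c hc s hs)] with t ht
      simp only [ht.1 p p']
    · split_ifs <;> simp
  have h1 := hind.mul hE
  have h2 := ((const K 1).add ((const K (-1)).mul hind)).mul hE'
  refine (h1.add h2).congr fun c hc y hy y' hy' => ?_
  split_ifs <;> simp

/-- A tame function that is constant on the fibers is a rational function of the coordinate. -/
theorem SepChart.Tame.exists_rational (hC : IsCover C d) (he : K.Tame e)
    (h : ∀ c ∉ K.F, ∀ y ∈ fiber C (affPt K.j c), ∀ y' ∈ fiber C (affPt K.j c), e y = e y') :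
    ∃ p g : ℂ[X], (∀ c ∉ K.F, g.eval c ≠ 0) ∧ ∀ c ∉ K.F, ∀ y ∈ fiber C (affPt K.j c),
      e y = p.eval c / g.eval c := by
  classical
  have hne : ∀ c ∉ K.F, (fiber C (affPt K.j c)).Nonempty := fun c hc => by
    rw [← Set.encard_pos, K.encard c hc]
    exact_mod_cast hC.pos
  let f : ℂ → ℂ := fun c => if hc : c ∉ K.F then e (hne c hc).some else 0
  have hf : ∀ c ∉ K.F, ∀ y ∈ fiber C (affPt K.j c), f c = e y := fun c hc y hy => by
    simp only [f, dif_pos hc]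
    exact h c hc _ (hne c hc).some_mem y hy
  obtain ⟨D, A, k, hD, hA, hb⟩ := he.growth
  obtain ⟨p, g, hg, hpg⟩ := exists_rational_of_growth K.finite (f := f) (D := D) (A := A) (k := k)
    (fun c hc => by
      obtain ⟨s, hs⟩ := hC.exists_sections (K.notMem_branchLocus hC hc)
      let p : fiber C (affPt K.j c) := ⟨_, (hne c hc).some_mem⟩
      refine (he.diff c hc s hs p p).congr_of_eventuallyEq ?_
      filter_upwards [hs.eventually_affPt (P := fun _ => True) (by simp), K.eventually_notMem hc]
        with t ht htF
      exact hf t htF _ (ht.2.1 p)) hD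
    (fun c hc => by
      rw [hf c hc _ (hne c hc).some_mem]
      exact hb c hc _ (hne c hc).some_mem _ (hne c hc).some_mem)
  exact ⟨p, g, hg, fun c hc y hy => by rw [← hf c hc y hy, hpg c hc]⟩

end Tame

end Decomposable
end

noncomputable section

namespace Decomposable

/-! ### Coordinates are tame -/

section Coordinates

open Polynomial Filter

variable {n : ℕ} {C : Set (PSpace n × PSpace 1)} {d : ℕ}

theorem SepChart.mem_chart (K : SepChart C d) {c : ℂ} (hc : c ∉ K.F) {y : PSpace n × PSpace 1}
    (hy : y ∈ fiber C (affPt K.j c)) : y ∈ chart C K.ℓ₀ K.j :=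
  ⟨hy.1, K.lin_ne_zero c hc y hy, by
    rw [show y.2 = affPt K.j c from hy.2]; exact affPt_rep_ne_zero _ _⟩

theorem SepChart.exists_notMem (K : SepChart C d) {F : Set ℂ} (hF : F.Finite) :
    ∃ c ∉ K.F, c ∉ F := by
  obtain ⟨c, hc⟩ := (K.finite.union hF).exists_notMem
  simp only [Set.mem_union, not_or] at hc
  exact ⟨c, hc.1, hc.2⟩

theorem SepChart.nonempty_fiber (K : SepChart C d) (hC : IsCover C d) {c : ℂ} (hc : c ∉ K.F) :
    (fiber C (affPt K.j c)).Nonempty := by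
  rw [← Set.encard_pos, K.encard c hc]
  exact_mod_cast hC.pos

theorem SepChart.nonempty_chart (K : SepChart C d) (hC : IsCover C d) :
    (chart C K.ℓ₀ K.j).Nonempty := by
  obtain ⟨c, hc, -⟩ := K.exists_notMem Set.finite_empty
  obtain ⟨y, hy⟩ := K.nonempty_fiber hC hc
  exact ⟨y, K.mem_chart hc hy⟩

/-- A function given by a polynomial in the normalized coordinates has zeros on finitely many
fibers only. -/
theorem SepChart.finite_zeros (K : SepChart C d) (hC : IsCover C d)
    {a : MvPolynomial (Fin (n + 1) ⊕ Fin 2) ℂ} {y₀ : PSpace n × PSpace 1}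
    (hy₀ : y₀ ∈ chart C K.ℓ₀ K.j) (ha : a.eval (normCrd K.ℓ₀ K.j y₀) ≠ 0) :
    ∃ F : Set ℂ, F.Finite ∧ ∀ c ∉ K.F, c ∉ F → ∀ y ∈ fiber C (affPt K.j c),
      a.eval (normCrd K.ℓ₀ K.j y) ≠ 0 := by
  obtain ⟨F, hF, h⟩ := (isIrreducibleAlgebraic_chart hC.closed hC.irreducible
    (K.nonempty_chart hC)).finite_zeros (hC.exists_finite_encard_le K.ℓ₀ K.j) (a := a)
    (fun h => ha (h _ ⟨y₀, hy₀, rfl⟩))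
  refine ⟨F, hF, fun c hc hcF y hy => h _ ⟨y, K.mem_chart hc hy, rfl⟩ ?_⟩
  rwa [eval_normCrd_X_inr, show y.2 = affPt K.j c from hy.2, affCrd_affPt]

theorem continuousAt_normCrd {ℓ : Fin (n + 1) → ℂ} {j : Fin 2} {p : PSpace n × PSpace 1}
    (hp : lin ℓ p.1 ≠ 0) (hp' : p.2.rep j ≠ 0) : ContinuousAt (normCrd ℓ j) p := by
  rw [continuousAt_pi]
  rintro (i | i)
  · have := continuousAt_lin_div (Pi.single i 1) ℓ hp
    simp only [lin_single] at this
    exact ContinuousAt.comp (g := fun x : PSpace n => x.rep i / lin ℓ x) this continuousAt_fst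
  · exact ContinuousAt.comp (g := fun x : PSpace 1 => x.rep i / x.rep j)
      (continuousAt_rep_div i j hp') continuousAt_snd

/-- A bound for the roots of a polynomial. -/
theorem norm_leadingCoeff_mul_le {g : ℕ → ℂ} {m : ℕ} (hm : 0 < m) {z : ℂ}
    (h : ∑ i ∈ Finset.range (m + 1), g i * z ^ i = 0) :
    ‖g m * z‖ ≤ ∑ i ∈ Finset.range (m + 1), ‖g i‖ := by
  obtain ⟨m, rfl⟩ : ∃ k, m = k + 1 := ⟨m - 1, by omega⟩
  rw [Finset.sum_range_succ] at h ⊢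
  rw [norm_mul]
  rcases le_total ‖z‖ 1 with hz | hz
  · refine (mul_le_of_le_one_right (norm_nonneg _) hz).trans ?_
    exact le_add_of_nonneg_left (Finset.sum_nonneg fun _ _ => norm_nonneg _)
  · refine le_trans ?_ (le_add_of_nonneg_right (norm_nonneg _))
    have hz0 : 0 < ‖z‖ := by linarith
    have h1 : ‖g (m + 1)‖ * ‖z‖ ^ (m + 1) ≤
        (∑ i ∈ Finset.range (m + 1), ‖g i‖) * ‖z‖ ^ m := by
      rw [← norm_pow, ← norm_mul, show g (m + 1) * z ^ (m + 1) =
        -∑ i ∈ Finset.range (m + 1), g i * z ^ i by linear_combination h, norm_neg, Finset.sum_mul]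
      refine (norm_sum_le _ _).trans (Finset.sum_le_sum fun i hi => ?_)
      rw [norm_mul, norm_pow]
      exact mul_le_mul_of_nonneg_left
        (pow_le_pow_right₀ hz (Nat.lt_succ_iff.mp (Finset.mem_range.mp hi))) (norm_nonneg _)
    rw [pow_succ, mul_comm (‖z‖ ^ m), ← mul_assoc] at h1
    exact le_of_mul_le_mul_right h1 (pow_pos hz0 m)

/-- A relation of minimal degree is separable at all but finitely many points. -/
theorem SepChart.exists_minimal_relation (K : SepChart C d) (hC : IsCover C d)
    (a : MvPolynomial (Fin (n + 1) ⊕ Fin 2) ℂ) :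
    ∃ G : ℂ[X][X], 0 < G.natDegree ∧
      (∀ c ∉ K.F, ∀ y ∈ fiber C (affPt K.j c), G.evalEval c (a.eval (normCrd K.ℓ₀ K.j y)) = 0) ∧
      ∃ F : Set ℂ, F.Finite ∧ ∀ c ∉ K.F, c ∉ F → ∀ y ∈ fiber C (affPt K.j c),
        (derivative G).evalEval c (a.eval (normCrd K.ℓ₀ K.j y)) ≠ 0 := by
  classical
  have hS := isIrreducibleAlgebraic_chart hC.closed hC.irreducible (K.nonempty_chart hC)
  have hex : ∃ m, ∃ G : ℂ[X][X], G ≠ 0 ∧ G.natDegree = m ∧ ∀ y ∈ chart C K.ℓ₀ K.j,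
      G.evalEval (affCrd K.j y.2) (a.eval (normCrd K.ℓ₀ K.j y)) = 0 := by
    obtain ⟨G, hG, h⟩ := hS.exists_relation (hC.exists_finite_encard_le K.ℓ₀ K.j) a
    refine ⟨_, G, hG, rfl, fun y hy => ?_⟩
    have := h _ ⟨y, hy, rfl⟩
    rwa [eval_normCrd_X_inr] at this
  obtain ⟨G, hG, hdeg, hrel⟩ := Nat.find_spec hex
  have hpos : 0 < G.natDegree := by
    rw [Nat.pos_iff_ne_zero]
    intro h0
    obtain ⟨g, rfl⟩ := natDegree_eq_zero.mp h0
    have hg : g ≠ 0 := fun h => hG (by rw [h, map_zero])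
    obtain ⟨c, hc, hcg⟩ := K.exists_notMem (finite_setOfPred_isRoot hg)
    obtain ⟨y, hy⟩ := K.nonempty_fiber hC hc
    have := hrel y (K.mem_chart hc hy)
    rw [show y.2 = affPt K.j c from hy.2, affCrd_affPt] at this
    exact hcg (by simpa [evalEval] using this)
  have hder : ∃ y ∈ chart C K.ℓ₀ K.j,
      (derivative G).evalEval (affCrd K.j y.2) (a.eval (normCrd K.ℓ₀ K.j y)) ≠ 0 := by
    by_contra! hcon
    -- By minimality of the degree, the derivative is not a relation as well.
    have hlt : (derivative G).natDegree < G.natDegree := natDegree_derivative_lt hpos.ne'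
    refine Nat.find_min hex (m := (derivative G).natDegree) (by rwa [← hdeg])
      ⟨derivative G, fun h => hpos.ne' ?_, rfl, hcon⟩
    exact derivative_eq_zero.mp h
  obtain ⟨y₀, hy₀, hne⟩ := hder
  have hev : ∀ y : PSpace n × PSpace 1,
      (subst₂ (MvPolynomial.X (Sum.inr (1 - K.j))) a (derivative G)).eval (normCrd K.ℓ₀ K.j y) =
      (derivative G).evalEval (affCrd K.j y.2) (a.eval (normCrd K.ℓ₀ K.j y)) := fun y => by
    rw [eval_subst₂, eval_normCrd_X_inr]
  obtain ⟨F, hF, hF'⟩ := K.finite_zeros hC (a := subst₂ (MvPolynomial.X (Sum.inr (1 - K.j))) a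
    (derivative G)) hy₀ (by rwa [hev])
  refine ⟨G, hpos, fun c hc y hy => ?_, F, hF, fun c hc hcF y hy => ?_⟩
  · have := hrel y (K.mem_chart hc hy)
    rwa [show y.2 = affPt K.j c from hy.2, affCrd_affPt] at this
  · have := hF' c hc hcF y hy
    rwa [hev, show y.2 = affPt K.j c from hy.2, affCrd_affPt] at this

/-- Polynomials in the normalized coordinates are tame. -/
theorem SepChart.Tame.eval_normCrd (K : SepChart C d) (hC : IsCover C d)
    (a : MvPolynomial (Fin (n + 1) ⊕ Fin 2) ℂ) :
    K.Tame fun y => a.eval (normCrd K.ℓ₀ K.j y) := by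
  obtain ⟨G, hpos, hrel, F, hF, hder⟩ := K.exists_minimal_relation hC a
  refine ⟨fun c hc s hs p _ => ?_, ?_⟩
  · have hcont : ∀ᶠ t in 𝓝 c, ContinuousAt
        (fun u => a.eval (normCrd K.ℓ₀ K.j (s p (affPt K.j u)))) t := by
      filter_upwards [hs.eventually_affPt (P := fun _ => True) (by simp), K.eventually_notMem hc]
        with t ht htF
      obtain ⟨-, h1, h2⟩ := K.mem_chart htF (ht.2.1 p)
      exact (a.continuous_eval.continuousAt.comp (continuousAt_normCrd h1 h2)).comp
        (f := fun u => s p (affPt K.j u)) (ht.2.2.2.2 p)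
    -- Where the root of `G` is simple, the function is differentiable by
    -- `differentiableAt_of_simple_root`; the finitely many other values of the coordinate are
    -- removable by continuity.
    refine (Complex.analyticAt_of_differentiable_on_punctured_nhds_of_continuousAt ?_
      hcont.self_of_nhds).differentiableAt
    have hFc : ∀ᶠ t in 𝓝[≠] c, t ∉ F := by
      have : ∀ᶠ t in 𝓝 c, t ∉ F \ {c} := hF.sdiff.isClosed.isOpen_compl.mem_nhds (by simp)
      filter_upwards [nhdsWithin_le_nhds this, self_mem_nhdsWithin] with t ht htc htF
      exact ht ⟨htF, htc⟩
    have hev : ∀ᶠ t in 𝓝 c, s p (affPt K.j t) ∈ fiber C (affPt K.j t) ∧ t ∉ K.F := by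
      filter_upwards [hs.eventually_affPt (P := fun _ => True) (by simp), K.eventually_notMem hc]
        with t ht htF
      exact ⟨ht.2.1 p, htF⟩
    filter_upwards [nhdsWithin_le_nhds hcont, nhdsWithin_le_nhds hev.eventually_nhds, hFc]
      with t h1 h2 h3
    refine differentiableAt_of_simple_root h1 ?_
      (hder t h2.self_of_nhds.2 h3 _ h2.self_of_nhds.1)
    filter_upwards [h2] with u hu using hrel u hu.2 _ hu.1
  -- The values are roots of `G(c, ·)`, so after multiplication with the leading coefficient they
  -- are bounded by the sum of the norms of the coefficients.
  · choose A k hA hb using fun i => exists_growth (G.coeff i)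
    refine ⟨G.leadingCoeff, ∑ i ∈ Finset.range (G.natDegree + 1), A i,
      ∑ i ∈ Finset.range (G.natDegree + 1), k i,
      leadingCoeff_ne_zero.mpr (fun h => by simp [h] at hpos),
      Finset.sum_nonneg fun i _ => hA i, fun c hc y hy _ _ => ?_⟩
    have h := hrel c hc y hy
    rw [evalEval_eq_sum] at h
    refine (norm_leadingCoeff_mul_le (g := fun i => (G.coeff i).eval c) hpos h).trans ?_
    rw [Finset.sum_mul]
    refine Finset.sum_le_sum fun i hi => (hb i c).trans ?_
    exact mul_le_mul_of_nonneg_left (pow_le_pow_right₀ (by linarith [norm_nonneg c])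
      (Finset.single_le_sum (fun _ _ => Nat.zero_le _) hi)) (hA i)

theorem SepChart.Tame.fn (K : SepChart C d) (hC : IsCover C d) : K.Tame K.fn :=
  (Tame.eval_normCrd K hC (linPoly K.ℓ₁)).congr fun _ _ _ _ => by rw [eval_normCrd_linPoly]; rfl

end Coordinates

end Decomposable
end

noncomputable section

namespace Decomposable

/-! ### Tame functions are rational -/

section Rational

open Polynomial Filter

variable {n : ℕ} {C : Set (PSpace n × PSpace 1)} {d : ℕ}

/-- A family of polynomials whose values at the natural numbers are rational functions. -/
theorem exists_poly_of_rational_values {T : Set ℂ} {L : ℂ → ℂ[X]} {m : ℕ}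
    (hdeg : ∀ c ∈ T, (L c).degree < m)
    (h : ∀ i : ℕ, ∃ p g : ℂ[X], (∀ c ∈ T, g.eval c ≠ 0) ∧
      ∀ c ∈ T, (L c).eval (i : ℂ) = p.eval c / g.eval c) :
    ∃ (N : ℂ[X][X]) (g : ℂ[X]), (∀ c ∈ T, g.eval c ≠ 0) ∧
      ∀ c ∈ T, N.map (evalRingHom c) = Polynomial.C (g.eval c) * L c := by
  classical
  choose p g hg hpg using h
  -- Lagrange interpolation at the nodes `0, …, m - 1`, with all denominators cleared by their
  -- product.
  refine ⟨∑ i ∈ Finset.range m, Polynomial.C (p i * ∏ k ∈ (Finset.range m).erase i, g k) *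
    (Lagrange.basis (Finset.range m) (fun k : ℕ => (k : ℂ)) i).map Polynomial.C,
    ∏ k ∈ Finset.range m, g k, fun c hc => ?_, fun c hc => ?_⟩
  · rw [eval_prod]
    exact Finset.prod_ne_zero_iff.mpr fun k _ => hg k c hc
  · have hL := Lagrange.eq_interpolate (s := Finset.range m) (v := fun k : ℕ => (k : ℂ))
      (fun a _ b _ hab => Nat.cast_injective hab) (f := L c) (by simpa using hdeg c hc)
    rw [hL, Lagrange.interpolate_apply, Polynomial.map_sum, Finset.mul_sum]
    refine Finset.sum_congr rfl fun i hi => ?_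
    rw [Polynomial.map_mul, map_C, Polynomial.map_map, ← mul_assoc, ← C_mul]
    congr 1
    · rw [hpg i c hc, coe_evalRingHom, eval_mul, eval_prod, eval_prod,
        ← Finset.mul_prod_erase _ _ hi]
      have := hg i c hc
      congr 1
      field_simp
    · have : (evalRingHom c).comp Polynomial.C = RingHom.id ℂ := by ext; simp
      rw [this, Polynomial.map_id]

variable {K : SepChart C d} {e : PSpace n × PSpace 1 → ℂ}

theorem SepChart.locConst_eq (K : SepChart C d) : K.LocConst fun y y' => y = y' := by
  intro c hc s hs
  filter_upwards [hs.eventually] with t ht p p'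
  exact ⟨fun h => congrArg Subtype.val (ht.2.2.1 h), fun h => by rw [Subtype.ext h]⟩

theorem fiber_snd_eq {c : ℂ} {y y' : PSpace n × PSpace 1} (hy : y ∈ fiber C (affPt K.j c))
    (hy' : y' ∈ fiber C (affPt K.j c)) : y.2 = y'.2 :=
  hy.2.trans hy'.2.symm

/-- The norm of a tame function without zeros on one fiber is a nonzero rational function. -/
theorem SepChart.Tame.exists_norm (hC : IsCover C d) (he : K.Tame e) {c₀ : ℂ} (hc₀ : c₀ ∉ K.F)
    (h0 : ∀ y ∈ fiber C (affPt K.j c₀), e y ≠ 0) :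
    ∃ p g : ℂ[X], p ≠ 0 ∧ (∀ c ∉ K.F, g.eval c ≠ 0) ∧ ∀ c ∉ K.F, ∀ y ∈ fiber C (affPt K.j c),
      p.eval c = g.eval c * ∏ y' ∈ fib C y.2, e y' := by
  obtain ⟨p, g, hg, hpg⟩ := (Tame₂.prod_fib he.right).exists_rational hC
    (fun c hc y hy y' hy' => by rw [fiber_snd_eq hy hy'])
  have hpg' : ∀ c ∉ K.F, ∀ y ∈ fiber C (affPt K.j c),
      p.eval c = g.eval c * ∏ y' ∈ fib C y.2, e y' := fun c hc y hy => by
    rw [hpg c hc y hy, mul_div_cancel₀ _ (hg c hc)]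
  refine ⟨p, g, ?_, hg, hpg'⟩
  rintro rfl
  obtain ⟨y, hy⟩ := K.nonempty_fiber hC hc₀
  have h1 := hpg' c₀ hc₀ y hy
  rw [eval_zero, show y.2 = affPt K.j c₀ from hy.2] at h1
  refine mul_ne_zero (hg c₀ hc₀) (Finset.prod_ne_zero_iff.mpr fun y' hy' => ?_) h1.symm
  exact h0 y' ((mem_fib (K.finite_fiber hc₀)).mp hy')

/-- A holomorphic function that is a quotient of tame functions is tame. -/
theorem SepChart.Tame.of_mul (hC : IsCover C d) {φ ψ : PSpace n × PSpace 1 → ℂ} (hφ : K.Tame φ)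
    (hψ : K.Tame ψ)
    (hdiff : ∀ c ∉ K.F, ∀ s, IsSections C (affPt K.j c) s → ∀ p,
      DifferentiableAt ℂ (fun t => e (s p (affPt K.j t))) c)
    (hmul : ∀ c ∉ K.F, ∀ y ∈ fiber C (affPt K.j c), ψ y * e y = φ y)
    {c₀ : ℂ} (hc₀ : c₀ ∉ K.F) (h0 : ∀ y ∈ fiber C (affPt K.j c₀), ψ y ≠ 0) : K.Tame e := by
  classical
  refine ⟨fun c hc s hs p _ => hdiff c hc s hs p, ?_⟩
  obtain ⟨p, g, hp, hg, hpg⟩ := hψ.exists_norm hC hc₀ h0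
  -- This is `g · φ(y)` times the product of `ψ(y')` over the points `y' ≠ y` of the fiber; the
  -- value `1` at `y' = y` omits that factor. Since `φ = ψ e`, it equals `g · N(ψ) · e = p e` with
  -- `N(ψ)` the norm, so `p` serves as a denominator of `e`.
  have hM := ((Tame.eval_polynomial K g).mul
    (Tame₂.prod_fib ((Tame₂.const K 1).ite (K.locConst_eq) hψ.right))).mul hφ
  obtain ⟨D, A, k, hD, hA, hb⟩ := hM.growth
  refine ⟨D * p, A, k, mul_ne_zero hD hp, hA, fun c hc y hy y' hy' => ?_⟩
  have := hb c hc y hy y' hy'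
  refine le_of_eq_of_le ?_ this
  congr 1
  have hyf : y ∈ fib C y.2 := by
    rw [show y.2 = affPt K.j c from hy.2]
    exact (mem_fib (K.finite_fiber hc)).mpr hy
  beta_reduce
  rw [eval_mul, hpg c hc y hy, ← hmul c hc y hy, show Decomposable.affCrd K.j y.2 = c by
    rw [show y.2 = affPt K.j c from hy.2, affCrd_affPt], ← Finset.mul_prod_erase _ _ hyf,
    ← Finset.mul_prod_erase _ (fun y' => if y = y' then (1 : ℂ) else ψ y') hyf]
  have : ∏ x ∈ (fib C y.2).erase y, (if y = x then (1 : ℂ) else ψ x) =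
      ∏ x ∈ (fib C y.2).erase y, ψ x :=
    Finset.prod_congr rfl fun x hx => if_neg (Finset.ne_of_mem_erase hx).symm
  rw [this]
  simp only [if_true]
  ring

theorem SepChart.Tame.inv (hC : IsCover C d) (he : K.Tame e)
    (h0 : ∀ c ∉ K.F, ∀ y ∈ fiber C (affPt K.j c), e y ≠ 0) : K.Tame fun y => (e y)⁻¹ := by
  obtain ⟨c₀, hc₀, -⟩ := K.exists_notMem Set.finite_empty
  refine (Tame.const K 1).of_mul hC he (fun c hc s hs p => ?_)
    (fun c hc y hy => mul_inv_cancel₀ (h0 c hc y hy)) hc₀ (h0 c₀ hc₀)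
  refine (he.diff c hc s hs p p).inv ?_
  rw [hs.apply_self]
  exact h0 c hc p p.2

theorem SepChart.evalEval_eq_of_map {N : ℂ[X][X]} {c : ℂ} {L : ℂ[X]} {a : ℂ}
    (h : N.map (evalRingHom c) = Polynomial.C a * L) (z : ℂ) : N.evalEval c z = a * L.eval z := by
  rw [← map_evalRingHom_eval, h, eval_mul, eval_C]

/-- The polynomial whose roots are the values of a tame function on a fiber has rational
coefficients. -/
theorem SepChart.Tame.exists_charpoly (hC : IsCover C d) (he : K.Tame e) :
    ∃ (H : ℂ[X][X]) (g : ℂ[X]), (∀ c ∉ K.F, g.eval c ≠ 0) ∧ ∀ c ∉ K.F,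
      H.map (evalRingHom c) = Polynomial.C (g.eval c) *
        ∏ y ∈ fib C (affPt K.j c), (X - Polynomial.C (e y)) := by
  -- The value of this polynomial at `i` is the norm of the tame function `i - e`, hence rational in
  -- the coordinate. The bound is `d + 1` because the degree is exactly `d`.
  refine exists_poly_of_rational_values (T := K.Fᶜ) (m := d + 1)
    (L := fun c => ∏ y ∈ fib C (affPt K.j c), (X - Polynomial.C (e y))) (fun c hc => ?_)
    fun i => ?_
  · rw [degree_prod]
    simp only [degree_X_sub_C, Finset.sum_const, card_fib (K.encard c hc), nsmul_eq_mul, mul_one]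
    exact_mod_cast Nat.lt_succ_self d
  · obtain ⟨p, g, hg, hpg⟩ := (Tame₂.prod_fib
      (((Tame.const K (i : ℂ)).sub he).right)).exists_rational hC
      (fun c hc y hy y' hy' => by rw [fiber_snd_eq hy hy'])
    refine ⟨p, g, hg, fun c hc => ?_⟩
    obtain ⟨y, hy⟩ := K.nonempty_fiber hC hc
    rw [← hpg c hc y hy, show y.2 = affPt K.j c from hy.2, eval_prod]
    simp

open Classical in
/-- A tame function is a polynomial in the separating function whose coefficients are rational
functions of the coordinate. -/
theorem SepChart.Tame.exists_eq (hC : IsCover C d) (he : K.Tame e) :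
    ∃ (N : ℂ[X][X]) (g : ℂ[X]), (∀ c ∉ K.F, g.eval c ≠ 0) ∧ ∀ c ∉ K.F,
      ∀ y ∈ fiber C (affPt K.j c), g.eval c * e y = N.evalEval c (K.fn y) := by
  have hfn := Tame.fn K hC
  obtain ⟨N, g, hg, hN⟩ := exists_poly_of_rational_values (T := K.Fᶜ) (m := d)
    (L := fun c => Lagrange.interpolate (fib C (affPt K.j c)) K.fn e) (fun c hc => by
      have hinj : Set.InjOn K.fn (fib C (affPt K.j c)) := by
        rw [coe_fib (K.finite_fiber hc)]; exact K.injOn c hc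
      have h := Lagrange.degree_interpolate_lt (s := fib C (affPt K.j c)) e hinj
      rwa [card_fib (K.encard c hc)] at h) (fun i => by
    -- Numerator and denominator of the Lagrange basis polynomial at the node `fn y`; the value `1`
    -- at `y' = y` leaves out the node itself. The interpolant evaluated at `i` is then a trace of a
    -- tame function.
    let P : ℂ → PSpace n × PSpace 1 → ℂ := fun a y => ∏ y' ∈ fib C y.2,
      if y = y' then 1 else a - K.fn y'
    let M : PSpace n × PSpace 1 → ℂ := fun y => ∏ y' ∈ fib C y.2,
      if y = y' then 1 else K.fn y - K.fn y'
    have hP : K.Tame (P i) := Tame₂.prod_fib ((Tame₂.const K 1).ite K.locConst_eq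
      ((Tame.const K (i : ℂ)).sub hfn).right)
    have hM : K.Tame M := Tame₂.prod_fib ((Tame₂.const K 1).ite K.locConst_eq
      (hfn.left.sub hfn.right))
    have hM0 : ∀ c ∉ K.F, ∀ y ∈ fiber C (affPt K.j c), M y ≠ 0 := fun c hc y hy => by
      refine Finset.prod_ne_zero_iff.mpr fun y' hy' => ?_
      split_ifs with h
      · exact one_ne_zero
      · rw [show y.2 = affPt K.j c from hy.2, mem_fib (K.finite_fiber hc)] at hy'
        exact sub_ne_zero.mpr fun heq => h (K.injOn c hc hy hy' heq)
    obtain ⟨p, g, hg, hpg⟩ := (Tame₂.sum_fib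
      ((he.mul (hM.inv hC hM0)).mul hP).right).exists_rational hC
      (fun c hc y hy y' hy' => by rw [fiber_snd_eq hy hy'])
    refine ⟨p, g, hg, fun c hc => ?_⟩
    obtain ⟨y, hy⟩ := K.nonempty_fiber hC hc
    rw [← hpg c hc y hy, show y.2 = affPt K.j c from hy.2, Lagrange.interpolate_apply,
      eval_finsetSum]
    refine Finset.sum_congr rfl fun y' hy' => ?_
    have hy2 : y'.2 = affPt K.j c := ((mem_fib (K.finite_fiber hc)).mp hy').2
    rw [eval_mul, eval_C, mul_assoc]
    congr 1
    simp only [Lagrange.basis, eval_prod, Lagrange.basisDivisor, eval_mul, eval_C, eval_sub, eval_X,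
      P, M, hy2, Finset.prod_mul_distrib, Finset.prod_inv_distrib]
    rw [← Finset.mul_prod_erase _ _ hy', ← Finset.mul_prod_erase _
      (fun x => if y' = x then (1 : ℂ) else i - K.fn x) hy']
    simp only [if_true, one_mul]
    congr 1
    · congr 1
      exact Finset.prod_congr rfl fun x hx => (if_neg (Finset.ne_of_mem_erase hx).symm).symm
    · exact Finset.prod_congr rfl fun x hx => (if_neg (Finset.ne_of_mem_erase hx).symm).symm)
  refine ⟨N, g, hg, fun c hc y hy => ?_⟩
  have hinj : Set.InjOn K.fn (fib C (affPt K.j c)) := by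
    rw [coe_fib (K.finite_fiber hc)]; exact K.injOn c hc
  rw [evalEval_eq_of_map (hN c hc), Lagrange.eval_interpolate_at_node _ hinj
    ((mem_fib (K.finite_fiber hc)).mpr hy)]

end Rational

end Decomposable
end

noncomputable section

namespace Decomposable

/-! ### Zeros of tame functions, transitivity of the monodromy, and regular functions -/

section Transitivity

open Polynomial Filter

variable {n : ℕ} {C : Set (PSpace n × PSpace 1)} {d : ℕ} {K : SepChart C d}
  {e : PSpace n × PSpace 1 → ℂ}

theorem SepChart.Tame₂.diag {E : PSpace n × PSpace 1 → PSpace n × PSpace 1 → ℂ}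
    (hE : K.Tame₂ E) : K.Tame fun y => E y y := by
  obtain ⟨D, A, k, hD, hA, hb⟩ := hE.growth
  exact ⟨fun c hc s hs p _ => hE.diff c hc s hs p p, D, A, k, hD, hA,
    fun c hc y hy _ _ => hb c hc y hy y hy⟩

/-- A nonzero tame function has zeros on finitely many fibers only. -/
theorem SepChart.Tame.finite_zeros (hC : IsCover C d) (he : K.Tame e) {c₀ : ℂ} (hc₀ : c₀ ∉ K.F)
    {y₀ : PSpace n × PSpace 1} (hy₀ : y₀ ∈ fiber C (affPt K.j c₀)) (h0 : e y₀ ≠ 0) :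
    ∃ F : Set ℂ, F.Finite ∧ ∀ c ∉ K.F, c ∉ F → ∀ y ∈ fiber C (affPt K.j c), e y ≠ 0 := by
  obtain ⟨N, g, hg, hN⟩ := he.exists_eq hC
  -- Up to the factor `g` without zeros, `e` is a polynomial in the normalized coordinates, and
  -- irreducibility of `C` controls the zeros of those.
  have hev : ∀ c ∉ K.F, ∀ y ∈ fiber C (affPt K.j c),
      (subst₂ (MvPolynomial.X (Sum.inr (1 - K.j))) (linPoly K.ℓ₁) N).eval (normCrd K.ℓ₀ K.j y) =
        g.eval c * e y := fun c hc y hy => by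
    rw [eval_subst₂, eval_normCrd_X_inr, eval_normCrd_linPoly,
      show y.2 = affPt K.j c from hy.2, affCrd_affPt, hN c hc y hy]
    rfl
  obtain ⟨F, hF, h⟩ := K.finite_zeros hC (K.mem_chart hc₀ hy₀)
    (a := subst₂ (MvPolynomial.X (Sum.inr (1 - K.j))) (linPoly K.ℓ₁) N)
    (by rw [hev c₀ hc₀ y₀ hy₀]; exact mul_ne_zero (hg c₀ hc₀) h0)
  refine ⟨F, hF, fun c hc hcF y hy => ?_⟩
  have := h c hc hcF y hy
  rw [hev c hc y hy] at this
  exact right_ne_zero_of_mul this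

/-- The chart with finitely many further points removed. -/
def SepChart.shrink (K : SepChart C d) {F : Set ℂ} (hF : F.Finite) : SepChart C d where
  __ := K
  F := K.F ∪ F
  finite := K.finite.union hF
  leadingCoeff c hc := K.leadingCoeff c fun h => hc (Or.inl h)
  encard c hc := K.encard c fun h => hc (Or.inl h)
  lin_ne_zero c hc := K.lin_ne_zero c fun h => hc (Or.inl h)
  injOn c hc := K.injOn c fun h => hc (Or.inl h)

theorem SepChart.locConst_extRel (K : SepChart C d) {q : PSpace 1}
    (r : fiber C q → fiber C q → Prop) : K.LocConst (ExtRel C r) :=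
  fun _ _ _ hs => hs.eventually_extRel_iff r

/-- The monodromy group of an irreducible curve is transitive. -/
theorem IsCover.exists_monodromy_eq (hC : IsCover C d) {q : PSpace 1} (hq : q ∉ branchLocus C)
    (x x' : fiber C q) : ∃ σ ∈ monodromyGroup C q hq, σ x = x' := by
  classical
  by_contra! hcon
  obtain ⟨K, c, hc, rfl⟩ := hC.exists_sepChart hq
  -- `r` says only that its first argument is in the orbit of `x`. It is made binary so that
  -- `ExtRel` extends it, and it is then read on the diagonal.
  let r : fiber C (affPt K.j c) → fiber C (affPt K.j c) → Prop := fun z _ =>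
    ∃ σ ∈ monodromyGroup C _ hq, σ x = z
  have hr : ∀ σ ∈ monodromyGroup C _ hq, ∀ z z', r z z' → r (σ z) (σ z') := by
    rintro σ hσ z z' ⟨τ, hτ, rfl⟩
    exact ⟨σ * τ, mul_mem hσ hτ, rfl⟩
  have hE : K.Tame fun y => if ExtRel C r y y then 1 else 0 :=
    ((SepChart.Tame₂.const K 1).ite (K.locConst_extRel r) (SepChart.Tame₂.const K 0)).diag
  have hx : ExtRel C r x x := (hC.extRel_iff hq hr x x).mpr ⟨1, one_mem _, rfl⟩
  have hx' : ¬ ExtRel C r x' x' := fun h =>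
    let ⟨σ, hσ, h⟩ := (hC.extRel_iff hq hr x' x').mp h
    hcon σ hσ h
  -- The indicator of the orbit and its complement are both nonzero tame functions, so on some
  -- common fiber neither has a zero; yet their product is zero.
  obtain ⟨F, hF, h⟩ := hE.finite_zeros hC hc x.2 (by rw [if_pos hx]; exact one_ne_zero)
  obtain ⟨F', hF', h'⟩ := ((SepChart.Tame.const K 1).sub hE).finite_zeros hC hc x'.2
    (by rw [if_neg hx']; simp)
  obtain ⟨c', hc', hcF⟩ := K.exists_notMem (hF.union hF')
  simp only [Set.mem_union, not_or] at hcF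
  obtain ⟨y, hy⟩ := K.nonempty_fiber hC hc'
  have h1 := h c' hc' hcF.1 y hy
  have h2 := h' c' hc' hcF.2 y hy
  split_ifs at h1 h2 with h3
  · exact h2 (by simp)
  · exact h1 rfl

/-- The points of the projective line that a chart covers. -/
def SepChart.base (K : SepChart C d) : Set (PSpace 1) := affPt K.j '' K.Fᶜ

theorem SepChart.mem_base {c : ℂ} : affPt K.j c ∈ K.base ↔ c ∉ K.F := by
  constructor
  · rintro ⟨c', hc', h⟩
    rwa [affPt_injective _ h] at hc'
  · exact fun h => ⟨c, h, rfl⟩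

theorem SepChart.finite_compl_base (K : SepChart C d) : K.baseᶜ.Finite := by
  refine ((K.finite.image (affPt K.j)).insert (affPt (1 - K.j) 0)).subset fun p hp => ?_
  by_cases h : p.rep K.j = 0
  · exact Or.inl (eq_affPt_of_rep_eq_zero h)
  · refine Or.inr ⟨affCrd K.j p, ?_, affPt_affCrd h⟩
    by_contra hF
    exact hp ⟨_, hF, affPt_affCrd h⟩

theorem evalAt_eq_eval_normCrd {m : ℕ} {F : MvPolynomial (Fin (n + 1) ⊕ Fin (m + 1)) ℂ}
    {D : ℕ × ℕ} (hF : IsBihomogeneous F D) {ℓ : Fin (n + 1) → ℂ} {j : Fin (m + 1)}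
    {p : PSpace n × PSpace m} (h1 : lin ℓ p.1 ≠ 0) (h2 : p.2.rep j ≠ 0) :
    evalAt F p = lin ℓ p.1 ^ D.1 * p.2.rep j ^ D.2 * F.eval (normCrd ℓ j p) := by
  rw [normCrd, ← hF.eval_smul, evalAt,
    show lin ℓ p.1 • (fun i => p.1.rep i / lin ℓ p.1) = p.1.rep from funext fun i =>
      mul_div_cancel₀ _ h1,
    show p.2.rep j • (fun i => p.2.rep i / p.2.rep j) = p.2.rep from funext fun i =>
      mul_div_cancel₀ _ h2]

/-- Regular functions are tame. -/
theorem SepChart.Tame.of_isRegularFun (hC : IsCover C d)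
    (he : IsRegularFun (C ∩ Prod.snd ⁻¹' K.base) e) : K.Tame e := by
  have key : ∀ c ∉ K.F, ∀ p ∈ fiber C (affPt K.j c),
      ∃ φ ψ : PSpace n × PSpace 1 → ℂ, K.Tame φ ∧ K.Tame ψ ∧ ψ p ≠ 0 ∧
        ∀ c' ∉ K.F, ∀ y ∈ fiber C (affPt K.j c'), ψ y ≠ 0 → e y = φ y / ψ y := by
    intro c hc p hp
    obtain ⟨D, _, ⟨F, hF, rfl⟩, _, ⟨G, hG, rfl⟩, h0, h⟩ := he p ⟨hp.1, by
      rw [Set.mem_preimage, show p.2 = affPt K.j c from hp.2]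
      exact mem_base.mpr hc⟩
    have hne : ∀ c ∉ K.F, ∀ y ∈ fiber C (affPt K.j c),
        evalAt G y ≠ 0 ↔ G.eval (normCrd K.ℓ₀ K.j y) ≠ 0 := fun c hc y hy => by
      obtain ⟨-, h1, h2⟩ := K.mem_chart hc hy
      rw [evalAt_eq_eval_normCrd hG h1 h2]
      simp [h1, h2]
    refine ⟨_, _, Tame.eval_normCrd K hC F, Tame.eval_normCrd K hC G, (hne c hc p hp).mp h0,
      fun c' hc' y hy hψ => ?_⟩
    obtain ⟨-, h1, h2⟩ := K.mem_chart hc' hy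
    rw [h y ⟨hy.1, by
      rw [Set.mem_preimage, show y.2 = affPt K.j c' from hy.2]
      exact mem_base.mpr hc'⟩ ((hne c' hc' y hy).mpr hψ), evalAt_eq_eval_normCrd hG h1 h2,
      evalAt_eq_eval_normCrd hF h1 h2]
    exact mul_div_mul_left _ _ (mul_ne_zero (pow_ne_zero _ h1) (pow_ne_zero _ h2))
  obtain ⟨c, hc, -⟩ := K.exists_notMem Set.finite_empty
  obtain ⟨p, hp⟩ := K.nonempty_fiber hC hc
  obtain ⟨φ, ψ, hφ, hψ, h0, h⟩ := key c hc p hp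
  obtain ⟨F, hF, hF'⟩ := hψ.finite_zeros hC hc hp h0
  obtain ⟨c₁, hc₁, hc₁F⟩ := K.exists_notMem hF
  -- The identity `ψ² e = φ ψ` also holds at the zeros of `ψ`, where `φ / ψ` says nothing about `e`.
  refine (hφ.mul hψ).of_mul hC (hψ.mul hψ) (fun c hc s hs p => ?_) (fun c hc y hy => ?_) hc₁
    (fun y hy => mul_self_ne_zero.mpr (hF' c₁ hc₁ hc₁F y hy))
  · obtain ⟨φ, ψ, hφ, hψ, h0, h⟩ := key c hc p p.2
    have hψs := hψ.diff c hc s hs p p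
    refine ((hφ.diff c hc s hs p p).fun_div hψs (by rwa [hs.apply_self])).congr_of_eventuallyEq ?_
    filter_upwards [hs.eventually_affPt (P := fun _ => True) (by simp), K.eventually_notMem hc,
      hψs.continuousAt.eventually_ne (by rwa [hs.apply_self])] with t ht htF hne
    exact h t htF _ (ht.2.1 p) hne
  · by_cases hψy : ψ y = 0
    · simp [hψy]
    · rw [h c hc y hy hψy]
      field_simp

end Transitivity

end Decomposable
end

noncomputable section

namespace Decomposable

/-! ### Affine charts and a criterion for regular maps -/

section AffineCharts

variable {M M' : Type} [HasForms M] [HasForms M'] {σ σ' : Type}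

/-- On `X`, the forms are, up to factors without zeros, the polynomials in the functions `ν`. -/
structure AffineChart (X : Set M) (ν : M → σ → ℂ) : Prop where
  toForm : ∀ a a' : MvPolynomial σ ℂ, ∃ D, ∃ φ ∈ HasForms.form (M := M) D,
    ∃ φ' ∈ HasForms.form (M := M) D, ∃ u : M → ℂ, ∀ x ∈ X, u x ≠ 0 ∧
      φ x = u x * a.eval (ν x) ∧ φ' x = u x * a'.eval (ν x)
  ofForm : ∀ k : HasForms.Deg M, ∃ u : M → ℂ, (∀ x ∈ X, u x ≠ 0) ∧
    ∀ φ ∈ HasForms.form k, ∃ a : MvPolynomial σ ℂ, ∀ x ∈ X, φ x = u x * a.eval (ν x)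

theorem AffineChart.mono {X X' : Set M} {ν : M → σ → ℂ} (h : AffineChart X ν) (hX : X' ⊆ X) :
    AffineChart X' ν where
  toForm a a' := by
    obtain ⟨D, φ, hφ, φ', hφ', u, hu⟩ := h.toForm a a'
    exact ⟨D, φ, hφ, φ', hφ', u, fun x hx => hu x (hX hx)⟩
  ofForm k := by
    obtain ⟨u, hu, h⟩ := h.ofForm k
    refine ⟨u, fun x hx => hu x (hX hx), fun φ hφ => ?_⟩
    obtain ⟨a, ha⟩ := h φ hφ
    exact ⟨a, fun x hx => ha x (hX hx)⟩

/-- The common denominator `w` is cleared by one power per degree; all large exponents are provided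
so that two polynomials can share one. -/
theorem exists_clear_denominators {ι : Type} {X : Set ι} {v : ι → σ → ℂ} {v' : ι → σ' → ℂ}
    {w : MvPolynomial σ ℂ} {b : σ' → MvPolynomial σ ℂ}
    (h : ∀ x ∈ X, ∀ i, w.eval (v x) * v' x i = (b i).eval (v x)) (a : MvPolynomial σ' ℂ) :
    ∃ N₀ : ℕ, ∀ N ≥ N₀, ∃ a' : MvPolynomial σ ℂ, ∀ x ∈ X,
      a'.eval (v x) = w.eval (v x) ^ N * a.eval (v' x) := by
  induction a using MvPolynomial.induction_on with
  | C c => exact ⟨0, fun N _ => ⟨w ^ N * MvPolynomial.C c, fun x _ => by simp⟩⟩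
  | add a a' ha ha' =>
    obtain ⟨N₁, h₁⟩ := ha
    obtain ⟨N₂, h₂⟩ := ha'
    refine ⟨max N₁ N₂, fun N hN => ?_⟩
    obtain ⟨c, hc⟩ := h₁ N (le_of_max_le_left hN)
    obtain ⟨c', hc'⟩ := h₂ N (le_of_max_le_right hN)
    exact ⟨c + c', fun x hx => by rw [map_add, map_add, hc x hx, hc' x hx]; ring⟩
  | mul_X a i ha =>
    obtain ⟨N₁, h₁⟩ := ha
    refine ⟨N₁ + 1, fun N hN => ?_⟩
    obtain ⟨N', rfl⟩ : ∃ N', N = N' + 1 := ⟨N - 1, by omega⟩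
    obtain ⟨c, hc⟩ := h₁ N' (by omega)
    refine ⟨c * b i, fun x hx => ?_⟩
    rw [map_mul, map_mul, MvPolynomial.eval_X, hc x hx, ← h x hx i]
    ring

/-- A map that pulls back pairs of forms of the same degree to pairs of forms of the same degree,
up to a common factor without zeros, is regular. -/
theorem isRegularMap_of_forms {f : M → M'} {X : Set M} {Y : Set M'} (hf : Set.MapsTo f X Y)
    (h : ∀ k : HasForms.Deg M', ∀ φ ∈ HasForms.form k, ∀ ψ ∈ HasForms.form k,
      ∃ D, ∃ φ' ∈ HasForms.form (M := M) D, ∃ ψ' ∈ HasForms.form (M := M) D, ∃ u : M → ℂ,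
        ∀ x ∈ X, u x ≠ 0 ∧ φ' x = u x * φ (f x) ∧ ψ' x = u x * ψ (f x)) :
    IsRegularMap f X Y where
  mapsTo := hf
  continuousOn := by
    rw [@continuousOn_iff_continuous_domRestrict _ _ (zariski M) (zariski M'), continuous_generateFrom_iff]
    rintro _ ⟨k, φ, hφ, rfl⟩
    obtain ⟨D, φ', hφ', _, _, u, hu⟩ := h k φ hφ φ hφ
    refine ⟨{x | φ' x ≠ 0}, isOpen_form_ne_zero hφ', ?_⟩
    ext ⟨x, hx⟩
    obtain ⟨h1, h2, -⟩ := hu x hx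
    simp [h2, h1]
  pullback W hW g hg := by
    rintro p ⟨hpX, hpW⟩
    obtain ⟨k, φ, hφ, ψ, hψ, h0, hgφ⟩ := hg (f p) ⟨hf hpX, hpW⟩
    obtain ⟨D, φ', hφ', ψ', hψ', u, hu⟩ := h k φ hφ ψ hψ
    refine ⟨D, φ', hφ', ψ', hψ', ?_, fun x hx hne => ?_⟩
    · rw [(hu p hpX).2.2]
      exact mul_ne_zero (hu p hpX).1 h0
    · obtain ⟨h1, h2, h3⟩ := hu x hx.1
      rw [h3] at hne
      rw [h2, h3, mul_div_mul_left _ _ h1, Function.comp_apply]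
      exact hgφ _ ⟨hf hx.1, hx.2⟩ (right_ne_zero_of_mul hne)

/-- A map given in the charts by quotients with the common denominator `w` pulls polynomials back to
polynomials after multiplication with a power of `w`, and these correspond to forms of equal degree.
-/
theorem AffineChart.isRegularMap {X : Set M} {Y : Set M'} {ν : M → σ → ℂ} {ν' : M' → σ' → ℂ}
    (hν : AffineChart X ν) (hν' : AffineChart Y ν') {f : M → M'} (hf : Set.MapsTo f X Y)
    {w : MvPolynomial σ ℂ} (hw : ∀ x ∈ X, w.eval (ν x) ≠ 0) {b : σ' → MvPolynomial σ ℂ}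
    (hb : ∀ x ∈ X, ∀ i, w.eval (ν x) * ν' (f x) i = (b i).eval (ν x)) : IsRegularMap f X Y := by
  refine isRegularMap_of_forms hf fun k φ hφ ψ hψ => ?_
  obtain ⟨u', hu', hform⟩ := hν'.ofForm k
  obtain ⟨a, ha⟩ := hform φ hφ
  obtain ⟨a', ha'⟩ := hform ψ hψ
  obtain ⟨N₁, h₁⟩ := exists_clear_denominators hb a
  obtain ⟨N₂, h₂⟩ := exists_clear_denominators hb a'
  obtain ⟨c, hc⟩ := h₁ (max N₁ N₂) (le_max_left _ _)
  obtain ⟨c', hc'⟩ := h₂ (max N₁ N₂) (le_max_right _ _)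
  obtain ⟨D, φ', hφ', ψ', hψ', u, hu⟩ := hν.toForm c c'
  refine ⟨D, φ', hφ', ψ', hψ', fun x => u x * w.eval (ν x) ^ max N₁ N₂ * (u' (f x))⁻¹,
    fun x hx => ?_⟩
  obtain ⟨h1, h2, h3⟩ := hu x hx
  have h4 := hu' _ (hf hx)
  refine ⟨mul_ne_zero (mul_ne_zero h1 (pow_ne_zero _ (hw x hx))) (inv_ne_zero h4), ?_, ?_⟩
  · rw [h2, hc x hx, ha _ (hf hx)]
    field_simp
  · rw [h3, hc' x hx, ha' _ (hf hx)]
    field_simp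

theorem AffineChart.isRegularFun {X : Set M} {ν : M → σ → ℂ} (hν : AffineChart X ν) {h : M → ℂ}
    {a w : MvPolynomial σ ℂ} (hw : ∀ x ∈ X, w.eval (ν x) ≠ 0)
    (hh : ∀ x ∈ X, h x = a.eval (ν x) / w.eval (ν x)) : IsRegularFun X h := by
  obtain ⟨D, φ, hφ, ψ, hψ, u, hu⟩ := hν.toForm a w
  intro p hp
  refine ⟨D, φ, hφ, ψ, hψ, ?_, fun x hx _ => ?_⟩
  · rw [(hu p hp).2.2]
    exact mul_ne_zero (hu p hp).1 (hw p hp)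
  · rw [(hu x hx).2.1, (hu x hx).2.2, mul_div_mul_left _ _ (hu x hx).1, hh x hx]

theorem AffineChart.isOpen {X : Set M} {ν : M → σ → ℂ} (hν : AffineChart X ν)
    (hX : IsOpen[zariski M] X) (a : MvPolynomial σ ℂ) :
    IsOpen[zariski M] {x | x ∈ X ∧ a.eval (ν x) ≠ 0} := by
  obtain ⟨D, φ, hφ, _, _, u, hu⟩ := hν.toForm a a
  convert @IsOpen.inter _ (zariski M) _ _ hX (isOpen_form_ne_zero hφ) using 1
  ext x
  refine and_congr_right fun hx => ?_
  rw [Set.mem_ofPred_eq, (hu x hx).2.1]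
  simp [(hu x hx).1]

theorem affineChart_affine (N : ℕ) (X : Set (Fin N → ℂ)) : AffineChart X (id : (Fin N → ℂ) → _) where
  toForm a a' := ⟨(), _, ⟨a, rfl⟩, _, ⟨a', rfl⟩, 1, fun x _ => by simp⟩
  ofForm k := ⟨1, fun _ _ => one_ne_zero, by
    rintro _ ⟨F, rfl⟩
    exact ⟨F, fun x _ => by simp⟩⟩

theorem exists_homogenization {m : ℕ} (j : Fin (m + 1)) (F : MvPolynomial (Fin (m + 1)) ℂ) :
    ∃ N₀ : ℕ, ∀ N ≥ N₀, ∃ G : MvPolynomial (Fin (m + 1)) ℂ, G.IsHomogeneous N ∧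
      ∀ x : Fin (m + 1) → ℂ, x j ≠ 0 →
        G.eval x = x j ^ N * F.eval fun i => x i / x j := by
  induction F using MvPolynomial.induction_on with
  | C a =>
    refine ⟨0, fun N _ => ⟨MvPolynomial.X j ^ N * MvPolynomial.C a, ?_, fun x _ => by simp⟩⟩
    simpa using ((MvPolynomial.isHomogeneous_X ℂ j).pow N).mul (MvPolynomial.isHomogeneous_C _ a)
  | add F G hF hG =>
    obtain ⟨N₁, h₁⟩ := hF
    obtain ⟨N₂, h₂⟩ := hG
    refine ⟨max N₁ N₂, fun N hN => ?_⟩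
    obtain ⟨F', hF', h⟩ := h₁ N (le_of_max_le_left hN)
    obtain ⟨G', hG', h'⟩ := h₂ N (le_of_max_le_right hN)
    exact ⟨F' + G', hF'.add hG', fun x hx => by
      rw [map_add, map_add, h x hx, h' x hx]; ring⟩
  | mul_X F i hF =>
    obtain ⟨N₁, h₁⟩ := hF
    refine ⟨N₁ + 1, fun N hN => ?_⟩
    obtain ⟨N', rfl⟩ : ∃ N', N = N' + 1 := ⟨N - 1, by omega⟩
    obtain ⟨F', hF', h⟩ := h₁ N' (by omega)
    refine ⟨F' * MvPolynomial.X i, hF'.mul (MvPolynomial.isHomogeneous_X ℂ i), fun x hx => ?_⟩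
    rw [map_mul, map_mul, h x hx, MvPolynomial.eval_X, MvPolynomial.eval_X,
      pow_succ]
    field_simp

theorem eval_rep_mem_form {m N : ℕ} {G : MvPolynomial (Fin (m + 1)) ℂ} (hG : G.IsHomogeneous N) :
    (fun p : PSpace m => G.eval p.rep) ∈ HasForms.form (M := PSpace m) (N : ℕ) :=
  ⟨G, hG, rfl⟩

theorem eval_rep_eq {m N : ℕ} {G : MvPolynomial (Fin (m + 1)) ℂ} (hG : G.IsHomogeneous N)
    {j : Fin (m + 1)} {p : PSpace m} (hp : p.rep j ≠ 0) :
    G.eval p.rep = p.rep j ^ N * G.eval fun i => p.rep i / p.rep j := by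
  rw [← eval_smul_of_isHomogeneous hG,
    show p.rep j • (fun i => p.rep i / p.rep j) = p.rep from funext fun i => mul_div_cancel₀ _ hp]

theorem affineChart_projective {m : ℕ} (j : Fin (m + 1)) :
    AffineChart {p : PSpace m | p.rep j ≠ 0} fun p i => p.rep i / p.rep j where
  toForm a a' := by
    obtain ⟨N₁, h₁⟩ := exists_homogenization j a
    obtain ⟨N₂, h₂⟩ := exists_homogenization j a'
    obtain ⟨G, hG, h⟩ := h₁ (max N₁ N₂) (le_max_left _ _)
    obtain ⟨G', hG', h'⟩ := h₂ (max N₁ N₂) (le_max_right _ _)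
    exact ⟨_, _, eval_rep_mem_form hG, _, eval_rep_mem_form hG', fun p => p.rep j ^ max N₁ N₂,
      fun p hp => ⟨pow_ne_zero _ hp, h _ hp, h' _ hp⟩⟩
  ofForm k := by
    refine ⟨fun p => p.rep j ^ (id k : ℕ), fun p hp => pow_ne_zero _ hp, ?_⟩
    rintro _ ⟨F, hF, rfl⟩
    exact ⟨F, fun p hp => eval_rep_eq hF hp⟩

theorem affineChart_biprojective {n m : ℕ} (ℓ : Fin (n + 1) → ℂ) (j : Fin (m + 1)) :
    AffineChart {p : PSpace n × PSpace m | lin ℓ p.1 ≠ 0 ∧ p.2.rep j ≠ 0} (normCrd ℓ j) where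
  toForm a a' := by
    obtain ⟨N₁, h₁⟩ := exists_bihomogenization ℓ j a
    obtain ⟨N₂, h₂⟩ := exists_bihomogenization ℓ j a'
    obtain ⟨G, hG, h⟩ := h₁ (max N₁ N₂) (le_max_left _ _)
    obtain ⟨G', hG', h'⟩ := h₂ (max N₁ N₂) (le_max_right _ _)
    exact ⟨_, _, evalAt_mem_form hG, _, evalAt_mem_form hG',
      fun p => (lin ℓ p.1 * p.2.rep j) ^ max N₁ N₂,
      fun p hp => ⟨pow_ne_zero _ (mul_ne_zero hp.1 hp.2), h _ hp.1 hp.2, h' _ hp.1 hp.2⟩⟩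
  ofForm k := by
    refine ⟨fun p => lin ℓ p.1 ^ (show ℕ × ℕ from k).1 * p.2.rep j ^ (show ℕ × ℕ from k).2,
      fun p hp => mul_ne_zero (pow_ne_zero _ hp.1) (pow_ne_zero _ hp.2), ?_⟩
    rintro _ ⟨F, hF, rfl⟩
    exact ⟨F, fun p hp => evalAt_eq_eval_normCrd hF hp.1 hp.2⟩

open Polynomial in
/-- A chart that is, by means of two of its functions, identified with a plane curve with
finitely many vertical lines removed is an affine variety. -/
theorem AffineChart.isAffineVariety {X : Set M} {ν : M → σ → ℂ} (hν : AffineChart X ν)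
    (hne : X.Nonempty) (hinj : Set.InjOn ν X) (D : ℂ[X]) (Q : ℂ[X][X]) (τ ζ : MvPolynomial σ ℂ)
    (hX : ∀ x ∈ X, D.eval (τ.eval (ν x)) ≠ 0 ∧ Q.evalEval (τ.eval (ν x)) (ζ.eval (ν x)) = 0)
    (hsurj : ∀ t z, D.eval t ≠ 0 → Q.evalEval t z = 0 →
      ∃ x ∈ X, τ.eval (ν x) = t ∧ ζ.eval (ν x) = z) (N : σ → ℂ[X][X]) (g : ℂ[X])
    (hg : ∀ t, D.eval t ≠ 0 → g.eval t ≠ 0)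
    (hN : ∀ x ∈ X, ∀ i, g.eval (τ.eval (ν x)) * ν x i =
      (N i).evalEval (τ.eval (ν x)) (ζ.eval (ν x))) : IsAffineVariety X := by
  classical
  -- The third coordinate is the inverse of `D`; it turns the removal of the vertical lines into a
  -- closed condition.
  let Z : Set (Fin 3 → ℂ) := {z | Q.evalEval (z 0) (z 1) = 0 ∧ z 2 * D.eval (z 0) = 1}
  let f : M → Fin 3 → ℂ := fun x =>
    ![τ.eval (ν x), ζ.eval (ν x), (D.eval (τ.eval (ν x)))⁻¹]
  have hfZ : Set.MapsTo f X Z := fun x hx =>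
    ⟨(hX x hx).2, inv_mul_cancel₀ (hX x hx).1⟩
  -- The inverse must be a function on all of `ℂ³`; off `Z` its value is an arbitrary point of `X`.
  have hchoose : ∀ z : Fin 3 → ℂ, ∃ x ∈ X, z ∈ Z → τ.eval (ν x) = z 0 ∧ ζ.eval (ν x) = z 1 :=
    fun z => by
      by_cases hz : z ∈ Z
      · obtain ⟨x, hx, h⟩ := hsurj (z 0) (z 1) (right_ne_zero_of_mul_eq_one hz.2) hz.1
        exact ⟨x, hx, fun _ => h⟩
      · exact ⟨hne.some, hne.some_mem, fun h => absurd h hz⟩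
  choose g' hg'X hg' using hchoose
  have hfg : ∀ z ∈ Z, f (g' z) = z := fun z hz => by
    obtain ⟨h0, h1⟩ := hg' z hz
    ext i
    fin_cases i
    · exact h0
    · exact h1
    · change (D.eval (τ.eval (ν (g' z))))⁻¹ = z 2
      rw [h0]
      exact (eq_inv_of_mul_eq_one_left hz.2).symm
  have hgf : ∀ x ∈ X, g' (f x) = x := fun x hx => by
    obtain ⟨h0, h1⟩ := hg' (f x) (hfZ hx)
    refine hinj (hg'X _) hx (funext fun i => ?_)
    have e1 := hN _ (hg'X (f x)) i
    have e2 := hN x hx i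
    rw [h0, h1] at e1
    exact mul_left_cancel₀ (hg _ (hX x hx).1) (e1.trans e2.symm)
  have hsub : ∀ (G : ℂ[X][X]) (z : Fin 3 → ℂ),
      (subst₂ (MvPolynomial.X 0) (MvPolynomial.X 1) G).eval z = G.evalEval (z 0) (z 1) :=
    fun G z => by rw [eval_subst₂, MvPolynomial.eval_X, MvPolynomial.eval_X]
  have hpol : ∀ (G : ℂ[X]) (z : Fin 3 → ℂ),
      (aeval (MvPolynomial.X 0 : MvPolynomial (Fin 3) ℂ) G).eval z = G.eval (z 0) :=
    fun G z => by rw [eval_aeval_poly, MvPolynomial.eval_X]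
  refine ⟨3, Z, ?_, f, g', ?_, ?_, hgf, hfg⟩
  · have h1 := isOpen_form_ne_zero (M := Fin 3 → ℂ) (d := ())
      ⟨subst₂ (MvPolynomial.X 0) (MvPolynomial.X 1) Q, rfl⟩
    have h2 := isOpen_form_ne_zero (M := Fin 3 → ℂ) (d := ())
      ⟨MvPolynomial.X 2 * aeval (MvPolynomial.X 0) D - 1, rfl⟩
    rw [← @isOpen_compl_iff _ _ (zariski _)]
    convert @IsOpen.union _ _ _ (zariski _) h1 h2 using 1
    ext z
    simp only [Z, Set.mem_compl_iff, Set.mem_ofPred_eq, Set.mem_union, hsub, map_sub, map_mul, hpol,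
      MvPolynomial.eval_X, map_one, sub_ne_zero]
    tauto
  · refine hν.isRegularMap (affineChart_affine 3 Z) hfZ (w := aeval τ D)
      (b := ![τ * aeval τ D, ζ * aeval τ D, 1]) (fun x hx => ?_) fun x hx i => ?_
    · rw [eval_aeval_poly]
      exact (hX x hx).1
    · rw [eval_aeval_poly]
      fin_cases i
      · simp [f, eval_aeval_poly, mul_comm]
      · simp [f, eval_aeval_poly, mul_comm]
      · simp [f, (hX x hx).1]
  · refine (affineChart_affine 3 Z).isRegularMap hν (fun z _ => hg'X z)
      (w := aeval (MvPolynomial.X 0) g)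
      (b := fun i => subst₂ (MvPolynomial.X 0) (MvPolynomial.X 1) (N i)) (fun z hz => ?_)
      fun z hz i => ?_
    · rw [hpol]
      exact hg _ (right_ne_zero_of_mul_eq_one hz.2)
    · obtain ⟨h0, h1⟩ := hg' z hz
      have := hN _ (hg'X z) i
      rw [h0, h1] at this
      rw [hpol, hsub]
      exact this

end AffineCharts

end Decomposable
end

noncomputable section

namespace Decomposable

/-! ### The decomposition given by a tame function -/

section OfTame

open Polynomial Filter

variable {n : ℕ} {C : Set (PSpace n × PSpace 1)} {d : ℕ} {K : SepChart C d}
  {e : PSpace n × PSpace 1 → ℂ}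

/-- When source and target are affine, the cover can consist of a single open set. -/
theorem isFiniteMorphism_of_affine {M M' : Type} [HasForms M] [HasForms M'] {f : M → M'}
    {X : Set M} {Y : Set M'} (hf : IsRegularMap f X Y) (hX : IsAffineVariety X)
    (hY : IsAffineVariety Y)
    (hint : ∀ h : M → ℂ, IsRegularFun X h → ∃ (k : ℕ) (c : Fin k → M' → ℂ),
      (∀ i, IsRegularFun Y (c i)) ∧
        ∀ x ∈ X, h x ^ k + ∑ i : Fin k, c i (f x) * h x ^ (i : ℕ) = 0) :
    IsFiniteMorphism f X Y := by
  refine ⟨hf, fun y _ => ⟨Set.univ, @isOpen_univ _ (zariski M'), trivial, ?_⟩⟩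
  simp only [Set.inter_univ, Set.preimage_univ]
  exact ⟨hY, hX, hint⟩

/-- A polynomial whose zeros are the values of the coordinate that the chart leaves out. -/
def SepChart.D (K : SepChart C d) : ℂ[X] := ∏ f ∈ K.finite.toFinset, (X - Polynomial.C f)

theorem SepChart.eval_D_ne_zero {t : ℂ} : K.D.eval t ≠ 0 ↔ t ∉ K.F := by
  simp only [D, eval_prod, eval_sub, eval_X, eval_C, Finset.prod_ne_zero_iff, sub_ne_zero,
    Set.Finite.mem_toFinset]
  exact ⟨fun h ht => h t ht rfl, fun h f hf hft => h (hft ▸ hf)⟩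

/-- The part of the curve over the base of the chart. -/
def SepChart.dom (K : SepChart C d) : Set (PSpace n × PSpace 1) := C ∩ Prod.snd ⁻¹' K.base

theorem SepChart.mem_dom {y : PSpace n × PSpace 1} :
    y ∈ K.dom ↔ ∃ c ∉ K.F, y ∈ fiber C (affPt K.j c) := by
  constructor
  · rintro ⟨hy, c, hc, h⟩
    exact ⟨c, hc, hy, h.symm⟩
  · rintro ⟨c, hc, hy, h⟩
    exact ⟨hy, c, hc, h.symm⟩

theorem SepChart.affineChart_dom (K : SepChart C d) : AffineChart K.dom (normCrd K.ℓ₀ K.j) :=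
  (affineChart_biprojective K.ℓ₀ K.j).mono fun y hy => by
    obtain ⟨c, hc, hy⟩ := mem_dom.mp hy
    exact (K.mem_chart hc hy).2

theorem SepChart.nonempty_dom (K : SepChart C d) (hC : IsCover C d) : K.dom.Nonempty := by
  obtain ⟨c, hc, -⟩ := K.exists_notMem Set.finite_empty
  obtain ⟨y, hy⟩ := K.nonempty_fiber hC hc
  exact ⟨y, mem_dom.mpr ⟨c, hc, hy⟩⟩

/-- Finitely many tame functions have a common denominator. -/
theorem SepChart.Tame.exists_common {ι : Type} [Fintype ι] (hC : IsCover C d)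
    {e : ι → PSpace n × PSpace 1 → ℂ} (he : ∀ i, K.Tame (e i)) :
    ∃ (N : ι → ℂ[X][X]) (g : ℂ[X]), (∀ c ∉ K.F, g.eval c ≠ 0) ∧ ∀ c ∉ K.F,
      ∀ y ∈ fiber C (affPt K.j c), ∀ i, g.eval c * e i y = (N i).evalEval c (K.fn y) := by
  classical
  choose N g hg hN using fun i => (he i).exists_eq hC
  refine ⟨fun i => Polynomial.C (∏ k ∈ Finset.univ.erase i, g k) * N i, ∏ i, g i, fun c hc => ?_,
    fun c hc y hy i => ?_⟩
  · rw [eval_prod]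
    exact Finset.prod_ne_zero_iff.mpr fun i _ => hg i c hc
  · rw [evalEval_mul, evalEval_C, ← hN i c hc y hy, ← Finset.prod_erase_mul _ _ (Finset.mem_univ i),
      eval_mul, mul_assoc]

/-- The coordinate and the separating function map this set bijectively to the curve `Q = 0` off the
removed lines. The inverse is regular because the normalized coordinates are tame, hence rational in
these two functions. -/
theorem SepChart.isAffineVariety_dom (K : SepChart C d) (hC : IsCover C d) :
    IsAffineVariety K.dom := by
  have hcrd : ∀ i, K.Tame fun y => normCrd K.ℓ₀ K.j y i := fun i =>
    (Tame.eval_normCrd K hC (MvPolynomial.X i)).congr fun _ _ _ _ => by rw [MvPolynomial.eval_X]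
  obtain ⟨N, g, hg, hN⟩ := Tame.exists_common hC hcrd
  have hτ : ∀ {c : ℂ} {y : PSpace n × PSpace 1}, y ∈ fiber C (affPt K.j c) →
      (MvPolynomial.X (Sum.inr (1 - K.j)) : MvPolynomial (Fin (n + 1) ⊕ Fin 2) ℂ).eval
        (normCrd K.ℓ₀ K.j y) = c := fun {c y} hy => by
    rw [eval_normCrd_X_inr, show y.2 = affPt K.j c from hy.2, affCrd_affPt]
  refine K.affineChart_dom.isAffineVariety (K.nonempty_dom hC) ?_ K.D K.Q
    (MvPolynomial.X (Sum.inr (1 - K.j))) (linPoly K.ℓ₁) (fun y hy => ?_) (fun t z ht hz => ?_) N g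
    (fun t ht => hg t (eval_D_ne_zero.mp ht)) fun y hy i => ?_
  · refine (normCrd_injOn K.ℓ₀ K.j).mono fun y hy => ?_
    obtain ⟨c, hc, hy⟩ := mem_dom.mp hy
    exact (K.mem_chart hc hy).2
  · obtain ⟨c, hc, hy⟩ := mem_dom.mp hy
    rw [hτ hy, eval_normCrd_linPoly]
    exact ⟨eval_D_ne_zero.mpr hc, K.evalEval_eq_zero hc hy⟩
  · have hc := eval_D_ne_zero.mp ht
    rw [K.evalEval_eq_prod hc, mul_eq_zero, or_iff_right (K.leadingCoeff t hc),
      Finset.prod_eq_zero_iff] at hz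
    obtain ⟨y, hy, h⟩ := hz
    rw [mem_fib (K.finite_fiber hc)] at hy
    refine ⟨y, mem_dom.mpr ⟨t, hc, hy⟩, hτ hy, ?_⟩
    rw [eval_normCrd_linPoly]
    exact (sub_eq_zero.mp h).symm
  · obtain ⟨c, hc, hy⟩ := mem_dom.mp hy
    rw [hτ hy, eval_normCrd_linPoly]
    exact hN c hc y hy i

/-- The base is presented as the line `z = 0` in the plane, with the values in `F` removed, so that
the criterion for plane curves applies. -/
theorem SepChart.isAffineVariety_base (K : SepChart C d) : IsAffineVariety K.base := by
  have hsub : K.base ⊆ {p | p.rep K.j ≠ 0} := by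
    rintro _ ⟨c, -, rfl⟩
    exact affPt_rep_ne_zero _ _
  have hτ : ∀ c, (MvPolynomial.X (1 - K.j) : MvPolynomial (Fin 2) ℂ).eval
      (fun i => (affPt K.j c).rep i / (affPt K.j c).rep K.j) = c := fun c => by
    rw [MvPolynomial.eval_X]
    exact affCrd_affPt K.j c
  refine ((affineChart_projective K.j).mono hsub).isAffineVariety ?_ ?_ K.D X
    (MvPolynomial.X (1 - K.j)) 0 ?_ (fun t z ht hz => ?_)
    (fun i => if i = K.j then 1 else Polynomial.C X) 1 (fun t _ => by simp) ?_
  · obtain ⟨c, hc, -⟩ := K.exists_notMem Set.finite_empty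
    exact ⟨_, c, hc, rfl⟩
  · rintro _ ⟨c, hc, rfl⟩ _ ⟨c', hc', rfl⟩ h
    have := congrFun h (1 - K.j)
    have e1 : affCrd K.j (affPt K.j c) = affCrd K.j (affPt K.j c') := this
    rw [affCrd_affPt, affCrd_affPt] at e1
    rw [e1]
  · rintro _ ⟨c, hc, rfl⟩
    rw [hτ]
    exact ⟨eval_D_ne_zero.mpr hc, by simp [evalEval]⟩
  · refine ⟨affPt K.j t, ⟨t, eval_D_ne_zero.mp ht, rfl⟩, hτ t, ?_⟩
    simpa [evalEval, eq_comm] using hz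
  · rintro _ ⟨c, hc, rfl⟩ i
    rw [hτ]
    by_cases hi : i = K.j
    · subst hi
      simp [affPt_rep_ne_zero, evalEval]
    · obtain rfl : i = 1 - K.j := by
        revert hi; generalize K.j = j; fin_cases i <;> fin_cases j <;> simp
      have : (affPt K.j c).rep (1 - K.j) / (affPt K.j c).rep K.j = c := affCrd_affPt K.j c
      simp [hi, this, evalEval]

/-- On each fiber `e` is a root of its characteristic polynomial, which is monic of degree `d` after
division by `g`. -/
theorem SepChart.Tame.exists_integral (hC : IsCover C d) (he : K.Tame e) :
    ∃ (A : Fin d → ℂ[X]) (g : ℂ[X]), (∀ c ∉ K.F, g.eval c ≠ 0) ∧ ∀ c ∉ K.F,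
      ∀ y ∈ fiber C (affPt K.j c),
        e y ^ d + ∑ i : Fin d, (A i).eval c / g.eval c * e y ^ (i : ℕ) = 0 := by
  obtain ⟨H, g, hg, hH⟩ := he.exists_charpoly hC
  refine ⟨fun i => H.coeff i, g, hg, fun c hc y hy => ?_⟩
  set P := ∏ y ∈ fib C (affPt K.j c), (X - Polynomial.C (e y)) with hP
  have hdeg : P.natDegree = d := by
    rw [hP, natDegree_prod_of_monic _ _ fun y _ => monic_X_sub_C _]
    simp [card_fib (K.encard c hc)]
  have hmonic : P.Monic := monic_prod_of_monic _ _ fun y _ => monic_X_sub_C _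
  have hcoeff : ∀ i, (H.coeff i).eval c / g.eval c = P.coeff i := fun i => by
    have := congrArg (fun p => p.coeff i) (hH c hc)
    simp only [coeff_map, coeff_C_mul, coe_evalRingHom] at this
    rw [this, mul_div_cancel_left₀ _ (hg c hc)]
  have hroot : P.eval (e y) = 0 := by
    rw [hP, eval_prod]
    exact Finset.prod_eq_zero ((mem_fib (K.finite_fiber hc)).mpr hy) (by simp)
  rw [eval_eq_sum_range, Finset.sum_range_succ, hmonic.coeff_natDegree, hdeg, one_mul,
    Finset.sum_range] at hroot
  simp only [hcoeff]
  rw [add_comm]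
  exact hroot

/-- The point `[1 : t : w]` of the projective plane. -/
def planePt (t w : ℂ) : PSpace 2 :=
  Projectivization.mk' ℂ ⟨![1, t, w], fun h => one_ne_zero (congrFun h 0)⟩

/-- The affine coordinates of a point of the projective plane. -/
def planeCrd (v : PSpace 2) (i : Fin 3) : ℂ := v.rep i / v.rep 0

theorem planePt_rep (t w : ℂ) : (planePt t w).rep 0 ≠ 0 ∧ planeCrd (planePt t w) = ![1, t, w] := by
  obtain ⟨a, ha, h⟩ := exists_rep_mk' (n := 2) ⟨![1, t, w], fun h => one_ne_zero (congrFun h 0)⟩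
  have h' : (planePt t w).rep = a • ![1, t, w] := h
  refine ⟨by simp [h', ha], funext fun i => ?_⟩
  rw [planeCrd, h']
  fin_cases i <;> simp [ha]

theorem planeCrd_injOn : Set.InjOn planeCrd {v | v.rep 0 ≠ 0} := by
  intro v hv v' hv' h
  refine eq_of_rep_div_lin (Pi.single 0 1) (by rwa [lin_single]) (by rwa [lin_single]) fun i => ?_
  rw [lin_single, lin_single]
  exact congrFun h i

end OfTame

end Decomposable
end

noncomputable section

namespace Decomposable

/-! ### The plane curve defined by a tame function and its morphisms -/

section OfTame

open Polynomial Filter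

variable {n : ℕ} {C : Set (PSpace n × PSpace 1)} {d : ℕ} {K : SepChart C d}
  {e : PSpace n × PSpace 1 → ℂ}

/-- The map to the plane given by the coordinate and a function. -/
def SepChart.toPlane (K : SepChart C d) (e : PSpace n × PSpace 1 → ℂ) (y : PSpace n × PSpace 1) :
    PSpace 2 := planePt (affCrd K.j y.2) (e y)

/-- The projection of the plane to the coordinate. -/
def SepChart.fromPlane (K : SepChart C d) (v : PSpace 2) : PSpace 1 := affPt K.j (planeCrd v 1)

theorem SepChart.planeCrd_toPlane {c : ℂ} {y : PSpace n × PSpace 1}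
    (hy : y ∈ fiber C (affPt K.j c)) : planeCrd (K.toPlane e y) = ![1, c, e y] := by
  rw [toPlane, (planePt_rep _ _).2, show y.2 = affPt K.j c from hy.2, affCrd_affPt]

theorem SepChart.toPlane_eq_iff {c : ℂ} {y y' : PSpace n × PSpace 1}
    (hy : y ∈ fiber C (affPt K.j c)) (hy' : y' ∈ fiber C (affPt K.j c)) :
    K.toPlane e y = K.toPlane e y' ↔ e y = e y' := by
  constructor
  · intro h
    have := congrArg (fun v => planeCrd v 2) h
    simpa [planeCrd_toPlane hy, planeCrd_toPlane hy'] using this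
  · intro h
    rw [toPlane, toPlane, h, fiber_snd_eq hy hy']

theorem SepChart.fromPlane_toPlane {c : ℂ} {y : PSpace n × PSpace 1}
    (hy : y ∈ fiber C (affPt K.j c)) : K.fromPlane (K.toPlane e y) = affPt K.j c := by
  rw [fromPlane, planeCrd_toPlane hy]
  rfl

theorem affineChart_plane : AffineChart {v : PSpace 2 | v.rep 0 ≠ 0} planeCrd :=
  affineChart_projective 0

theorem SepChart.toPlane_image_subset :
    K.toPlane e '' K.dom ⊆ {v : PSpace 2 | v.rep 0 ≠ 0} := by
  rintro _ ⟨y, -, rfl⟩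
  exact (planePt_rep _ _).1

/-- The characteristic polynomial of `e` vanishes at `(c, z)` exactly when `z` is a value of `e` on
the fiber over `c`. -/
theorem SepChart.Tame.exists_equation (hC : IsCover C d) (he : K.Tame e) :
    ∃ H : ℂ[X][X], ∀ v : PSpace 2, v ∈ K.toPlane e '' K.dom ↔
      v.rep 0 ≠ 0 ∧ planeCrd v 1 ∉ K.F ∧ H.evalEval (planeCrd v 1) (planeCrd v 2) = 0 := by
  obtain ⟨H, g, hg, hH⟩ := he.exists_charpoly hC
  have hzero : ∀ c ∉ K.F, ∀ z, H.evalEval c z = 0 ↔ ∃ y ∈ fiber C (affPt K.j c), e y = z :=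
    fun c hc z => by
      rw [evalEval_eq_of_map (hH c hc), mul_eq_zero, or_iff_right (hg c hc), eval_prod,
        Finset.prod_eq_zero_iff]
      simp only [mem_fib (K.finite_fiber hc), eval_sub, eval_X, eval_C, sub_eq_zero,
        eq_comm (a := z)]
  refine ⟨H, fun v => ⟨?_, ?_⟩⟩
  · rintro ⟨y, hy, rfl⟩
    obtain ⟨c, hc, hy⟩ := mem_dom.mp hy
    refine ⟨(planePt_rep _ _).1, ?_⟩
    rw [planeCrd_toPlane hy]
    exact ⟨hc, (hzero c hc _).mpr ⟨y, hy, rfl⟩⟩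
  · rintro ⟨h0, hc, hz⟩
    obtain ⟨y, hy, hyz⟩ := (hzero _ hc _).mp hz
    refine ⟨y, mem_dom.mpr ⟨_, hc, hy⟩, planeCrd_injOn (planePt_rep _ _).1 h0 ?_⟩
    change planeCrd (K.toPlane e y) = _
    rw [planeCrd_toPlane hy]
    funext i
    fin_cases i
    · exact (div_self h0).symm
    · rfl
    · exact hyz

theorem SepChart.isAffineVariety_plane (hC : IsCover C d) (he : K.Tame e) :
    IsAffineVariety (K.toPlane e '' K.dom) := by
  obtain ⟨H, hH⟩ := he.exists_equation hC
  refine (affineChart_plane.mono toPlane_image_subset).isAffineVariety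
    ((K.nonempty_dom hC).image _) (planeCrd_injOn.mono toPlane_image_subset) K.D H
    (MvPolynomial.X 1) (MvPolynomial.X 2) (fun v hv => ?_) (fun t z ht hz => ?_)
    ![1, Polynomial.C X, X] 1 (fun t _ => by simp) fun v hv i => ?_
  · rw [MvPolynomial.eval_X, MvPolynomial.eval_X, eval_D_ne_zero]
    exact ((hH v).mp hv).2
  · refine ⟨planePt t z, (hH _).mpr ⟨(planePt_rep _ _).1, ?_⟩, ?_⟩
    · rw [(planePt_rep _ _).2]
      exact ⟨eval_D_ne_zero.mp ht, hz⟩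
    · rw [(planePt_rep _ _).2]
      simp
  · have h0 : planeCrd v 0 = 1 := div_self (toPlane_image_subset hv)
    fin_cases i <;> simp [evalEval, h0]

theorem isLocallyClosed_sdiff {M : Type*} [TopologicalSpace M] {O O' : Set M} (hO : IsOpen O)
    (hO' : IsOpen O') : IsLocallyClosed (O \ O') :=
  hO.isLocallyClosed.inter hO'.isClosed_compl.isLocallyClosed

theorem SepChart.isLocallyClosed_plane (hC : IsCover C d) (he : K.Tame e) :
    @IsLocallyClosed _ (zariski (PSpace 2)) (K.toPlane e '' K.dom) := by
  obtain ⟨H, hH⟩ := he.exists_equation hC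
  have hopen : IsOpen[zariski (PSpace 2)] {v : PSpace 2 | v.rep 0 ≠ 0} := by
    have := isOpen_form_ne_zero (eval_rep_mem_form (MvPolynomial.isHomogeneous_X ℂ (0 : Fin 3)))
    simpa only [MvPolynomial.eval_X] using this
  have h1 := affineChart_plane.isOpen hopen (aeval (MvPolynomial.X 1) K.D)
  have h2 := affineChart_plane.isOpen hopen (subst₂ (MvPolynomial.X 1) (MvPolynomial.X 2) H)
  convert @isLocallyClosed_sdiff _ (zariski _) _ _ h1 h2 using 1
  ext v
  rw [hH v]
  simp only [Set.mem_sdiff, Set.mem_ofPred_eq, eval_aeval_poly, eval_subst₂, MvPolynomial.eval_X,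
    eval_D_ne_zero]
  tauto

theorem isOpen_base (K : SepChart C d) : IsOpen[zariski (PSpace 1)] K.base := by
  have hopen : IsOpen[zariski (PSpace 1)] {v : PSpace 1 | v.rep K.j ≠ 0} := by
    have := isOpen_form_ne_zero (eval_rep_mem_form (MvPolynomial.isHomogeneous_X ℂ (K.j : Fin 2)))
    simpa only [MvPolynomial.eval_X] using this
  convert (affineChart_projective K.j).isOpen hopen (aeval (MvPolynomial.X (1 - K.j)) K.D) using 1
  ext p
  simp only [Set.mem_ofPred_eq, eval_aeval_poly, MvPolynomial.eval_X, SepChart.eval_D_ne_zero]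
  constructor
  · rintro ⟨c, hc, rfl⟩
    refine ⟨affPt_rep_ne_zero _ _, ?_⟩
    change affCrd K.j (affPt K.j c) ∉ K.F
    rwa [affCrd_affPt]
  · rintro ⟨h, hc⟩
    exact ⟨_, hc, affPt_affCrd h⟩

theorem SepChart.isIrreducible_dom (K : SepChart C d) (hC : IsCover C d) :
    @IsIrreducible _ (zariski (PSpace n × PSpace 1)) K.dom := by
  refine ⟨K.nonempty_dom hC, fun u v hu hv hdu hdv => ?_⟩
  have hO := isOpen_snd_notMem (n := n) K.finite_compl_base
  have hdom : ∀ y, y ∈ K.dom ↔ y ∈ C ∧ y.2 ∉ K.baseᶜ := fun y => by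
    simp [dom]
  obtain ⟨y, hy, hyu⟩ := hdu
  obtain ⟨z, hz, hzv⟩ := hdv
  obtain ⟨x, hx, hxu, hxv⟩ := hC.irreducible.2 _ _ (@IsOpen.inter _ (zariski _) _ _ hu hO)
    (@IsOpen.inter _ (zariski _) _ _ hv hO) ⟨y, hy.1, hyu, ((hdom y).mp hy).2⟩
    ⟨z, hz.1, hzv, ((hdom z).mp hz).2⟩
  exact ⟨x, (hdom x).mpr ⟨hx, hxu.2⟩, hxu.1, hxv.1⟩

/-- By `SepChart.Tame.exists_eq`, `e` is a polynomial in the coordinate and the separating function,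
divided by a polynomial in the coordinate without zeros over the base. -/
theorem SepChart.isRegularMap_toPlane (hC : IsCover C d) (he : K.Tame e) :
    IsRegularMap (K.toPlane e) K.dom (K.toPlane e '' K.dom) := by
  obtain ⟨N, g, hg, hN⟩ := he.exists_eq hC
  have hτ : ∀ {c : ℂ} {y : PSpace n × PSpace 1}, y ∈ fiber C (affPt K.j c) →
      (MvPolynomial.X (Sum.inr (1 - K.j)) : MvPolynomial (Fin (n + 1) ⊕ Fin 2) ℂ).eval
        (normCrd K.ℓ₀ K.j y) = c := fun {c y} hy => by
    rw [eval_normCrd_X_inr, show y.2 = affPt K.j c from hy.2, affCrd_affPt]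
  let T : MvPolynomial (Fin (n + 1) ⊕ Fin 2) ℂ := MvPolynomial.X (Sum.inr (1 - K.j))
  refine K.affineChart_dom.isRegularMap (affineChart_plane.mono toPlane_image_subset)
    (Set.mapsTo_image _ _) (w := aeval T g) (b := ![aeval T g, aeval T g * T,
      subst₂ T (linPoly K.ℓ₁) N]) (fun y hy => ?_) fun y hy i => ?_
  · obtain ⟨c, hc, hy⟩ := mem_dom.mp hy
    rw [eval_aeval_poly, hτ hy]
    exact hg c hc
  · obtain ⟨c, hc, hy⟩ := mem_dom.mp hy
    rw [eval_aeval_poly, hτ hy, planeCrd_toPlane hy]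
    fin_cases i
    · simp [eval_aeval_poly, T, hτ hy]
    · simp [eval_aeval_poly, T, hτ hy]
    · change g.eval c * e y = (subst₂ T (linPoly K.ℓ₁) N).eval (normCrd K.ℓ₀ K.j y)
      rw [eval_subst₂, hτ hy, eval_normCrd_linPoly]
      exact hN c hc y hy

theorem SepChart.affineChart_base (K : SepChart C d) :
    AffineChart K.base fun p i => p.rep i / p.rep K.j :=
  (affineChart_projective K.j).mono (by
    rintro _ ⟨c, -, rfl⟩
    exact affPt_rep_ne_zero _ _)

theorem SepChart.isRegularMap_fromPlane :
    IsRegularMap K.fromPlane (K.toPlane e '' K.dom) K.base := by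
  refine (affineChart_plane.mono toPlane_image_subset).isRegularMap K.affineChart_base ?_ (w := 1)
    (b := fun i => if i = K.j then 1 else MvPolynomial.X 1) (fun v _ => by simp) fun v hv i => ?_
  · rintro _ ⟨y, hy, rfl⟩
    obtain ⟨c, hc, hy⟩ := mem_dom.mp hy
    rw [fromPlane_toPlane hy]
    exact ⟨c, hc, rfl⟩
  · by_cases hi : i = K.j
    · subst hi
      simp [fromPlane, affPt_rep_ne_zero]
    · obtain rfl : i = 1 - K.j := by
        revert hi; generalize K.j = j; fin_cases i <;> fin_cases j <;> simp
      have := affCrd_affPt K.j (planeCrd v 1)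
      rw [affCrd] at this
      simp [hi, fromPlane, this]

/-- Regular functions on the source are tame, so they satisfy their characteristic polynomials. The
coefficients depend only on the coordinate and are therefore regular on the image. -/
theorem SepChart.isFiniteMorphism_toPlane (hC : IsCover C d) (he : K.Tame e) :
    IsFiniteMorphism (K.toPlane e) K.dom (K.toPlane e '' K.dom) := by
  refine isFiniteMorphism_of_affine (isRegularMap_toPlane hC he) (K.isAffineVariety_dom hC)
    (isAffineVariety_plane hC he) fun h hh => ?_
  obtain ⟨A, g, hg, hA⟩ := (Tame.of_isRegularFun hC hh).exists_integral hC
  refine ⟨d, fun i v => (A i).eval (planeCrd v 1) / g.eval (planeCrd v 1), fun i => ?_,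
    fun y hy => ?_⟩
  · refine (affineChart_plane.mono toPlane_image_subset).isRegularFun
      (a := aeval (MvPolynomial.X 1) (A i)) (w := aeval (MvPolynomial.X 1) g) ?_ fun v _ => by
        rw [eval_aeval_poly, eval_aeval_poly, MvPolynomial.eval_X]
    rintro _ ⟨y, hy, rfl⟩
    obtain ⟨c, hc, hy⟩ := mem_dom.mp hy
    rw [eval_aeval_poly, MvPolynomial.eval_X, planeCrd_toPlane hy]
    exact hg c hc
  · obtain ⟨c, hc, hy⟩ := mem_dom.mp hy
    simp only [planeCrd_toPlane hy]
    exact hA c hc y hy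

/-- A regular function on the image is pulled back to the curve, where it is tame; its integral
equation has coefficients on the base and descends because the image is covered. -/
theorem SepChart.isFiniteMorphism_fromPlane (hC : IsCover C d) (he : K.Tame e) :
    IsFiniteMorphism K.fromPlane (K.toPlane e '' K.dom) K.base := by
  refine isFiniteMorphism_of_affine isRegularMap_fromPlane (isAffineVariety_plane hC he)
    K.isAffineVariety_base fun h hh => ?_
  have hreg : IsRegularFun (C ∩ Prod.snd ⁻¹' K.base) (h ∘ K.toPlane e) := by
    have := (isRegularMap_toPlane hC he).pullback Set.univ (@isOpen_univ _ (zariski _)) h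
      (by rwa [Set.inter_univ])
    rwa [Set.preimage_univ, Set.inter_univ] at this
  obtain ⟨A, g, hg, hA⟩ := (Tame.of_isRegularFun hC hreg).exists_integral hC
  refine ⟨d, fun i p => (A i).eval (affCrd K.j p) / g.eval (affCrd K.j p), fun i => ?_, ?_⟩
  · refine K.affineChart_base.isRegularFun (a := aeval (MvPolynomial.X (1 - K.j)) (A i))
      (w := aeval (MvPolynomial.X (1 - K.j)) g) ?_ fun p _ => by
        rw [eval_aeval_poly, eval_aeval_poly, MvPolynomial.eval_X]
        rfl
    rintro _ ⟨c, hc, rfl⟩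
    rw [eval_aeval_poly, MvPolynomial.eval_X]
    change g.eval (affCrd K.j (affPt K.j c)) ≠ 0
    rw [affCrd_affPt]
    exact hg c hc
  · rintro _ ⟨y, hy, rfl⟩
    obtain ⟨c, hc, hy⟩ := mem_dom.mp hy
    simp only [fromPlane_toPlane hy, affCrd_affPt]
    exact hA c hc y hy

/-- The level sets of `e` partition a fiber of `d = a * b` points into parts of size `a`, one for
each image point. -/
theorem SepChart.encard_fromPlane {a b : ℕ} (ha : 0 < a) (hd : d = a * b)
    (hcard : ∀ c ∉ K.F, ∀ y ∈ fiber C (affPt K.j c),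
      {y' ∈ fiber C (affPt K.j c) | e y' = e y}.encard = a) {c : ℂ} (hc : c ∉ K.F) :
    (K.toPlane e '' K.dom ∩ K.fromPlane ⁻¹' {affPt K.j c}).encard = b := by
  classical
  have hset : K.toPlane e '' K.dom ∩ K.fromPlane ⁻¹' {affPt K.j c} =
      ((fib C (affPt K.j c)).image (K.toPlane e) : Finset (PSpace 2)) := by
    rw [Finset.coe_image, coe_fib (K.finite_fiber hc)]
    ext v
    constructor
    · rintro ⟨⟨y, hy, rfl⟩, h⟩
      obtain ⟨c', hc', hy⟩ := mem_dom.mp hy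
      rw [Set.mem_preimage, fromPlane_toPlane hy, Set.mem_singleton_iff] at h
      exact ⟨y, h ▸ hy, rfl⟩
    · rintro ⟨y, hy, rfl⟩
      exact ⟨⟨y, mem_dom.mpr ⟨c, hc, hy⟩, rfl⟩, fromPlane_toPlane hy⟩
  rw [hset, Set.encard_coe_eq_coe_finsetCard]
  have hsum := Finset.card_eq_sum_card_image (K.toPlane e) (fib C (affPt K.j c))
  have hfib : ∀ v ∈ (fib C (affPt K.j c)).image (K.toPlane e),
      ((fib C (affPt K.j c)).filter fun y => K.toPlane e y = v).card = a := by
    intro v hv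
    obtain ⟨y, hy, rfl⟩ := Finset.mem_image.mp hv
    rw [mem_fib (K.finite_fiber hc)] at hy
    have := hcard c hc y hy
    rw [← Nat.cast_inj (R := ℕ∞), ← Set.encard_coe_eq_coe_finsetCard, ← this]
    congr 1
    ext y'
    simp only [Finset.coe_filter, mem_fib (K.finite_fiber hc), Set.mem_ofPred_eq]
    exact and_congr_right fun hy' => toPlane_eq_iff hy' hy
  rw [Finset.sum_congr rfl hfib, card_fib (K.encard c hc), Finset.sum_const, smul_eq_mul]
    at hsum
  rw [Nat.eq_of_mul_eq_mul_right ha (hsum.symm.trans (hd.trans (mul_comm a b)))]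

/-- A tame function with fibers of constant size gives a decomposition of the projection. -/
theorem SepChart.exists_decomposition (hC : IsCover C d) (he : K.Tame e) {a b : ℕ} (ha : 0 < a)
    (hb : 0 < b) (hd : d = a * b) (hcard : ∀ c ∉ K.F, ∀ y ∈ fiber C (affPt K.j c),
      {y' ∈ fiber C (affPt K.j c) | e y' = e y}.encard = a) {c₀ : ℂ} (hc₀ : c₀ ∉ K.F) :
    ∃ D : Decomposition C, D.IsGeneral (affPt K.j c₀) ∧ D.degα = a ∧ D.degβ = b ∧
      ∀ x x' : fiber C (affPt K.j c₀), D.α x = D.α x' ↔ e x = e x' := by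
  refine ⟨{
    U := K.base
    U_open := isOpen_base K
    U_nonempty := ⟨_, mem_base.mpr hc₀⟩
    m := 2
    V := K.toPlane e '' K.dom
    V_locallyClosed := isLocallyClosed_plane hC he
    V_irreducible := @IsIrreducible.image _ _ (zariski _) (zariski _) _ (K.isIrreducible_dom hC) _
      (isRegularMap_toPlane hC he).continuousOn
    α := K.toPlane e
    β := K.fromPlane
    α_finite := isFiniteMorphism_toPlane hC he
    β_finite := isFiniteMorphism_fromPlane hC he
    comp_eq := fun y hy => by
      obtain ⟨c, hc, hy⟩ := mem_dom.mp hy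
      rw [fromPlane_toPlane hy]
      exact hy.2.symm
    degα := a
    degβ := b
    degα_pos := ha
    degβ_pos := hb
    -- By `hcard` the degrees are attained over every point, so nothing has to be removed.
    degα_spec := ⟨Set.univ, @isOpen_univ _ (zariski _),
      by rw [Set.inter_univ]; exact (K.nonempty_dom hC).image _, ?_⟩
    degβ_spec := ⟨Set.univ, @isOpen_univ _ (zariski _), ⟨_, mem_base.mpr hc₀, trivial⟩, ?_⟩ },
    ⟨mem_base.mpr hc₀, encard_fromPlane ha hd hcard hc₀⟩, rfl, rfl,
    fun x x' => toPlane_eq_iff x.2 x'.2⟩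
  · rintro _ ⟨⟨y, hy, rfl⟩, -⟩
    obtain ⟨c, hc, hy⟩ := mem_dom.mp hy
    rw [← hcard c hc y hy]
    congr 1
    ext y'
    constructor
    · rintro ⟨hy', h⟩
      obtain ⟨c', hc', hy'⟩ := mem_dom.mp hy'
      have h1 := congrArg K.fromPlane h
      rw [fromPlane_toPlane hy', fromPlane_toPlane hy] at h1
      rw [h1] at hy'
      exact ⟨hy', (toPlane_eq_iff hy' hy).mp h⟩
    · rintro ⟨hy', h⟩
      exact ⟨mem_dom.mpr ⟨c, hc, hy'⟩, (toPlane_eq_iff hy' hy).mpr h⟩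
  · rintro _ ⟨⟨c, hc, rfl⟩, -⟩
    exact encard_fromPlane ha hd hcard hc

end OfTame

end Decomposable
end

noncomputable section

namespace Decomposable

/-! ### Invariant equivalence relations on a fiber give decompositions -/

section OfRelation

open Polynomial Filter

variable {n : ℕ} {C : Set (PSpace n × PSpace 1)} {d : ℕ} {K : SepChart C d}
  {e : PSpace n × PSpace 1 → ℂ}

theorem SepChart.Tame.shrink (he : K.Tame e) {F : Set ℂ} (hF : F.Finite) :
    (K.shrink hF).Tame e := by
  obtain ⟨D, A, k, hD, hA, hb⟩ := he.growth
  exact ⟨fun c hc s hs p p' => he.diff c (fun h => hc (Or.inl h)) s hs p p', D, A, k, hD, hA,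
    fun c hc y hy y' hy' => hb c (fun h => hc (Or.inl h)) y hy y' hy'⟩

/-- A tame function whose values separate the classes of an invariant equivalence relation. -/
theorem IsCover.exists_tame_of_setoid (hC : IsCover C d) {q : PSpace 1} (hq : q ∉ branchLocus C)
    (S : Setoid (fiber C q))
    (hS : ∀ σ ∈ monodromyGroup C q hq, ∀ x x', S x x' → S (σ x) (σ x')) {a : ℕ} (ha : 0 < a)
    (hcard : ∀ x : fiber C q, {x' | S x x'}.encard = a) :
    ∃ (K : SepChart C d) (c₀ : ℂ) (e : PSpace n × PSpace 1 → ℂ), c₀ ∉ K.F ∧ affPt K.j c₀ = q ∧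
      K.Tame e ∧ (∀ c ∉ K.F, ∀ y ∈ fiber C (affPt K.j c),
        {y' ∈ fiber C (affPt K.j c) | e y' = e y}.encard = a) ∧
      ∀ x x' : fiber C q, e x = e x' ↔ S x x' := by
  classical
  obtain ⟨K, c₀, hc₀, rfl⟩ := hC.exists_sepChart hq
  set R := ExtRel C (fun x x' => S x x') with hR
  have hRq : ∀ x x' : fiber C (affPt K.j c₀), R x x' ↔ S x x' := hC.extRel_iff hq hS
  have htr : ∀ c ∉ K.F, ∃ L : fiber C (affPt K.j c₀) ≃ fiber C (affPt K.j c),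
      ∀ x x', R (L x) (L x') ↔ S x x' := fun c hc => by
    obtain ⟨γ, hγ⟩ := K.exists_path hC hc₀ hc
    exact hC.exists_equiv_extRel hq hS γ hγ
  have hrefl : ∀ c ∉ K.F, ∀ y ∈ fiber C (affPt K.j c), R y y := fun c hc y hy => by
    obtain ⟨L, hL⟩ := htr c hc
    obtain ⟨x, hx⟩ := L.surjective ⟨y, hy⟩
    have := (hL x x).mpr (S.refl x)
    rwa [hx] at this
  have htrans : ∀ c ∉ K.F, ∀ y ∈ fiber C (affPt K.j c), ∀ y' ∈ fiber C (affPt K.j c),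
      ∀ z ∈ fiber C (affPt K.j c), R y y' → (R y z ↔ R y' z) := fun c hc y hy y' hy' z hz => by
    obtain ⟨L, hL⟩ := htr c hc
    obtain ⟨x, hx⟩ := L.surjective ⟨y, hy⟩
    obtain ⟨x', hx'⟩ := L.surjective ⟨y', hy'⟩
    obtain ⟨w, hw⟩ := L.surjective ⟨z, hz⟩
    have h1 := hL x x'
    have h2 := hL x w
    have h3 := hL x' w
    rw [hx, hx'] at h1
    rw [hx, hw] at h2
    rw [hx', hw] at h3
    simp only at h1 h2 h3
    rw [h1, h2, h3]
    exact fun h => ⟨fun h' => S.trans (S.symm h) h', fun h' => S.trans h h'⟩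
  have hRcard : ∀ c ∉ K.F, ∀ y ∈ fiber C (affPt K.j c),
      {y' ∈ fiber C (affPt K.j c) | R y y'}.encard = a := fun c hc y hy => by
    obtain ⟨L, hL⟩ := htr c hc
    obtain ⟨x, hx⟩ := L.surjective ⟨y, hy⟩
    rw [← hcard x, ← (Subtype.val_injective.comp L.injective).encard_image]
    congr 1
    ext y'
    constructor
    · rintro ⟨hy', h⟩
      obtain ⟨x', hx'⟩ := L.surjective ⟨y', hy'⟩
      refine ⟨x', (hL x x').mp ?_, by rw [Function.comp_apply, hx']⟩
      rwa [hx, hx']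
    · rintro ⟨x', h, rfl⟩
      have := (hL x x').mpr h
      rw [hx] at this
      exact ⟨(L x').2, this⟩
  -- a polynomial in the separating function whose class sums separate the classes over `q`
  have := (K.finite_fiber hc₀).to_subtype
  let _ := Fintype.ofFinite (fiber C (affPt K.j c₀))
  -- `ρ` selects a representative of each class, and `P` below takes at every point over `q` the
  -- value of the separating function at its representative. The sum over a class is then `a` times
  -- that value, and distinct classes give distinct values.
  let ρ : fiber C (affPt K.j c₀) → fiber C (affPt K.j c₀) := fun x => (Quotient.mk S x).out
  have hρ : ∀ x, S (ρ x) x := fun x => Quotient.mk_out x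
  have hρ' : ∀ x x', S x x' → ρ x = ρ x' := fun x x' h => by
    simp only [ρ]
    rw [Quotient.sound h]
  have hinj : Set.InjOn (fun x : fiber C (affPt K.j c₀) => K.fn x)
      (Finset.univ : Finset (fiber C (affPt K.j c₀))) := fun x _ x' _ h =>
    Subtype.ext (K.injOn c₀ hc₀ x.2 x'.2 h)
  obtain ⟨P, hP⟩ : ∃ P : ℂ[X], ∀ x : fiber C (affPt K.j c₀), P.eval (K.fn x) = K.fn (ρ x) :=
    ⟨Lagrange.interpolate Finset.univ (fun x : fiber C (affPt K.j c₀) => K.fn x)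
      fun x => K.fn (ρ x), fun x => Lagrange.eval_interpolate_at_node _ hinj (Finset.mem_univ x)⟩
  have hPt : K.Tame fun y => P.eval (K.fn y) := by
    simp only [eval_eq_sum_range]
    exact SepChart.Tame.sum _ fun i _ => (SepChart.Tame.const K _).mul ((SepChart.Tame.fn K hC).pow i)
  let e : PSpace n × PSpace 1 → ℂ := fun y =>
    ∑ y' ∈ fib C y.2, if R y y' then P.eval (K.fn y') else 0
  have he : K.Tame e :=
    SepChart.Tame₂.sum_fib (SepChart.Tame₂.ite (K.locConst_extRel _) hPt.right (SepChart.Tame₂.const K 0))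
  have he_eq : ∀ c ∉ K.F, ∀ y ∈ fiber C (affPt K.j c), ∀ y' ∈ fiber C (affPt K.j c),
      R y y' → e y = e y' := fun c hc y hy y' hy' h => by
    simp only [e]
    rw [fiber_snd_eq hy hy']
    refine Finset.sum_congr rfl fun z hz => ?_
    rw [show y'.2 = affPt K.j c from hy'.2, mem_fib (K.finite_fiber hc)] at hz
    simp only [htrans c hc y hy y' hy' z hz h]
  have heq : ∀ x : fiber C (affPt K.j c₀), e x = a * K.fn (ρ x) := fun x => by
    simp only [e]
    rw [show x.1.2 = affPt K.j c₀ from x.2.2, ← Finset.sum_filter]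
    have hc : ((fib C (affPt K.j c₀)).filter fun y' => R x y').card = a := by
      rw [← Nat.cast_inj (R := ℕ∞), ← Set.encard_coe_eq_coe_finsetCard, ← hRcard c₀ hc₀ x x.2]
      congr 1
      ext y'
      simp [mem_fib (K.finite_fiber hc₀)]
    rw [Finset.sum_congr rfl (g := fun _ => K.fn (ρ x)), Finset.sum_const, hc, nsmul_eq_mul]
    intro y' hy'
    rw [Finset.mem_filter, mem_fib (K.finite_fiber hc₀)] at hy'
    rw [hρ' x ⟨y', hy'.1⟩ ((hRq _ _).mp hy'.2)]
    exact hP ⟨y', hy'.1⟩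
  have hsep : ∀ x x' : fiber C (affPt K.j c₀), e x = e x' ↔ S x x' := fun x x' => by
    rw [heq, heq, mul_right_inj' (by exact_mod_cast ha.ne')]
    constructor
    · intro h
      have h' : ρ x = ρ x' := Subtype.ext (K.injOn c₀ hc₀ (ρ x).2 (ρ x').2 h)
      exact S.trans (S.symm (hρ x)) (h' ▸ hρ x')
    · intro h
      rw [hρ' x x' h]
  -- remove the fibers where the function does not separate the classes
  have hW : K.Tame fun y => ∏ y' ∈ fib C y.2, if R y y' then 1 else e y - e y' :=
    SepChart.Tame₂.prod_fib (SepChart.Tame₂.ite (K.locConst_extRel _) (SepChart.Tame₂.const K 1) (he.left.sub he.right))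
  have hW0 : ∀ y ∈ fiber C (affPt K.j c₀),
      ∏ y' ∈ fib C y.2, (if R y y' then 1 else e y - e y') ≠ 0 := fun y hy => by
    refine Finset.prod_ne_zero_iff.mpr fun y' hy' => ?_
    rw [show y.2 = affPt K.j c₀ from hy.2, mem_fib (K.finite_fiber hc₀)] at hy'
    split_ifs with h
    · exact one_ne_zero
    · exact sub_ne_zero.mpr fun h' =>
        h ((hRq ⟨y, hy⟩ ⟨y', hy'⟩).mpr ((hsep ⟨y, hy⟩ ⟨y', hy'⟩).mp h'))
  obtain ⟨y₀, hy₀⟩ := K.nonempty_fiber hC hc₀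
  obtain ⟨F, hF, hFW⟩ := hW.finite_zeros hC hc₀ hy₀ (hW0 y₀ hy₀)
  -- The value `c₀` can be kept, since over `q` the function separates the classes by construction.
  have hF' : (F \ {c₀}).Finite := hF.sdiff
  refine ⟨K.shrink hF', c₀, e, ?_, rfl, he.shrink hF', ?_, hsep⟩
  · rintro (h | h)
    · exact hc₀ h
    · exact h.2 rfl
  · intro c hc' y hy
    have hc : c ∉ K.F := fun h => hc' (Or.inl h)
    rw [← hRcard c hc y hy]
    have hWy : ∏ y' ∈ fib C y.2, (if R y y' then 1 else e y - e y') ≠ 0 := by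
      by_cases hcc : c = c₀
      · subst hcc
        exact hW0 y hy
      · exact hFW c hc (fun h => hc' (Or.inr ⟨h, hcc⟩)) y hy
    congr 1
    ext y'
    refine and_congr_right fun hy' => ⟨fun h => ?_, fun h => (he_eq c hc y hy y' hy' h).symm⟩
    by_contra hcon
    rw [Finset.prod_ne_zero_iff] at hWy
    have := hWy y' (by
      rw [show y.2 = affPt K.j c from hy.2]
      exact (mem_fib (K.finite_fiber hc)).mpr hy')
    rw [if_neg hcon] at this
    exact this (sub_eq_zero.mpr h.symm)

theorem IsCover.exists_decomposition_of_setoid (hC : IsCover C d) {q : PSpace 1}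
    (hq : q ∉ branchLocus C) (S : Setoid (fiber C q))
    (hS : ∀ σ ∈ monodromyGroup C q hq, ∀ x x', S x x' → S (σ x) (σ x')) {a b : ℕ} (ha : 0 < a)
    (hb : 0 < b) (hd : d = a * b) (hcard : ∀ x : fiber C q, {x' | S x x'}.encard = a) :
    ∃ D : Decomposition C, D.IsGeneral q ∧ D.degα = a ∧ D.degβ = b ∧
      ∀ x x' : fiber C q, D.α x = D.α x' ↔ S x x' := by
  obtain ⟨K, c₀, e, hc₀, rfl, he, hcl, hsep⟩ := hC.exists_tame_of_setoid hq S hS ha hcard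
  obtain ⟨D, h1, h2, h3, h4⟩ := K.exists_decomposition hC he ha hb hd hcl hc₀
  exact ⟨D, h1, h2, h3, fun x x' => (h4 x x').trans (hsep x x')⟩

end OfRelation

end Decomposable
end

noncomputable section

namespace Decomposable

/-! ### Finite morphisms of positive degree are surjective -/

section FiniteMorphisms

variable {M M' : Type} [HasForms M] [HasForms M'] {f : M → M'} {X : Set M} {Y : Set M'}

theorem IsRegularMap.isRegularFun_comp (hf : IsRegularMap f X Y) {h : M' → ℂ}
    (hh : IsRegularFun Y h) : IsRegularFun X (h ∘ f) := by
  have := hf.pullback Set.univ (@isOpen_univ _ (zariski M')) h (by rwa [Set.inter_univ])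
  rwa [Set.preimage_univ, Set.inter_univ] at this

theorem isRegularFun_coordinate {N : ℕ} (Z : Set (Fin N → ℂ)) (i : Fin N) :
    IsRegularFun Z fun z => z i :=
  (affineChart_affine N Z).isRegularFun (a := MvPolynomial.X i) (w := 1) (fun _ _ => by simp)
    fun _ _ => by simp

theorem exists_poly_of_notMem {N : ℕ} {Z : Set (Fin N → ℂ)} (hZ : IsClosed[zariski (Fin N → ℂ)] Z)
    {z : Fin N → ℂ} (hz : z ∉ Z) :
    ∃ P : MvPolynomial (Fin N) ℂ, P.eval z ≠ 0 ∧ ∀ x ∈ Z, P.eval x = 0 := by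
  obtain ⟨_, _, ⟨P, rfl⟩, h0, h⟩ :=
    exists_form_of_isOpen ((@isOpen_compl_iff _ _ (zariski _)).mpr hZ) hz
  exact ⟨P, h0, fun x hx => by_contra fun hne => h x hne hx⟩

/-- Regular functions on an affine variety are polynomials. -/
theorem exists_poly_of_isRegularFun {N : ℕ} {Z : Set (Fin N → ℂ)}
    (hZ : IsClosed[zariski (Fin N → ℂ)] Z) {h : (Fin N → ℂ) → ℂ} (hh : IsRegularFun Z h) :
    ∃ P : MvPolynomial (Fin N) ℂ, ∀ z ∈ Z, h z = P.eval z := by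
  -- The ideal of denominators of `h`. It has no zero on `Z` because of the local denominators and
  -- none off `Z` because of the equations of `Z`, so by the Nullstellensatz it contains `1`.
  let J : Ideal (MvPolynomial (Fin N) ℂ) :=
    { carrier := {P | ∃ Q : MvPolynomial (Fin N) ℂ, ∀ z ∈ Z, P.eval z * h z = Q.eval z}
      zero_mem' := ⟨0, fun z _ => by simp⟩
      add_mem' := by
        rintro P P' ⟨Q, hQ⟩ ⟨Q', hQ'⟩
        exact ⟨Q + Q', fun z hz => by rw [map_add, map_add, add_mul, hQ z hz, hQ' z hz]⟩
      smul_mem' := by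
        rintro R P ⟨Q, hQ⟩
        exact ⟨R * Q, fun z hz => by rw [smul_eq_mul, map_mul, map_mul, mul_assoc, hQ z hz]⟩ }
  have hempty : MvPolynomial.zeroLocus ℂ J = ∅ := by
    rw [Set.eq_empty_iff_forall_notMem]
    intro z hz
    rw [MvPolynomial.mem_zeroLocus_iff] at hz
    have hz : ∀ P ∈ J, P.eval z = 0 := hz
    by_cases hzZ : z ∈ Z
    · obtain ⟨_, _, ⟨P, rfl⟩, _, ⟨Q, rfl⟩, h0, hPQ⟩ := hh z hzZ
      refine mul_self_ne_zero.mpr h0 ?_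
      rw [← map_mul]
      -- The square makes the identity hold also at the zeros of the local denominator.
      refine hz (Q * Q) ⟨Q * P, fun x hx => ?_⟩
      rw [map_mul, map_mul]
      by_cases hQ : Q.eval x = 0
      · simp [hQ]
      · rw [hPQ x hx hQ]
        field_simp
    · obtain ⟨P, hP, hPZ⟩ := exists_poly_of_notMem hZ hzZ
      exact hP (hz P ⟨0, fun x hx => by simp [hPZ x hx]⟩)
  have h1 : (1 : MvPolynomial (Fin N) ℂ) ∈ J := by
    rw [← Ideal.eq_top_iff_one, ← Ideal.radical_eq_top,
      ← MvPolynomial.vanishingIdeal_zeroLocus_eq_radical (K := ℂ), hempty,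
      MvPolynomial.vanishingIdeal_empty]
  obtain ⟨Q, hQ⟩ := h1
  exact ⟨Q, fun z hz => by rw [← hQ z hz, map_one, one_mul]⟩

/-- A polynomial map between affine sets with dense image whose coordinates are integral is
surjective. -/
theorem exists_preimage_of_integral {N N' : ℕ} {Z' : Set (Fin N' → ℂ)}
    (hZ' : IsClosed[zariski (Fin N' → ℂ)] Z') {a : Fin N → MvPolynomial (Fin N') ℂ}
    {z : Fin N → ℂ}
    (hz : ∀ P : MvPolynomial (Fin N) ℂ, (∀ x ∈ Z', P.eval (fun i => (a i).eval x) = 0) →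
      P.eval z = 0)
    (hint : ∀ j : Fin N', ∃ (k : ℕ) (c : Fin k → MvPolynomial (Fin N) ℂ), ∀ x ∈ Z',
      x j ^ k + ∑ i : Fin k, (c i).eval (fun l => (a l).eval x) * x j ^ (i : ℕ) = 0) :
    ∃ x ∈ Z', ∀ i, (a i).eval x = z i := by
  let I : Ideal (MvPolynomial (Fin N') ℂ) := MvPolynomial.vanishingIdeal ℂ Z'
  have hI : ∀ P, P ∈ I ↔ ∀ x ∈ Z', P.eval x = 0 := fun P => Iff.rfl
  let φ : MvPolynomial (Fin N) ℂ →+* MvPolynomial (Fin N') ℂ ⧸ I :=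
    (Ideal.Quotient.mk I).comp (MvPolynomial.bind₁ a : _ →ₐ[ℂ] MvPolynomial (Fin N') ℂ).toRingHom
  have hev : ∀ (P : MvPolynomial (Fin N) ℂ) (x : Fin N' → ℂ),
      (MvPolynomial.bind₁ a P).eval x = P.eval fun i => (a i).eval x := fun P x => by
    induction P using MvPolynomial.induction_on with
    | C b => simp
    | add P Q hP hQ => simp [hP, hQ]
    | mul_X P i hP => simp [hP]
  have hφ : ∀ P, φ P = Ideal.Quotient.mk I (MvPolynomial.bind₁ a P) := fun P => rfl
  let _ := φ.toAlgebra
  have hgen : ∀ j, IsIntegral (MvPolynomial (Fin N) ℂ)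
      (Ideal.Quotient.mk I (MvPolynomial.X j)) := fun j => by
    obtain ⟨k, c, hc⟩ := hint j
    refine ⟨Polynomial.X ^ k + ∑ i : Fin k, Polynomial.C (c i) * Polynomial.X ^ (i : ℕ),
      Polynomial.monic_X_pow_add (Polynomial.degree_sum_fin_lt c), ?_⟩
    change Polynomial.eval₂ φ _ _ = 0
    simp only [Polynomial.eval₂_add, Polynomial.eval₂_X_pow, Polynomial.eval₂_finsetSum,
      Polynomial.eval₂_mul, Polynomial.eval₂_C, hφ]
    rw [show Ideal.Quotient.mk I (MvPolynomial.X j) ^ k + ∑ i : Fin k,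
      Ideal.Quotient.mk I (MvPolynomial.bind₁ a (c i)) *
        Ideal.Quotient.mk I (MvPolynomial.X j) ^ (i : ℕ) =
      Ideal.Quotient.mk I (MvPolynomial.X j ^ k + ∑ i : Fin k,
        MvPolynomial.bind₁ a (c i) * MvPolynomial.X j ^ (i : ℕ)) by simp,
      Ideal.Quotient.eq_zero_iff_mem, hI]
    intro x hx
    rw [← hc x hx]
    simp [hev]
  have hintegral : Algebra.IsIntegral (MvPolynomial (Fin N) ℂ) (MvPolynomial (Fin N') ℂ ⧸ I) := by
    refine ⟨fun s => ?_⟩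
    obtain ⟨P, rfl⟩ := Ideal.Quotient.mk_surjective s
    induction P using MvPolynomial.induction_on with
    | C b =>
      have : Ideal.Quotient.mk I (MvPolynomial.C b) =
          algebraMap (MvPolynomial (Fin N) ℂ) _ (MvPolynomial.C b) := by
        change _ = φ _
        rw [hφ, MvPolynomial.bind₁_C_right]
      rw [this]
      exact isIntegral_algebraMap
    | add P Q hP hQ => rw [map_add]; exact hP.add hQ
    | mul_X P j hP => rw [map_mul]; exact hP.mul (hgen j)
  -- Lying over: by `hz` the maximal ideal of `z` contains the kernel of `φ`, so it is the
  -- contraction of a maximal ideal of the integral extension, and over `ℂ` the latter comes from a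
  -- point.
  obtain ⟨Q, hQmax, hQ⟩ := Ideal.exists_ideal_over_maximal_of_isIntegral
    (S := MvPolynomial (Fin N') ℂ ⧸ I) (MvPolynomial.vanishingIdeal ℂ {z}) (fun P hP => by
      rw [MvPolynomial.mem_vanishingIdeal_singleton_iff]
      have hP0 : φ P = 0 := hP
      rw [hφ, Ideal.Quotient.eq_zero_iff_mem, hI] at hP0
      exact hz P fun x hx => by rw [← hev]; exact hP0 x hx)
  have hmax : (Q.comap (Ideal.Quotient.mk I)).IsMaximal :=
    Ideal.comap_isMaximal_of_surjective _ Ideal.Quotient.mk_surjective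
  obtain ⟨x, hx⟩ := MvPolynomial.isMaximal_iff_eq_vanishingIdeal_singleton.mp hmax
  have hmem : ∀ P, Ideal.Quotient.mk I P ∈ Q ↔ P.eval x = 0 := fun P => by
    rw [← Ideal.mem_comap, hx, MvPolynomial.mem_vanishingIdeal_singleton_iff]
    rfl
  refine ⟨x, ?_, fun i => ?_⟩
  · by_contra hxZ
    obtain ⟨P, hP, hPZ⟩ := exists_poly_of_notMem hZ' hxZ
    refine hP ((hmem P).mp ?_)
    rw [Ideal.Quotient.eq_zero_iff_mem.mpr ((hI P).mpr hPZ)]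
    exact Q.zero_mem
  · have h1 : MvPolynomial.X i - MvPolynomial.C (z i) ∈ Q.comap (algebraMap
        (MvPolynomial (Fin N) ℂ) (MvPolynomial (Fin N') ℂ ⧸ I)) := by
      rw [hQ, MvPolynomial.mem_vanishingIdeal_singleton_iff]
      simp
    have h2 : Ideal.Quotient.mk I (MvPolynomial.bind₁ a
      (MvPolynomial.X i - MvPolynomial.C (z i))) ∈ Q := h1
    rw [hmem, hev] at h2
    simpa [sub_eq_zero] using h2

/-- Positive degree and irreducibility put an image point into every nonempty open subset of `Y`. On
an affine piece, integrality of the coordinates then turns this density into surjectivity. -/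
theorem IsFiniteMorphism.surjOn (hf : IsFiniteMorphism f X Y)
    (hY : @IsIrreducible _ (zariski M') Y) {d : ℕ} (hd : HasDegree f X Y d) (hd0 : 0 < d) :
    Set.SurjOn f X Y := by
  intro v hv
  obtain ⟨W, hW, hvW, ⟨N, Z, hZ, fY, gY, hfY, hgY, hinvY⟩,
    ⟨N', Z', hZ', fX, gX, hfX, hgX, hinvX⟩, hint⟩ := hf.finite v hv
  have hcomp : ∀ h : M' → ℂ, IsRegularFun (Y ∩ W) h → IsRegularFun (X ∩ f ⁻¹' W) (h ∘ f) :=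
    hf.regular.pullback W hW
  have ha : ∀ i : Fin N, ∃ a : MvPolynomial (Fin N') ℂ, ∀ x ∈ Z', fY (f (gX x)) i = a.eval x :=
    fun i => exists_poly_of_isRegularFun hZ' (hgX.isRegularFun_comp
      (hcomp _ (hfY.isRegularFun_comp (isRegularFun_coordinate Z i))))
  choose a ha using ha
  have ha' : ∀ x ∈ Z', (fun i => (a i).eval x) = fY (f (gX x)) := fun x hx =>
    funext fun i => (ha i x hx).symm
  obtain ⟨x, hx, hxv⟩ := exists_preimage_of_integral hZ' (a := a) (z := fY v) (fun P hP => by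
      by_contra hne
      have hopen := isOpen_form_ne_zero (M := Fin N → ℂ) (d := ()) ⟨P, rfl⟩
      obtain ⟨O, hO, hOeq⟩ := (@continuousOn_iff' _ _ (zariski M') (zariski _) _ _).mp
        hfY.continuousOn _ hopen
      have hvO : v ∈ O := ((Set.ext_iff.mp hOeq v).mp ⟨hne, hv, hvW⟩).1
      obtain ⟨W', hW', ⟨v', hv'⟩, hcard⟩ := hd
      obtain ⟨w, hwY, ⟨hwO, hwW⟩, hwW'⟩ := hY.2 _ _ (@IsOpen.inter _ (zariski _) _ _ hO hW) hW'
        ⟨v, hv, hvO, hvW⟩ ⟨v', hv'⟩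
      have hpos : (X ∩ f ⁻¹' {w}).encard ≠ 0 := by
        rw [hcard w ⟨hwY, hwW'⟩]
        exact_mod_cast hd0.ne'
      obtain ⟨y, hyX, hyw⟩ := Set.encard_ne_zero.mp hpos
      have hyw : f y = w := hyw
      have hyX' : y ∈ X ∩ f ⁻¹' W := ⟨hyX, by rw [Set.mem_preimage, hyw]; exact hwW⟩
      have h1 := hP (fX y) (hfX.mapsTo hyX')
      rw [ha' _ (hfX.mapsTo hyX'), hinvX.1 hyX', hyw] at h1
      exact ((Set.ext_iff.mp hOeq w).mpr ⟨hwO, hwY, hwW⟩).1 h1)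
    (fun j => by
      obtain ⟨k, c, hc, hrel⟩ := hint (fun x => fX x j)
        (hfX.isRegularFun_comp (isRegularFun_coordinate Z' j))
      choose c' hc' using fun i => exists_poly_of_isRegularFun hZ (hgY.isRegularFun_comp (hc i))
      refine ⟨k, c', fun x hx => ?_⟩
      have hgx := hgX.mapsTo hx
      have h1 := hrel (gX x) hgx
      rw [ha' x hx]
      simp only [hinvX.2 hx] at h1
      have hfx : f (gX x) ∈ Y ∩ W := ⟨hf.regular.mapsTo hgx.1, hgx.2⟩
      have h2 : ∀ i, c i (f (gX x)) = (c' i).eval (fY (f (gX x))) := fun i => by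
        rw [← hc' i _ (hfY.mapsTo hfx), Function.comp_apply, hinvY.1 hfx]
      simpa only [h2] using h1)
  have hgx := hgX.mapsTo hx
  refine ⟨gX x, hgx.1, ?_⟩
  have hfx : f (gX x) ∈ Y ∩ W := ⟨hf.regular.mapsTo hgx.1, hgx.2⟩
  rw [← hinvY.1 hfx, ← hinvY.1 ⟨hv, hvW⟩]
  congr 1
  funext i
  rw [← hxv i, ha i x hx]

end FiniteMorphisms

end Decomposable
end

noncomputable section

namespace Decomposable

/-! ### Regular maps are continuous for the classical topology -/

section Continuity

open Filter

variable {n m : ℕ} {X : Set (PSpace n × PSpace 1)}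

theorem IsRegularFun.continuousWithinAt {h : PSpace n × PSpace 1 → ℂ} (hh : IsRegularFun X h)
    {p : PSpace n × PSpace 1} (hp : p ∈ X) : ContinuousWithinAt h X p := by
  obtain ⟨D, _, ⟨F, hF, rfl⟩, _, ⟨G, hG, rfl⟩, h0, h⟩ := hh p hp
  have hcont := (continuousAt_evalAt_div hF hG h0).continuousWithinAt (s := X)
  refine hcont.congr_of_eventuallyEq ?_ (h p hp h0)
  filter_upwards [self_mem_nhdsWithin, nhdsWithin_le_nhds ((isOpen_evalAt_ne_zero hG).mem_nhds h0)]
    with x hx hne using h x hx hne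

/-- The coordinate ratios in a chart of the target are regular, so they pull back to regular
functions, which are locally quotients of forms and hence classically continuous. -/
theorem IsRegularMap.continuousOn_classical {f : PSpace n × PSpace 1 → PSpace m}
    {Y : Set (PSpace m)} (hf : IsRegularMap f X Y) : ContinuousOn f X := by
  intro p hp
  obtain ⟨j, hj⟩ := exists_rep_ne_zero (f p)
  have hW : IsOpen[zariski (PSpace m)] {v : PSpace m | v.rep j ≠ 0} := by
    have := isOpen_form_ne_zero (eval_rep_mem_form (MvPolynomial.isHomogeneous_X ℂ j))
    simpa only [MvPolynomial.eval_X] using this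
  obtain ⟨O, hO, hOeq⟩ := (@continuousOn_iff' _ _ (zariski _) (zariski _) _ _).mp hf.continuousOn _ hW
  have hpO : p ∈ O := ((Set.ext_iff.mp hOeq p).mp ⟨hj, hp⟩).1
  have hOW : ∀ x ∈ X, x ∈ O → (f x).rep j ≠ 0 := fun x hx hxO =>
    ((Set.ext_iff.mp hOeq x).mpr ⟨hxO, hx⟩).1
  have hreg : ∀ i, IsRegularFun (X ∩ f ⁻¹' {v | v.rep j ≠ 0})
      fun x => (f x).rep i / (f x).rep j := fun i =>
    hf.pullback _ hW (fun v => v.rep i / v.rep j)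
      (((affineChart_projective j).mono fun v hv => hv.2).isRegularFun (a := MvPolynomial.X i)
        (w := 1) (fun _ _ => by simp) fun _ _ => by simp)
  have hmem : X ∩ f ⁻¹' {v | v.rep j ≠ 0} ∈ 𝓝[X] p := by
    filter_upwards [self_mem_nhdsWithin,
      nhdsWithin_le_nhds ((isOpen_of_zariski hO).mem_nhds hpO)] with x hx hxO
    exact ⟨hx, hOW x hx hxO⟩
  have hcont : ContinuousWithinAt (fun x i => (f x).rep i / (f x).rep j) X p := by
    rw [continuousWithinAt_pi]
    exact fun i => ((hreg i).continuousWithinAt ⟨hp, hj⟩).mono_of_mem_nhdsWithin hmem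
  have hne : ∀ x, (f x).rep j ≠ 0 → (fun i => (f x).rep i / (f x).rep j) ≠ 0 := fun x hx h => by
    have := congrFun h j
    rw [div_self hx] at this
    exact one_ne_zero this
  let v₀ : NZ m := ⟨_, hne p hj⟩
  classical
  let g : PSpace n × PSpace 1 → NZ m := fun x =>
    if hx : (f x).rep j ≠ 0 then ⟨_, hne x hx⟩ else v₀
  have hg : ContinuousWithinAt g X p := by
    refine tendsto_subtype_rng.mpr (ContinuousWithinAt.tendsto (f := fun x => (g x).1) ?_)
    refine hcont.congr_of_eventuallyEq ?_ ?_
    · filter_upwards [hmem] with x hx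
      have hx : (f x).rep j ≠ 0 := hx.2
      simp only [g, dif_pos hx]
    · simp only [g, dif_pos hj]
  have hfg : ∀ x, (f x).rep j ≠ 0 → f x = Projectivization.mk' ℂ (g x) := fun x hx => by
    simp only [g, dif_pos hx]
    conv_lhs => rw [← mk'_rep (f x)]
    rw [mk'_eq_mk'_iff]
    exact ⟨Units.mk0 _ hx, funext fun i => mul_div_cancel₀ _ hx⟩
  refine ((isOpenQuotientMap_mk'.continuous.continuousAt).comp_continuousWithinAt
    hg).congr_of_eventuallyEq ?_ (hfg p hj)
  filter_upwards [hmem] with x hx using hfg x hx.2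

end Continuity

end Decomposable
end

noncomputable section

namespace Decomposable

/-! ### Relations that are locally constant outside finitely many fibers -/

section Invariance

open Filter

/-- The punctured disc is the image of a half plane under `z ↦ c₀ + exp z`. -/
theorem isPreconnected_ball_sdiff_center (c₀ : ℂ) {ε : ℝ} (hε : 0 < ε) :
    IsPreconnected (Metric.ball c₀ ε \ {c₀}) := by
  have h1 : IsPreconnected {z : ℂ | z.re < Real.log ε} :=
    (convex_halfSpace_re_lt _).isPreconnected
  have h2 := h1.image (fun z => c₀ + Complex.exp z) (by fun_prop)
  convert h2 using 1
  ext c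
  simp only [Set.mem_sdiff, Metric.mem_ball, Set.mem_singleton_iff, Set.mem_image,
    Set.mem_ofPred_eq]
  constructor
  · rintro ⟨h, hne⟩
    have hne' : c - c₀ ≠ 0 := sub_ne_zero.mpr hne
    refine ⟨Complex.log (c - c₀), ?_, by rw [Complex.exp_log hne']; ring⟩
    rw [Complex.log_re]
    rw [dist_eq_norm] at h
    exact Real.log_lt_log (norm_pos_iff.mpr hne') h
  · rintro ⟨z, hz, rfl⟩
    refine ⟨?_, by simp [Complex.exp_ne_zero]⟩
    rw [dist_eq_norm, add_sub_cancel_left, Complex.norm_exp]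
    exact (Real.lt_log_iff_exp_lt hε).mp hz

theorem IsPreconnected.iff_of_eventually_iff {X : Type*} [TopologicalSpace X] {S : Set X}
    (hS : IsPreconnected S) {P : X → Prop} (h : ∀ x ∈ S, ∀ᶠ y in 𝓝 x, P y ↔ P x) {x y : X}
    (hx : x ∈ S) (hy : y ∈ S) : P x ↔ P y :=
  hS.induction₂ (fun x y => P x ↔ P y)
    (fun x hx => ((h x hx).filter_mono nhdsWithin_le_nhds).mono fun _ h => h.symm)
    (fun _ _ _ _ _ _ h h' => h.trans h') (fun _ _ _ _ h => h.symm) hx hy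

theorem eventually_affPt_mem {T : Set (PSpace 1)} (hT : Tᶜ.Finite) (j : Fin 2) (c₀ : ℂ) :
    ∀ᶠ c in 𝓝 c₀, c ≠ c₀ → affPt j c ∈ T := by
  have hF : ((affPt j) ⁻¹' Tᶜ).Finite := hT.preimage (affPt_injective j).injOn
  have := (hF.sdiff (t := {c₀})).isClosed.isOpen_compl.mem_nhds (x := c₀) (by simp)
  filter_upwards [this] with c hc hne
  by_contra h
  exact hc ⟨h, hne⟩

theorem frequently_mem_of_finite_compl {T : Set (PSpace 1)} (hT : Tᶜ.Finite) (t₀ : PSpace 1) :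
    ∃ᶠ t in 𝓝 t₀, t ∈ T := by
  obtain ⟨j, hj⟩ := exists_rep_ne_zero t₀
  obtain ⟨c₀, rfl⟩ : ∃ c₀, affPt j c₀ = t₀ := ⟨_, affPt_affCrd hj⟩
  intro h
  rw [eventually_nhds_affPt] at h
  have h' := ((eventually_affPt_mem hT j c₀).and h).filter_mono (nhdsWithin_le_nhds (s := {c₀}ᶜ))
  obtain ⟨c, hc, hne⟩ := (h'.and self_mem_nhdsWithin).exists
  exact hc.2 (hc.1 hne)

variable {n : ℕ} {C : Set (PSpace n × PSpace 1)} {d : ℕ}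

/-- A point of `C` near `p` lies on one of the finitely many local sections, and the sections
through the other points of the fiber stay away from `p`. -/
theorem IsSections.eventually_eq (hC : IsCover C d) {t₀ : PSpace 1} (ht₀ : t₀ ∉ branchLocus C)
    {s : fiber C t₀ → PSpace 1 → PSpace n × PSpace 1} (hs : IsSections C t₀ s) (p : fiber C t₀) :
    ∀ᶠ y in 𝓝 (p : PSpace n × PSpace 1), y ∈ C → y = s p y.2 := by
  have := (hC.finite_fiber ht₀).to_subtype
  have hsnd : Tendsto (Prod.snd : PSpace n × PSpace 1 → _) (𝓝 (p : PSpace n × PSpace 1)) (𝓝 t₀) := by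
    have h : Tendsto (Prod.snd : PSpace n × PSpace 1 → _) (𝓝 (p : PSpace n × PSpace 1)) (𝓝 p.1.2) :=
      continuous_snd.continuousAt
    rwa [show p.1.2 = t₀ from p.2.2] at h
  have hne : ∀ p' : fiber C t₀, p' ≠ p → ∀ᶠ y in 𝓝 (p : PSpace n × PSpace 1), s p' y.2 ≠ y := by
    intro p' hp'
    have h1 : Tendsto (s p') (𝓝 t₀) (𝓝 p') := by
      have := hs.eventually.self_of_nhds.2.2.2.2 p'
      rwa [ContinuousAt, hs.apply_self] at this
    have h2 := (h1.comp hsnd).prodMk_nhds (tendsto_id (x := 𝓝 (p : PSpace n × PSpace 1)))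
    exact h2.eventually (isClosed_diagonal.isOpen_compl.mem_nhds fun h => hp' (Subtype.ext h))
  have hall : ∀ᶠ y in 𝓝 (p : PSpace n × PSpace 1), ∀ p' : fiber C t₀, p' ≠ p → s p' y.2 ≠ y :=
    eventually_all.mpr fun p' => by
      by_cases h : p' = p
      · exact Eventually.of_forall fun _ h' => absurd h h'
      · exact (hne p' h).mono fun _ h _ => h
  filter_upwards [hall, hsnd.eventually hs.eventually] with y hy hev hyC
  obtain ⟨p', hp'⟩ := hev.2.2.2.1 y ⟨hyC, rfl⟩
  by_cases h : p' = p
  · rw [← h, hp']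
  · exact absurd hp' (hy p' h)

/-- The pairs of points of `C` in a common fiber over `T`. -/
def pairs (C : Set (PSpace n × PSpace 1)) (T : Set (PSpace 1)) :
    Set ((PSpace n × PSpace 1) × (PSpace n × PSpace 1)) :=
  {z | z.1 ∈ C ∧ z.2 ∈ C ∧ z.1.2 = z.2.2 ∧ z.1.2 ∈ T}

theorem IsSections.eventually_mem_pairs {t₀ : PSpace 1}
    {s : fiber C t₀ → PSpace 1 → PSpace n × PSpace 1} (hs : IsSections C t₀ s) (p p' : fiber C t₀)
    (T : Set (PSpace 1)) : ∀ᶠ t in 𝓝 t₀, t ∈ T → (s p t, s p' t) ∈ pairs C T := by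
  filter_upwards [hs.eventually] with t ht htT
  exact ⟨(ht.2.1 p).1, (ht.2.1 p').1, (ht.2.1 p).2.trans (ht.2.1 p').2.symm, by
    rwa [show (s p t).2 = t from (ht.2.1 p).2]⟩

theorem IsSections.tendsto_pair {t₀ : PSpace 1}
    {s : fiber C t₀ → PSpace 1 → PSpace n × PSpace 1} (hs : IsSections C t₀ s) (p p' : fiber C t₀) :
    Tendsto (fun t => (s p t, s p' t)) (𝓝 t₀) (𝓝 ((p : PSpace n × PSpace 1), (p' : _ × PSpace 1))) := by
  have h := fun p => hs.eventually.self_of_nhds.2.2.2.2 p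
  have h' := (h p).prodMk (h p')
  rwa [ContinuousAt, hs.apply_self, hs.apply_self] at h'

/-- A property that holds along sections over `T` holds for the nearby pairs of points of the fibers
over `T`. -/
theorem IsSections.eventually_pairs (hC : IsCover C d) {t₀ : PSpace 1} (ht₀ : t₀ ∉ branchLocus C)
    {s : fiber C t₀ → PSpace 1 → PSpace n × PSpace 1} (hs : IsSections C t₀ s) (p p' : fiber C t₀)
    {T : Set (PSpace 1)} {R : (PSpace n × PSpace 1) × (PSpace n × PSpace 1) → Prop}
    (h : ∀ᶠ t in 𝓝 t₀, t ∈ T → R (s p t, s p' t)) :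
    ∀ᶠ w in 𝓝 ((p : PSpace n × PSpace 1), (p' : PSpace n × PSpace 1)), w ∈ pairs C T → R w := by
  have hfst : Tendsto (fun w : (PSpace n × PSpace 1) × (PSpace n × PSpace 1) => w.1.2)
      (𝓝 ((p : PSpace n × PSpace 1), (p' : PSpace n × PSpace 1))) (𝓝 p.1.2) :=
    (continuous_snd.comp continuous_fst).tendsto' _ _ rfl
  rw [show p.1.2 = t₀ from p.2.2] at hfst
  have hsec := (hs.eventually_eq hC ht₀ p).prod_mk (hs.eventually_eq hC ht₀ p')
  rw [← nhds_prod_eq] at hsec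
  filter_upwards [hsec, hfst.eventually h] with w hw hw' hwT
  have h2 := hw.2 hwT.2.1
  rw [← hwT.2.2.1] at h2
  rw [show w = (s p w.1.2, s p' w.1.2) from Prod.ext (hw.1 hwT.1) h2]
  exact hw' hwT.2.2.2

/-- A relation that is locally constant over `T` is near each pair of points of a fiber either
always true or always false over `T`. -/
theorem IsCover.eventually_or_eventually_not (hC : IsCover C d) {T : Set (PSpace 1)}
    (hT : Tᶜ.Finite) {R : (PSpace n × PSpace 1) × (PSpace n × PSpace 1) → Prop}
    (hR : ∀ z ∈ pairs C T, ∀ᶠ w in 𝓝 z, w ∈ pairs C T → (R w ↔ R z))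
    {z : (PSpace n × PSpace 1) × (PSpace n × PSpace 1)} (hz : z ∈ pairs C (branchLocus C)ᶜ) :
    (∀ᶠ w in 𝓝 z, w ∈ pairs C T → R w) ∨ ∀ᶠ w in 𝓝 z, w ∈ pairs C T → ¬ R w := by
  obtain ⟨p, p'⟩ := z
  obtain ⟨hp, hp', hpp', hB⟩ := hz
  simp only at hp hp' hpp' hB
  obtain ⟨t₀, ht₀⟩ : ∃ t₀, p.2 = t₀ := ⟨_, rfl⟩
  rw [ht₀] at hB
  obtain ⟨s, hs⟩ := hC.exists_sections hB
  let P : fiber C t₀ := ⟨p, hp, ht₀⟩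
  let P' : fiber C t₀ := ⟨p', hp', hpp'.symm.trans ht₀⟩
  obtain ⟨j, hj⟩ := exists_rep_ne_zero t₀
  obtain ⟨c₀, hc₀⟩ : ∃ c₀, affPt j c₀ = t₀ := ⟨_, affPt_affCrd hj⟩
  suffices h : (∀ᶠ t in 𝓝 t₀, t ∈ T → R (s P t, s P' t)) ∨
      ∀ᶠ t in 𝓝 t₀, t ∈ T → ¬ R (s P t, s P' t) by
    exact h.imp (hs.eventually_pairs hC hB P P') (hs.eventually_pairs hC hB P P')
  by_cases hT₀ : t₀ ∈ T
  · have h := (hs.tendsto_pair P P').eventually (hR (p, p') ⟨hp, hp', hpp', by rwa [ht₀]⟩)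
    have h' := hs.eventually_mem_pairs P P' T
    by_cases hr : R (p, p')
    · left
      filter_upwards [h, h'] with t h h' ht
      exact (h (h' ht)).mpr hr
    · right
      filter_upwards [h, h'] with t h h' ht
      exact fun h'' => hr ((h (h' ht)).mp h'')
  -- Here `t₀` is an isolated point outside `T`. On a small punctured disc around it the relation
  -- along the two sections is locally constant, hence constant by connectedness.
  · subst hc₀
    have hev := hs.eventually.and (hs.eventually_mem_pairs P P' T)
    rw [eventually_nhds_affPt] at hev
    obtain ⟨ε, hε, hball⟩ := Metric.eventually_nhds_iff_ball.mp
      (hev.and (eventually_affPt_mem hT j c₀))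
    have hconst : ∀ c ∈ Metric.ball c₀ ε \ {c₀}, ∀ᶠ c' in 𝓝 c,
        R (s P (affPt j c'), s P' (affPt j c')) ↔ R (s P (affPt j c), s P' (affPt j c)) := by
      rintro c ⟨hc, hne⟩
      have hb := hball c hc
      have hcont : ContinuousAt (fun c => (s P (affPt j c), s P' (affPt j c))) c :=
        ((hb.1.1.2.2.2.2 P).prodMk (hb.1.1.2.2.2.2 P')).comp (continuous_affPt j).continuousAt
      have h := hcont.eventually (hR _ (hb.1.2 (hb.2 hne)))
      filter_upwards [h, (Metric.isOpen_ball.sdiff isClosed_singleton).mem_nhds ⟨hc, hne⟩]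
        with c' h' hc'
      have hb' := hball c' hc'.1
      exact h' (hb'.1.2 (hb'.2 hc'.2))
    have hiff := fun c hc c' hc' => IsPreconnected.iff_of_eventually_iff
      (isPreconnected_ball_sdiff_center c₀ hε) hconst (x := c) (y := c') hc hc'
    rw [eventually_nhds_affPt, eventually_nhds_affPt]
    have hnear := Metric.ball_mem_nhds c₀ hε
    by_cases hex : ∃ c ∈ Metric.ball c₀ ε \ {c₀}, R (s P (affPt j c), s P' (affPt j c))
    · left
      obtain ⟨c, hc, hr⟩ := hex
      filter_upwards [hnear] with c' hc' hT'
      refine (hiff c hc c' ⟨hc', ?_⟩).mp hr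
      rintro rfl
      exact hT₀ hT'
    · right
      filter_upwards [hnear] with c' hc' hT' hr
      refine hex ⟨c', ⟨hc', ?_⟩, hr⟩
      rintro rfl
      exact hT₀ hT'

/-- Points of `T` accumulate at every base point, so the sections supply pairs over `T` arbitrarily
close to `z`. -/
theorem IsCover.not_eventually_and_eventually_not (hC : IsCover C d) {T : Set (PSpace 1)}
    (hT : Tᶜ.Finite) {R : (PSpace n × PSpace 1) × (PSpace n × PSpace 1) → Prop}
    {z : (PSpace n × PSpace 1) × (PSpace n × PSpace 1)} (hz : z ∈ pairs C (branchLocus C)ᶜ)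
    (h : ∀ᶠ w in 𝓝 z, w ∈ pairs C T → R w) (h' : ∀ᶠ w in 𝓝 z, w ∈ pairs C T → ¬ R w) : False := by
  obtain ⟨p, p'⟩ := z
  obtain ⟨hp, hp', hpp', hB⟩ := hz
  obtain ⟨s, hs⟩ := hC.exists_sections hB
  let P : fiber C p.2 := ⟨p, hp, rfl⟩
  let P' : fiber C p.2 := ⟨p', hp', hpp'.symm⟩
  obtain ⟨t, ht, h1, h2⟩ := ((frequently_mem_of_finite_compl hT p.2).and_eventually
    ((hs.eventually_mem_pairs P P' T).and
      ((hs.tendsto_pair P P').eventually (h.and h')))).exists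
  exact h2.2 (h1 ht) (h2.1 (h1 ht))

/-- A relation on the points of the fibers that is locally constant outside finitely many fibers is
invariant under the monodromy group. -/
theorem IsCover.iff_of_mem_monodromyGroup (hC : IsCover C d) {q : PSpace 1} (hq : q ∉ branchLocus C)
    {T : Set (PSpace 1)} (hT : Tᶜ.Finite) (hqT : q ∈ T)
    {R : (PSpace n × PSpace 1) × (PSpace n × PSpace 1) → Prop}
    (hR : ∀ z ∈ pairs C T, ∀ᶠ w in 𝓝 z, w ∈ pairs C T → (R w ↔ R z))
    {σ : Equiv.Perm (fiber C q)} (hσ : σ ∈ monodromyGroup C q hq) (x x' : fiber C q) :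
    R (x, x') ↔ R (σ x, σ x') := by
  obtain ⟨γ, hγ, hind⟩ := hσ
  obtain ⟨Γ, hΓ⟩ := hind x
  obtain ⟨Γ', hΓ'⟩ := hind x'
  have hmem : ∀ s, (Γ s, Γ' s) ∈ pairs C (branchLocus C)ᶜ := fun s =>
    ⟨(hΓ s).1, (hΓ' s).1, (hΓ s).2.trans (hΓ' s).2.symm, by
      show (Γ s).2 ∉ _
      rw [(hΓ s).2]
      exact hγ s⟩
  -- The loop may leave `T`, where `R` itself carries no information. The condition on nearby pairs
  -- over `T` makes sense along the whole loop, is locally constant in the parameter, and agrees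
  -- with `R` at both ends.
  let P : unitInterval → Prop := fun s => ∀ᶠ w in 𝓝 (Γ s, Γ' s), w ∈ pairs C T → R w
  have hcont : ∀ s, ContinuousAt (fun s => (Γ s, Γ' s)) s := fun s =>
    (Γ.continuous.prodMk Γ'.continuous).continuousAt
  have hP : ∀ s ∈ Set.univ, ∀ᶠ s' in 𝓝 s, P s' ↔ P s := by
    intro s _
    rcases hC.eventually_or_eventually_not hT hR (hmem s) with h | h
    · exact ((hcont s).eventually (eventually_eventually_nhds.mpr h)).mono fun _ h' =>
        iff_of_true h' h
    · refine ((hcont s).eventually (eventually_eventually_nhds.mpr h)).mono fun s' h' =>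
        iff_of_false (fun h'' => ?_) fun h'' => ?_
      · exact hC.not_eventually_and_eventually_not hT (hmem s') h'' h'
      · exact hC.not_eventually_and_eventually_not hT (hmem s) h'' h
  have hend : ∀ z ∈ pairs C T, z ∈ pairs C (branchLocus C)ᶜ →
      ((∀ᶠ w in 𝓝 z, w ∈ pairs C T → R w) ↔ R z) := by
    intro z hz hz'
    refine ⟨fun h => h.self_of_nhds hz, fun h => ?_⟩
    filter_upwards [hR z hz] with w hw hwT
    exact (hw hwT).mpr h
  have hfib : ∀ y y' : fiber C q, ∀ T' : Set (PSpace 1), q ∈ T' →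
      ((y : PSpace n × PSpace 1), (y' : PSpace n × PSpace 1)) ∈ pairs C T' := fun y y' T' hT' =>
    ⟨y.2.1, y'.2.1, y.2.2.trans y'.2.2.symm, by
      show y.1.2 ∈ _
      rwa [show y.1.2 = q from y.2.2]⟩
  have h01 : P 0 ↔ P 1 := IsPreconnected.iff_of_eventually_iff isPreconnected_univ hP
    (Set.mem_univ _) (Set.mem_univ _)
  simp only [P, Γ.source, Γ'.source, Γ.target, Γ'.target] at h01
  rwa [hend _ (hfib _ _ _ hqT) (hfib _ _ _ hq), hend _ (hfib _ _ _ hqT) (hfib _ _ _ hq)] at h01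

end Invariance

end Decomposable
end

noncomputable section

namespace Decomposable

/-! ### The partition of the fibers by a decomposition -/

section Classes

open Filter

/-- `f` factors through `g`, and the induced surjection between the ranges is injective because they
are finite of equal size. -/
theorem eq_of_encard_range_eq {X Y Z : Type*} [Finite X] {f : X → Y} {g : X → Z}
    (h : ∀ x x', g x = g x' → f x = f x') (hcard : (Set.range f).encard = (Set.range g).encard)
    {x x' : X} (hf : f x = f x') : g x = g x' := by
  have hfac : Function.FactorsThrough f g := fun x x' => h x x'
  let φ : Z → Y := Function.extend g f fun _ => f x
  have hφ : ∀ x, φ (g x) = f x := fun x => hfac.extend_apply _ x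
  have himg : φ '' Set.range g = Set.range f := by
    rw [← Set.range_comp]
    exact congrArg Set.range (funext hφ)
  exact (Set.finite_range g).injOn_of_encard_image_eq (by rw [himg, hcard]) ⟨x, rfl⟩ ⟨x', rfl⟩
    (by rw [hφ, hφ, hf])

theorem encard_eq_mul_encard_image {X Y : Type*} {s : Set X} (hs : s.Finite) (f : X → Y) {a : ℕ}
    (h : ∀ x ∈ s, {x' ∈ s | f x' = f x}.encard = a) : s.encard = a * (f '' s).encard := by
  classical
  lift s to Finset X using hs
  have h1 : s.card = (s.image f).card * a := by
    rw [Finset.card_eq_sum_card_image f s]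
    refine Finset.sum_const_nat fun y hy => ?_
    obtain ⟨x, hx, rfl⟩ := Finset.mem_image.mp hy
    have := h x hx
    rw [show {x' | x' ∈ (s : Set X) ∧ f x' = f x} = ((s.filter fun x' => f x' = f x : Finset X) : Set X)
      from (Finset.coe_filter _ s).symm, Set.encard_coe_eq_coe_finsetCard] at this
    exact_mod_cast this
  rw [← Finset.coe_image, Set.encard_coe_eq_coe_finsetCard, Set.encard_coe_eq_coe_finsetCard, h1,
    mul_comm]
  push_cast
  rfl

variable {n : ℕ} {C : Set (PSpace n × PSpace 1)} {d : ℕ}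

/-- A nonempty open subset of the curve contains all but finitely many fibers. -/
theorem IsCover.finite_setOf_fiber_not_subset (hC : IsCover C d) {O : Set (PSpace n × PSpace 1)}
    (hO : IsOpen[zariski (PSpace n × PSpace 1)] O) (hne : (C ∩ O).Nonempty) :
    {t | ¬ fiber C t ⊆ O}.Finite := by
  obtain ⟨q, hq⟩ : ∃ q, q ∉ branchLocus C := (finite_branchLocus hC.degree).exists_notMem
  obtain ⟨K, c, hc, -⟩ := hC.exists_sepChart hq
  obtain ⟨y₁, hy₁C, hy₁⟩ := hne
  obtain ⟨y₀, hy₀⟩ := K.nonempty_chart hC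
  obtain ⟨y, hyC, hyO, hy1, hy2⟩ := hC.irreducible.2 O _ hO (isOpen_chart K.ℓ₀ K.j)
    ⟨y₁, hy₁C, hy₁⟩ ⟨y₀, hy₀.1, hy₀.2⟩
  obtain ⟨D, φ, ⟨F, hF, rfl⟩, h1, h2⟩ := exists_form_of_isOpen hO hyO
  obtain ⟨Z, hZ, h⟩ := K.finite_zeros hC (y₀ := y) (a := F) ⟨hyC, hy1, hy2⟩ (by
    rw [evalAt_eq_eval_normCrd hF hy1 hy2] at h1
    exact right_ne_zero_of_mul h1)
  refine ((K.shrink hZ).finite_compl_base).subset fun t ht htb => ht fun y hy => h2 y ?_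
  obtain ⟨c, hc, rfl⟩ := htb
  have hc' : c ∉ K.F ∧ c ∉ Z := by
    rw [← not_or]
    exact hc
  have hch := K.mem_chart hc'.1 hy
  rw [evalAt_eq_eval_normCrd hF hch.2.1 hch.2.2]
  exact mul_ne_zero (mul_ne_zero (pow_ne_zero _ hch.2.1) (pow_ne_zero _ hch.2.2))
    (h c hc'.1 hc'.2 y hy)

namespace Decomposition

variable (D : Decomposition C)

theorem mem_dom_of_mem_fiber {t : PSpace 1} (ht : t ∈ D.U) {y : PSpace n × PSpace 1}
    (hy : y ∈ fiber C t) : y ∈ C ∩ Prod.snd ⁻¹' D.U :=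
  ⟨hy.1, by
    show y.2 ∈ D.U
    rwa [show y.2 = t from hy.2]⟩

/-- Surjectivity of `α` shows that no point of the fiber of `β` is missed. -/
theorem image_fiber {t : PSpace 1} (ht : t ∈ D.U) : D.α '' fiber C t = D.V ∩ D.β ⁻¹' {t} := by
  apply Set.Subset.antisymm
  · rintro _ ⟨y, hy, rfl⟩
    have hyU := D.mem_dom_of_mem_fiber ht hy
    exact ⟨D.α_finite.regular.mapsTo hyU, (D.comp_eq y hyU).trans hy.2⟩
  · rintro v ⟨hv, hvt⟩
    obtain ⟨y, hy, rfl⟩ := D.α_finite.surjOn D.V_irreducible D.degα_spec D.degα_pos hv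
    exact ⟨y, ⟨hy.1, (D.comp_eq y hy).symm.trans hvt⟩, rfl⟩

/-- The points outside the branch loci of the projection and of `β`. -/
def good : Set (PSpace 1) :=
  {t | t ∉ branchLocus C ∧ t ∈ D.U ∧ (D.V ∩ D.β ⁻¹' {t}).encard = D.degβ}

theorem finite_compl_good (hC : IsCover C d) : D.goodᶜ.Finite := by
  obtain ⟨W, hW, hne, h⟩ := D.degβ_spec
  have hUW := finite_compl_of_isOpen (@IsOpen.inter _ (zariski _) _ _ D.U_open hW) hne
  refine ((finite_branchLocus hC.degree).union hUW).subset fun t ht => ?_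
  by_contra hcon
  simp only [Set.mem_union, Set.mem_compl_iff, not_or, not_not] at hcon
  exact ht ⟨hcon.1, hcon.2.1, h t hcon.2⟩

theorem encard_range {t : PSpace 1} (ht : t ∈ D.good) :
    (Set.range fun x : fiber C t => D.α x).encard = D.degβ := by
  rw [← Set.image_eq_range, D.image_fiber ht.2.1, ht.2.2]

/-- Classical continuity of `α` and the Hausdorff property of the target keep distinct values apart.
The restriction to good points is needed because `α` is continuous only over `U`. -/
theorem eventually_ne {t₀ : PSpace 1} (ht₀ : t₀ ∈ D.good)
    {s : fiber C t₀ → PSpace 1 → PSpace n × PSpace 1} (hs : IsSections C t₀ s) {p p' : fiber C t₀}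
    (h : D.α p ≠ D.α p') : ∀ᶠ t in 𝓝 t₀, t ∈ D.good → D.α (s p t) ≠ D.α (s p' t) := by
  have hα : ∀ p : fiber C t₀, Tendsto (fun t => D.α (s p t)) (𝓝[D.good] t₀) (𝓝 (D.α p)) := by
    intro p
    have h1 := D.α_finite.regular.continuousOn_classical p (D.mem_dom_of_mem_fiber ht₀.2.1 p.2)
    have h2 : Tendsto (s p) (𝓝[D.good] t₀) (𝓝[C ∩ Prod.snd ⁻¹' D.U] p) := by
      refine tendsto_nhdsWithin_of_tendsto_nhds_of_eventually_within _ ?_ ?_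
      · have := hs.eventually.self_of_nhds.2.2.2.2 p
        rw [ContinuousAt, hs.apply_self] at this
        exact this.mono_left nhdsWithin_le_nhds
      · filter_upwards [hs.eventually.filter_mono nhdsWithin_le_nhds, self_mem_nhdsWithin]
          with t ht htg
        exact D.mem_dom_of_mem_fiber htg.2.1 (ht.2.1 p)
    exact Tendsto.comp h1 h2
  have := ((hα p).prodMk_nhds (hα p')).eventually (isClosed_diagonal.isOpen_compl.mem_nhds h)
  exact eventually_nhdsWithin_iff.mp this

/-- Distinct values of `α` stay distinct, so the partitions of nearby fibers refine the one at the
given base point; all of them have `deg β` classes, so they agree. -/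
theorem eventually_iff (hC : IsCover C d) {z : (PSpace n × PSpace 1) × (PSpace n × PSpace 1)}
    (hz : z ∈ pairs C D.good) :
    ∀ᶠ w in 𝓝 z, w ∈ pairs C D.good → (D.α w.1 = D.α w.2 ↔ D.α z.1 = D.α z.2) := by
  obtain ⟨p, p'⟩ := z
  obtain ⟨hp, hp', hpp', ht₀⟩ := hz
  obtain ⟨s, hs⟩ := hC.exists_sections ht₀.1
  have := (hC.finite_fiber ht₀.1).to_subtype
  let P : fiber C p.2 := ⟨p, hp, rfl⟩
  let P' : fiber C p.2 := ⟨p', hp', hpp'.symm⟩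
  refine hs.eventually_pairs hC ht₀.1 P P' (R := fun w => D.α w.1 = D.α w.2 ↔ D.α p = D.α p') ?_
  have hall : ∀ᶠ t in 𝓝 p.2, ∀ x x' : fiber C p.2, D.α x ≠ D.α x' → t ∈ D.good →
      D.α (s x t) ≠ D.α (s x' t) := eventually_all.mpr fun x => eventually_all.mpr fun x' => by
    by_cases h : D.α x = D.α x'
    · exact Eventually.of_forall fun _ h' => absurd h h'
    · exact (D.eventually_ne ht₀ hs h).mono fun _ h _ => h
  filter_upwards [hall, hs.eventually] with t ht hev htg
  have href : ∀ x x' : fiber C p.2, D.α (s x t) = D.α (s x' t) → D.α x = D.α x' := fun x x' h =>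
    by_contra fun hne => ht x x' hne htg h
  refine ⟨href P P', fun h => ?_⟩
  refine eq_of_encard_range_eq (f := fun x : fiber C p.2 => D.α x) (g := fun x => D.α (s x t))
    href ?_ (x := P) (x' := P') h
  rw [D.encard_range ht₀, ← D.encard_range htg]
  congr 1
  ext v
  constructor
  · rintro ⟨y, rfl⟩
    obtain ⟨x, hx⟩ := hev.2.2.2.1 y y.2
    exact ⟨x, by simp only [hx]⟩
  · rintro ⟨x, rfl⟩
    exact ⟨⟨s x t, hev.2.1 x⟩, rfl⟩

/-- The partition of the fiber over `q` by `α` is invariant under the monodromy group. -/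
theorem iff_of_mem_monodromyGroup (hC : IsCover C d) {q : PSpace 1} (hq : q ∉ branchLocus C)
    (hD : D.IsGeneral q) {σ : Equiv.Perm (fiber C q)} (hσ : σ ∈ monodromyGroup C q hq)
    (x x' : fiber C q) : D.α x = D.α x' ↔ D.α (σ x) = D.α (σ x') :=
  hC.iff_of_mem_monodromyGroup hq (D.finite_compl_good hC) (T := D.good) ⟨hq, hD⟩
    (R := fun z => D.α z.1 = D.α z.2) (fun _ hz => D.eventually_iff hC hz) hσ x x'

/-- The degree of `α` is known only over a nonempty open subset of `V`. Almost every fiber of the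
projection maps into that subset, and one that is also good for `β` is counted. -/
theorem degree_eq (hC : IsCover C d) : d = D.degα * D.degβ := by
  obtain ⟨W, hW, ⟨v, hvV, hvW⟩, h⟩ := D.degα_spec
  obtain ⟨y, hy, rfl⟩ := D.α_finite.surjOn D.V_irreducible D.degα_spec D.degα_pos hvV
  obtain ⟨O, hO, hOW⟩ := (@continuousOn_iff' _ _ (zariski _) (zariski _) _ _).mp
    D.α_finite.regular.continuousOn W hW
  have hyO : y ∈ O := (hOW.subset ⟨hvW, hy⟩).1
  obtain ⟨t, ht⟩ := ((hC.finite_setOf_fiber_not_subset hO ⟨y, hy.1, hyO⟩).union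
    (D.finite_compl_good hC)).exists_notMem
  simp only [Set.mem_union, Set.mem_ofPred_eq, Set.mem_compl_iff, not_or, not_not] at ht
  obtain ⟨htO, htg⟩ := ht
  have hcount := encard_eq_mul_encard_image (hC.finite_fiber htg.1) D.α (a := D.degα)
    fun x hx => by
      have hxU := D.mem_dom_of_mem_fiber htg.2.1 hx
      rw [← h (D.α x) ⟨D.α_finite.regular.mapsTo hxU, (hOW.superset ⟨htO hx, hxU⟩).1⟩]
      congr 1
      ext x'
      constructor
      · rintro ⟨h1, h2⟩
        exact ⟨D.mem_dom_of_mem_fiber htg.2.1 h1, h2⟩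
      · rintro ⟨h1, h2⟩
        refine ⟨⟨h1.1, ?_⟩, h2⟩
        show x'.2 = t
        rw [← D.comp_eq x' h1, show D.α x' = D.α x from h2, D.comp_eq x hxU]
        exact hx.2
  rw [hC.encard_fiber htg.1, D.image_fiber htg.2.1, htg.2.2] at hcount
  exact_mod_cast hcount

/-- The classes of the partition of the fiber over `q` by `α` have `deg α` elements. -/
theorem encard_class (hC : IsCover C d) {q : PSpace 1} (hq : q ∉ branchLocus C)
    (hD : D.IsGeneral q) (x : fiber C q) : {x' : fiber C q | D.α x' = D.α x}.encard = D.degα := by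
  have := (hC.finite_fiber hq).to_subtype
  obtain ⟨k, hk⟩ : ∃ k : ℕ, {x' : fiber C q | D.α x' = D.α x}.encard = k :=
    ENat.ne_top_iff_exists.mp (Set.toFinite _).encard_lt_top.ne |>.imp fun _ h => h.symm
  -- All classes have the same size because the monodromy group is transitive and preserves the
  -- partition. The degree of `α` cannot be read off directly, since the points of `V` over `q` may
  -- be exceptional for `α`.
  have hall : ∀ y : fiber C q, {x' : fiber C q | D.α x' = D.α y}.encard = k := by
    intro y
    obtain ⟨σ, hσ, rfl⟩ := hC.exists_monodromy_eq hq x y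
    rw [← hk, ← σ.injective.encard_image {x' : fiber C q | D.α x' = D.α x}]
    congr 1
    ext x'
    constructor
    · intro h
      refine ⟨σ.symm x', (D.iff_of_mem_monodromyGroup hC hq hD hσ _ _).mpr ?_, by simp⟩
      rw [Equiv.apply_symm_apply]
      exact h
    · rintro ⟨y', h, rfl⟩
      exact (D.iff_of_mem_monodromyGroup hC hq hD hσ _ _).mp h
  have hcount := encard_eq_mul_encard_image (Set.toFinite (Set.univ : Set (fiber C q)))
    (fun x => D.α x) (a := k) fun y _ => by simpa using hall y
  rw [Set.image_univ, D.encard_range ⟨hq, hD⟩, Set.encard_univ, ENat.card_coe_set_eq,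
    hC.encard_fiber hq, D.degree_eq hC] at hcount
  rw [hk]
  have h : D.degα * D.degβ = k * D.degβ := by exact_mod_cast hcount
  rw [Nat.eq_of_mul_eq_mul_right D.degβ_pos h]

end Decomposition

end Classes

end Decomposable
end

noncomputable section

namespace Decomposable

/-! ### Blocks and factors -/

section Blocks

variable {X Y : Type} {G : Subgroup (Equiv.Perm X)} {f : X → Y} {A B : Set X}

theorem smul_setOf_eq (hf : ∀ σ ∈ G, ∀ x x', f x = f x' ↔ f (σ x) = f (σ x')) {σ : Equiv.Perm X}
    (hσ : σ ∈ G) (x₀ : X) : σ • {x | f x = f x₀} = {x | f x = f (σ x₀)} := by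
  ext x
  rw [Set.mem_smul_set_iff_inv_smul_mem]
  show f (σ⁻¹ x) = f x₀ ↔ f x = f (σ x₀)
  rw [hf σ hσ, ← Equiv.Perm.mul_apply, mul_inv_cancel, Equiv.Perm.one_apply]

theorem isBlock_setOf_eq (hf : ∀ σ ∈ G, ∀ x x', f x = f x' ↔ f (σ x) = f (σ x')) (x₀ : X) :
    MulAction.IsBlock G {x | f x = f x₀} := by
  rintro ⟨σ, hσ⟩ ⟨τ, hτ⟩ hne
  have h1 : (⟨σ, hσ⟩ : G) • {x | f x = f x₀} = {x | f x = f (σ x₀)} := smul_setOf_eq hf hσ x₀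
  have h2 : (⟨τ, hτ⟩ : G) • {x | f x = f x₀} = {x | f x = f (τ x₀)} := smul_setOf_eq hf hτ x₀
  rw [h1, h2] at hne ⊢
  refine Set.disjoint_left.mpr fun x hx hx' => hne ?_
  rw [show f (σ x₀) = f (τ x₀) from Eq.trans (Eq.symm hx) hx']

/-- By transitivity the translates of one class are all the classes. As `B` has as many elements as
there are classes, meeting each at most once is the same as meeting each exactly once. -/
theorem isSetOfRepresentatives_iff [Finite X] (hG : ∀ x x', ∃ σ ∈ G, σ x = x')
    (hf : ∀ σ ∈ G, ∀ x x', f x = f x' ↔ f (σ x) = f (σ x')) (x₀ : X)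
    (hB : B.encard = (Set.range f).encard) :
    IsSetOfRepresentatives G {x | f x = f x₀} B ↔ Set.InjOn f B := by
  constructor
  · intro h x hx x' hx' hxx'
    obtain ⟨σ, hσ, rfl⟩ := hG x₀ x
    refine (h σ hσ).unique ?_ ?_ <;> rw [smul_setOf_eq hf hσ]
    · exact ⟨rfl, hx⟩
    · exact ⟨hxx'.symm, hx'⟩
  · intro h σ hσ
    have himg : f '' B = Set.range f := ((Set.finite_range f).subset
      (Set.image_subset_range f B)).eq_of_subset_of_encard_le (Set.image_subset_range f B) (by rw [h.encard_image, hB])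
    obtain ⟨x, hx, hxσ⟩ : f (σ x₀) ∈ f '' B := himg ▸ ⟨_, rfl⟩
    rw [smul_setOf_eq hf hσ]
    exact ⟨x, ⟨hxσ, hx⟩, fun x' hx' => h hx'.2 hx (Eq.trans hx'.1 hxσ.symm)⟩

/-- The partition into the translates of a block. -/
def blockSetoid (hG : ∀ x x', ∃ σ ∈ G, σ x = x') (hA : MulAction.IsBlock G A) (hne : A.Nonempty) :
    Setoid X where
  r x x' := ∃ σ ∈ G, x ∈ σ • A ∧ x' ∈ σ • A
  iseqv := by
    refine ⟨fun x => ?_, fun ⟨σ, hσ, h, h'⟩ => ⟨σ, hσ, h', h⟩, ?_⟩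
    · obtain ⟨x₀, hx₀⟩ := hne
      obtain ⟨σ, hσ, rfl⟩ := hG x₀ x
      exact ⟨σ, hσ, ⟨x₀, hx₀, rfl⟩, ⟨x₀, hx₀, rfl⟩⟩
    · rintro x y z ⟨σ, hσ, hx, hy⟩ ⟨τ, hτ, hy', hz⟩
      have h : σ • A = τ • A := by
        by_contra hne
        exact Set.disjoint_left.mp (hA (g₁ := ⟨σ, hσ⟩) (g₂ := ⟨τ, hτ⟩) hne) hy hy'
      exact ⟨σ, hσ, hx, h ▸ hz⟩

theorem blockSetoid_smul (hG : ∀ x x', ∃ σ ∈ G, σ x = x') (hA : MulAction.IsBlock G A)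
    (hne : A.Nonempty) {σ : Equiv.Perm X} (hσ : σ ∈ G) {x x' : X}
    (h : blockSetoid hG hA hne x x') : blockSetoid hG hA hne (σ x) (σ x') := by
  obtain ⟨τ, hτ, ⟨y, hy, rfl⟩, ⟨y', hy', rfl⟩⟩ := h
  exact ⟨σ * τ, mul_mem hσ hτ, ⟨y, hy, rfl⟩, ⟨y', hy', rfl⟩⟩

/-- For `x₀` in `A`, the class of `σ x₀` is the translate of `A` by `σ`. -/
theorem encard_blockSetoid (hG : ∀ x x', ∃ σ ∈ G, σ x = x') (hA : MulAction.IsBlock G A)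
    (hne : A.Nonempty) (x : X) : {x' | blockSetoid hG hA hne x x'}.encard = A.encard := by
  obtain ⟨x₀, hx₀⟩ := hne
  obtain ⟨σ, hσ, rfl⟩ := hG x₀ x
  rw [← σ.injective.encard_image A]
  congr 1
  ext x'
  constructor
  · rintro ⟨τ, hτ, hx, hx'⟩
    have h : σ • A = τ • A := by
      by_contra hne
      exact Set.disjoint_left.mp (hA (g₁ := ⟨σ, hσ⟩) (g₂ := ⟨τ, hτ⟩) hne) ⟨x₀, hx₀, rfl⟩ hx
    rw [← h] at hx'
    exact hx'
  · exact fun h => ⟨σ, hσ, ⟨x₀, hx₀, rfl⟩, h⟩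

end Blocks

/-! ### Factors of a witness set, blocks and sets of representatives -/

section Factors

variable {n : ℕ} {C : Set (PSpace n × PSpace 1)} {a b : ℕ} {q : PSpace 1} {A : Set (fiber C q)}

/-- The translates of the block are an invariant partition into classes of size `a`, and `A` is the
class of the identity translate. -/
theorem IsCover.exists_isAlphaFactor (hC : IsCover C (a * b)) (hq : q ∉ branchLocus C)
    (ha : 0 < a) (hb : 0 < b) (hA : A.encard = a)
    (hblock : MulAction.IsBlock (monodromyGroup C q hq) A) :
    ∃ D : Decomposition C, D.IsGeneral q ∧ D.IsAlphaFactor A := by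
  have hne : A.Nonempty := by
    rw [← Set.encard_pos, hA]
    exact_mod_cast ha
  have hG := hC.exists_monodromy_eq hq
  obtain ⟨D, hD, hDa, -, h⟩ := hC.exists_decomposition_of_setoid hq (blockSetoid hG hblock hne)
    (fun σ hσ _ _ => blockSetoid_smul hG hblock hne hσ) ha hb rfl
    fun x => (encard_blockSetoid hG hblock hne x).trans hA
  refine ⟨D, hD, by rw [hA, hDa], fun x hx y hy => (h x y).mpr ⟨1, one_mem _, ?_, ?_⟩⟩
  · rwa [one_smul]
  · rwa [one_smul]

/-- `A` lies in one class of the partition by `α`, and both have `deg α` elements. -/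
theorem Decomposition.IsAlphaFactor.eq_setOf {D : Decomposition C} (hC : IsCover C (a * b))
    (hq : q ∉ branchLocus C) (hD : D.IsGeneral q) (hA : D.IsAlphaFactor A) :
    ∃ x₀ : fiber C q, A = {x : fiber C q | D.α x = D.α x₀} := by
  have := (hC.finite_fiber hq).to_subtype
  obtain ⟨x₀, hx₀⟩ : A.Nonempty := by
    rw [← Set.encard_pos, hA.1]
    exact_mod_cast D.degα_pos
  exact ⟨x₀, (Set.toFinite _).eq_of_subset_of_encard_le (fun x hx => hA.2 x hx x₀ hx₀)
    (by rw [D.encard_class hC hq hD, hA.1])⟩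

theorem Decomposition.IsAlphaFactor.isBlock {D : Decomposition C} (hC : IsCover C (a * b))
    (hq : q ∉ branchLocus C) (hD : D.IsGeneral q) (hA : D.IsAlphaFactor A) :
    MulAction.IsBlock (monodromyGroup C q hq) A := by
  obtain ⟨x₀, rfl⟩ := hA.eq_setOf hC hq hD
  exact isBlock_setOf_eq (f := fun x : fiber C q => D.α x)
    (fun σ hσ => D.iff_of_mem_monodromyGroup hC hq hD hσ) x₀

/-- The size of `A` forces `deg α = a`, and then `a * b = deg α * deg β` forces `deg β = b`; so `B`
has as many elements as there are classes. -/
theorem Decomposition.IsAlphaFactor.isBetaFactor_iff {D : Decomposition C} (hC : IsCover C (a * b))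
    (hq : q ∉ branchLocus C) (ha : 0 < a) (hD : D.IsGeneral q) (hA : D.IsAlphaFactor A)
    (hAa : A.encard = a) {B : Set (fiber C q)} (hB : B.encard = b) :
    D.IsBetaFactor B ↔ IsSetOfRepresentatives (monodromyGroup C q hq) A B := by
  have := (hC.finite_fiber hq).to_subtype
  have hDa : D.degα = a := by exact_mod_cast hA.1.symm.trans hAa
  have hDb : D.degβ = b := by
    have := D.degree_eq hC
    rw [hDa] at this
    exact (Nat.eq_of_mul_eq_mul_left ha this).symm
  obtain ⟨x₀, rfl⟩ := hA.eq_setOf hC hq hD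
  rw [isSetOfRepresentatives_iff (f := fun x : fiber C q => D.α x) (hC.exists_monodromy_eq hq)
    (fun σ hσ => D.iff_of_mem_monodromyGroup hC hq hD hσ) x₀
    (by rw [D.encard_range ⟨hq, hD⟩, hB, hDb])]
  exact ⟨fun h x hx y hy => h.2 x hx y hy, fun h => ⟨by rw [hB, hDb], fun x hx y hy => h hx hy⟩⟩

/-- Since `q` is off the branch locus, the number of witness points is the degree of the projection.
-/
theorem WitnessSet.isCover (W : WitnessSet C) (hC : IsIrreducibleCurve C) (ha : 0 < a) (hb : 0 < b)
    (hab : Nat.card W.Point = a * b) : IsCover C (a * b) := by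
  have hq := W.q_notMem
  simp only [branchLocus, Set.mem_ofPred_eq, not_not] at hq
  obtain ⟨d, hd, h⟩ := hq
  have hd' : d = a * b := by
    rw [← hab, WitnessSet.Point, Nat.card_coe_set_eq, Set.ncard, h]
    rfl
  subst hd'
  exact ⟨hC.closed, hC.irreducible, hd, Nat.mul_pos ha hb⟩

end Factors

end Decomposable
end
theorem mainTheorem2 {n : ℕ} (C : Set (Decomposable.PSpace n × Decomposable.PSpace 1))
    (hC : Decomposable.IsIrreducibleCurve C) (hdom : Decomposable.IsDominantProjection C)
    (W : Decomposable.WitnessSet C) (a b : ℕ) (ha : 1 < a) (hb : 1 < b)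
    (hab : Nat.card W.Point = a * b) (hG : Decomposable.IsImprimitive W.galoisGroup)
    (A B : Set W.Point) (hA : A.encard = a) (hB : B.encard = b) :
    -- `A` and `B` are the factors of one decomposition iff (1) and (2) hold
    ((∃ D : Decomposable.Decomposition C, D.IsGeneral W.q ∧ D.IsAlphaFactor A ∧ D.IsBetaFactor B) ↔
      MulAction.IsBlock W.galoisGroup A ∧
        Decomposable.IsSetOfRepresentatives W.galoisGroup A B) ∧
    -- `A` is an `α`-factor iff `A` is a block
    ((∃ D : Decomposable.Decomposition C, D.IsGeneral W.q ∧ D.IsAlphaFactor A) ↔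
      MulAction.IsBlock W.galoisGroup A) ∧
    -- for a decomposition with `α`-factor `A`: `B` is a `β`-factor iff it represents `{γ A}`
    (∀ D : Decomposable.Decomposition C, D.IsGeneral W.q → D.IsAlphaFactor A →
      (D.IsBetaFactor B ↔ Decomposable.IsSetOfRepresentatives W.galoisGroup A B)) := by
  have ha' : 0 < a := by omega
  have hcov := W.isCover hC ha' (by omega) hab
  have h2 : (∃ D : Decomposable.Decomposition C, D.IsGeneral W.q ∧ D.IsAlphaFactor A) ↔
      MulAction.IsBlock W.galoisGroup A :=
    ⟨fun ⟨_, hD, h⟩ => h.isBlock hcov W.q_notMem hD,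
      hcov.exists_isAlphaFactor W.q_notMem ha' (by omega) hA⟩
  have h3 : ∀ D : Decomposable.Decomposition C, D.IsGeneral W.q → D.IsAlphaFactor A →
      (D.IsBetaFactor B ↔ Decomposable.IsSetOfRepresentatives W.galoisGroup A B) :=
    fun _ hD h => h.isBetaFactor_iff hcov W.q_notMem ha' hD hA hB
  -- The first equivalence is formal: the second statement supplies a decomposition with `A` as a
  -- factor, and the third converts the condition on `B` within that same decomposition.
  refine ⟨⟨fun ⟨D, hD, h, h'⟩ => ⟨h2.mp ⟨D, hD, h⟩, (h3 D hD h).mp h'⟩, fun ⟨h, h'⟩ => ?_⟩, h2, h3⟩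
  obtain ⟨D, hD, hDA⟩ := h2.mpr h
  exact ⟨D, hD, hDA, (h3 D hD hDA).mpr h'⟩
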